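/- **Setting.** Let $d\ge 1$. Let $r$ be a probability measure on $\mathbb R$ with $r\{0\}=0$ and $\operatorname{supp} r\subseteq[-c,c]$, $c>0$. Let $\nu$ be a complex measure on $\mathbb R$ with compact support $\operatorname{supp}\nu\subseteq[-c',c']$, $c'>0$, and $\nu(A)=\overline{\nu(-A)}$ for all Borel sets $A$; put $|\nu|=|\Re\nu|+|\Im\nu|$. Let $G\in L^1(\mathbb R^d,dx)$ be real valued and $O(d)$-invariant (a.e.). The trigonometric energy density is the real function $v(t)=\int_{\mathbb R}(1-e^{i\alpha t})\,d\nu(\alpha)$. Let $\Gamma_0^c$ be the set of signed measures $\eta=\sum_j s_j\delta_{x_j}$ on $\mathbb R^d$ with finite support and $|\eta\{x\}|\le c$ for all $x$. For compact $\Lambda\subset\mathbb R^d$ put $U_\Lambda(\eta)=\int_\Lambda v(G*\eta)\,dx$, where $(G*\eta)(x)=\sum_j s_jG(x-x_j)$. Let $F_\Lambda=\sum_{j=1}^N S_j\delta_{Y_j}$ be the Poisson noise in $\Lambda$ with activity $z>0$ and Lévy measure $r$: $N$ is Poisson with mean $z|\Lambda|$ and, given $N$, the $Y_j$ are uniform in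 $\Lambda$, the $S_j$ have law $r$, all independent. For $\beta\in\mathbb R$ the correlation functional is $$\rho_\Lambda(\eta)=1_{\{\operatorname{supp}\eta\subseteq\Lambda\}}\,\frac{\mathbb E\big[e^{-\beta U_\Lambda(\eta+F_\Lambda)}\big]}{\mathbb E\big[e^{-\beta U_\Lambda(F_\Lambda)}\big]}.$$ Put $$C_1=\sup_{y\in\mathbb R^d,\,s\in\operatorname{supp}r}\int_{\mathbb R^d}\int_{\mathbb R}\big|e^{is\alpha G(y-y')}-1\big|\,d|\nu|(\alpha)\,dy',\qquad C_2=\sup_{y'\in\mathbb R^d,\,\alpha\in\operatorname{supp}\nu}\int_{\mathbb R^d}\int_{\mathbb R}\big|e^{is\alpha G(y-y')}-1\big|\,dr(s)\,dy,$$ and let $D\subset\mathbb C^2$ be the polydisc of all $(z,\beta)$ with $|z|<1/(eC_2)$ and $|\beta|<1/(eC_1)$ (where $1/0=\infty$). *Cluster functions (formal two-component Potts model at imaginary temperature).* Consider finite sets $\xi$ of points of two kinds: points $(x,s)\in\mathbb R^d\times\mathbb R$ of the first component and points $(y,\alpha)\in\mathbb R^d\times\mathbb R$ of the second. Let $\Psi(\xi)=\exp\big(i\sum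 s\,\alpha\, G(x-y)\big)$, the sum being over all pairs of a point $(x,s)\in\xi$ of the first and a point $(y,\alpha)\in\xi$ of the second component. Let $(\Psi_1*\Psi_2)(\xi)=\sum_{\tau\subseteq\xi}\Psi_1(\tau)\Psi_2(\xi\setminus\tau)$, let $\Psi^{-1}$ be the $*$-inverse of $\Psi$, let $D_\xi\Psi(\tau)=\Psi(\xi\cup\tau)$ and $\tilde\varphi_\xi=\Psi^{-1}*D_\xi\Psi$. For $\eta=\sum_js_j\delta_{x_j}\in\Gamma_0^c$ (distinct $x_j$, $s_j\neq0$) let $\tilde\varphi_\eta$ be $\tilde\varphi_\xi$ for the set $\xi$ of the points $(x_j,s_j)$ in the first component, and put $$a_{n_1,n_2}(\eta)=\frac1{n_1!\,n_2!}\int\tilde\varphi_\eta(\{q_1,\dots,q_{n_1},q_1',\dots,q_{n_2}'\})\prod_{j=1}^{n_1}dy_j\,dr(s_j)\prod_{k=1}^{n_2}dy_k'\,d\nu(\alpha_k),$$ where $q_j=(y_j,s_j)$ are points of the first and $q_k'=(y_k',\alpha_k)$ points of the second component. **Theorem 6.1.** Under these assumptions, for every $\eta\in\Gamma_0^c$,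 $\tilde\varphi_\eta$ is integrable with respect to $(dy\otimes r)^{n_1}\otimes(dy\otimes|\nu|)^{n_2}$ for all $n_1,n_2\ge0$, and for all $(z,\beta)\in D$ $$\sum_{n_1,n_2\ge0}\frac{|z|^{n_1}|\beta|^{n_2}}{n_1!\,n_2!}\int|\tilde\varphi_\eta|\,d(dy\otimes r)^{n_1}\,d(dy\otimes|\nu|)^{n_2}<\infty .$$ Moreover: (i) For all $z>0$ and $\beta\in\mathbb R$ with $(z,\beta)\in D$ and all $\eta\in\Gamma_0^c$, the infinite-volume limit $\rho(\eta)=\lim_{\Lambda\uparrow\mathbb R^d}\rho_\Lambda(\eta)$ exists, along the compact sets $\Lambda$ directed by inclusion, and is given by the absolutely convergent cluster expansion $\rho(\eta)=\sum_{n_1,n_2}a_{n_1,n_2}(\eta)z^{n_1}\beta^{n_2}$. In particular, for $z$ fixed, the high temperature expansion $\rho(\eta)=\sum_{n_2}\big(\sum_{n_1}a_{n_1,n_2}(\eta)z^{n_1}\big)\beta^{n_2}$ converges. For fixed $\eta$, $\rho(\eta)$ is jointly real analytic in $(z,\beta)$ on $\{(z,\beta)\in D: z>0,\ \beta\in\mathbb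 R\}$ and is the restriction of an analytic function on $D$. (ii) For these $z,\beta$, $\rho$ is invariant under the Euclidean group: $\rho(\eta_{\{g,a\}})=\rho(\eta)$ for all $\eta\in\Gamma_0^c$, $g\in O(d)$, $a\in\mathbb R^d$, where $\eta_{\{g,a\}}=\sum_js_j\delta_{g^{-1}(x_j-a)}$. -/

import Mathlib

open MeasureTheory Filter Topology

noncomputable section

namespace TrigGas

/-- Euclidean space `ℝ^d`. -/
abbrev E (d : ℕ) : Type := EuclideanSpace ℝ (Fin d)

/-- A marked point: a position in `ℝ^d` together with a real mark (a charge). -/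
abbrev MarkedPoint (d : ℕ) : Type := E d × ℝ

/-! ### The interaction measure and the trigonometric energy density -/

/-- The modulus `|ν| = |Re ν| + |Im ν|` of a complex measure on the line. -/
def modulus (ν : ComplexMeasure ℝ) : Measure ℝ :=
  ν.re.totalVariation + ν.im.totalVariation

instance (ν : ComplexMeasure ℝ) : IsFiniteMeasure (modulus ν) := by
  unfold modulus; infer_instance

/-- The density `h = dν / d|ν|`, so that `dν = h d|ν|`. -/
def density (ν : ComplexMeasure ℝ) : ℝ → ℂ := ν.rnDeriv (modulus ν)

/-- `v(t) = ∫ (1 - e^{iαt}) dν(α)` as a complex number. -/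
def energyDensityC (ν : ComplexMeasure ℝ) (t : ℝ) : ℂ :=
  ∫ α, (1 - Complex.exp (Complex.I * ((α * t : ℝ) : ℂ))) * density ν α ∂(modulus ν)

/-- The energy density `v : ℝ → ℝ`. For `ν` with `ν(A) = conj ν(-A)` the number `energyDensityC ν t`
is real (see `energyDensityC_im`), so nothing is lost in taking the real part. -/
def energyDensity (ν : ComplexMeasure ℝ) (t : ℝ) : ℝ := (energyDensityC ν t).re

/-! ### Finite configurations, Poisson noise and correlation functionals -/

/-- `Γ₀^c`: signed measures on `ℝ^d` with finite support and all point masses in `[-c, c]`. The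
finitely supported function `η` stands for the measure `∑ₓ η(x) δₓ`. -/
def Gamma0 (d : ℕ) (c : ℝ) : Set (E d →₀ ℝ) := {η | ∀ x, |η x| ≤ c}

/-- The static field `(G * η)(x) = ∑_y η(y) G(x - y)`. -/
def field {d : ℕ} (G : E d → ℝ) (η : E d →₀ ℝ) (x : E d) : ℝ :=
  η.sum fun y s => s * G (x - y)

/-- The interaction `U_Λ(η) = ∫_Λ v(G * η) dx`. -/
def interaction {d : ℕ} (ν : ComplexMeasure ℝ) (G : E d → ℝ)
    (Λ : TopologicalSpace.Compacts (E d)) (η : E d →₀ ℝ) : ℝ :=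
  ∫ x in (Λ : Set (E d)), energyDensity ν (field G η x)

/-- The configuration `∑_j s_j δ_{y_j}` of a finite family of marked points `(y_j, s_j)`. -/
def config {d : ℕ} (ω : Σ n : ℕ, Fin n → MarkedPoint d) : E d →₀ ℝ :=
  ∑ j, Finsupp.single (ω.2 j).1 (ω.2 j).2

/-- The Poisson noise `F_Λ` with activity `z` and Lévy measure `r` in the volume `Λ`, through the law
of its finite family of marked points: the number of points is Poisson with parameter `z|Λ|`, and,
given that number, the points are independent, uniformly distributed in `Λ`, with independent marks
distributed according to `r`. The noise itself is `F_Λ = config ω` under this law. -/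
def poissonLaw {d : ℕ} (z : ℝ) (r : Measure ℝ) (Λ : TopologicalSpace.Compacts (E d)) :
    Measure (Σ n : ℕ, Fin n → MarkedPoint d) :=
  Measure.sum fun n : ℕ =>
    ENNReal.ofReal (Real.exp (-(z * volume.real (Λ : Set (E d)))) * z ^ n / (n.factorial : ℝ)) •
      (Measure.pi fun _ : Fin n => (volume.restrict (Λ : Set (E d))).prod r).map (Sigma.mk n)

open Classical in
/-- The correlation functional in the volume `Λ`,
`ρ_Λ(η) = 1_{supp η ⊆ Λ} E[exp(-β U_Λ(η + F_Λ))] / E[exp(-β U_Λ(F_Λ))]`. -/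
def corr {d : ℕ} (r : Measure ℝ) (ν : ComplexMeasure ℝ) (G : E d → ℝ) (z β : ℝ)
    (Λ : TopologicalSpace.Compacts (E d)) (η : E d →₀ ℝ) : ℝ :=
  if (η.support : Set (E d)) ⊆ (Λ : Set (E d)) then
    (∫ ω, Real.exp (-β * interaction ν G Λ (η + config ω)) ∂(poissonLaw z r Λ)) /
      (∫ ω, Real.exp (-β * interaction ν G Λ (config ω)) ∂(poissonLaw z r Λ))
  else 0

/-- The action of a Euclidean transformation, `η_{g,a} = ∑_j s_j δ_{g⁻¹(y_j - a)}`. -/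
def euclideanAction {d : ℕ} (g : E d ≃ₗᵢ[ℝ] E d) (a : E d) (η : E d →₀ ℝ) : E d →₀ ℝ :=
  η.mapDomain fun y => g.symm (y - a)

/-! ### The constants that delimit the domain of convergence -/

/-- `C₁ = sup_{y, s ∈ supp r} ∫ ∫ |e^{isαG(y-y')} - 1| d|ν|(α) dy'`. -/
def C₁ {d : ℕ} (r : Measure ℝ) (ν : ComplexMeasure ℝ) (G : E d → ℝ) : ENNReal :=
  ⨆ y : E d, ⨆ s ∈ r.support, ∫⁻ y' : E d, ∫⁻ α : ℝ,
    ‖Complex.exp (Complex.I * ((s * α * G (y - y') : ℝ) : ℂ)) - 1‖ₑ ∂(modulus ν)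

/-- `C₂ = sup_{y', α ∈ supp ν} ∫ ∫ |e^{isαG(y-y')} - 1| dr(s) dy`. -/
def C₂ {d : ℕ} (r : Measure ℝ) (ν : ComplexMeasure ℝ) (G : E d → ℝ) : ENNReal :=
  ⨆ y' : E d, ⨆ α ∈ (modulus ν).support, ∫⁻ y : E d, ∫⁻ s : ℝ,
    ‖Complex.exp (Complex.I * ((s * α * G (y - y') : ℝ) : ℂ)) - 1‖ₑ ∂r

/-- The polydisc of all complex `(z, β)` with `e C₂ |z| < 1` and `e C₁ |β| < 1`, that is,
`|z| < 1/(e C₂)` and `|β| < 1/(e C₁)` with `1/0 = ∞`. -/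
def polydisc {d : ℕ} (r : Measure ℝ) (ν : ComplexMeasure ℝ) (G : E d → ℝ) : Set (ℂ × ℂ) :=
  {p | ENNReal.ofReal (Real.exp 1) * C₂ r ν G * ‖p.1‖ₑ < 1 ∧
       ENNReal.ofReal (Real.exp 1) * C₁ r ν G * ‖p.2‖ₑ < 1}

/-! ### Ruelle's algebra and the cluster expansion of the formal two-component Potts model -/

/-- The `*`-product `(Ψ₁ * Ψ₂)(ξ) = ∑_{τ ⊆ ξ} Ψ₁(τ) Ψ₂(ξ \ τ)` of functions of finite sets. -/
def starMul {ι : Type*} [DecidableEq ι] (Ψ₁ Ψ₂ : Finset ι → ℂ) (ξ : Finset ι) : ℂ :=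
  ∑ τ ∈ ξ.powerset, Ψ₁ τ * Ψ₂ (ξ \ τ)

/-- The inverse `Ψ⁻¹` with respect to the `*`-product of a function with `Ψ(∅) = 1`, by recursion:
`Ψ⁻¹(∅) = 1` and `Ψ⁻¹(ξ) = - ∑_{τ ⊊ ξ} Ψ⁻¹(τ) Ψ(ξ \ τ)` for nonempty `ξ`. -/
def starInv {ι : Type*} [DecidableEq ι] (Ψ : Finset ι → ℂ) (ξ : Finset ι) : ℂ :=
  if ξ = ∅ then 1 else -∑ τ ∈ ξ.ssubsets.attach, starInv Ψ τ.1 * Ψ (ξ \ τ.1)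
termination_by ξ.card
decreasing_by exact Finset.card_lt_card (Finset.mem_ssubsets.1 τ.2)

/-- `starInv Ψ` is the inverse of `Ψ` for the `*`-product. -/
theorem starMul_starInv {ι : Type*} [DecidableEq ι] (Ψ : Finset ι → ℂ) (hΨ : Ψ ∅ = 1)
    (ξ : Finset ι) : starMul (starInv Ψ) Ψ ξ = if ξ = ∅ then 1 else 0 := by
  unfold starMul
  by_cases h : ξ = ∅
  · subst h
    rw [Finset.powerset_empty, Finset.sum_singleton, starInv, if_pos rfl]
    simp [hΨ]
  · have hs : ξ.powerset = insert ξ ξ.ssubsets := by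
      rw [Finset.ssubsets, Finset.insert_erase (Finset.mem_powerset_self ξ)]
    rw [if_neg h, hs, Finset.sum_insert (by simp [Finset.mem_ssubsets]), starInv,
      if_neg h, Finset.sdiff_self, hΨ, mul_one,
      Finset.sum_attach ξ.ssubsets (fun τ => starInv Ψ τ * Ψ (ξ \ τ))]
    ring

/-- The function `φ̃_ξ = Ψ⁻¹ * D_ξ Ψ`, where `(D_ξ Ψ)(τ) = Ψ(ξ ∪ τ)`. -/
def clusterFun {ι : Type*} [DecidableEq ι] (Ψ : Finset ι → ℂ) (ξ τ : Finset ι) : ℂ :=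
  starMul (starInv Ψ) (fun κ => Ψ (ξ ∪ κ)) τ

/-- The pair energy `s α G(x - y)` between a marked point `(x, s)` of the first component (`Sum.inl`)
and a marked point `(y, α)` of the second component (`Sum.inr`); no interaction within a component,
and every pair is counted once. -/
def pairEnergy {d : ℕ} (G : E d → ℝ) :
    MarkedPoint d ⊕ MarkedPoint d → MarkedPoint d ⊕ MarkedPoint d → ℝ
  | Sum.inl p, Sum.inr p' => p.2 * p'.2 * G (p.1 - p'.1)
  | _, _ => 0

/-- The Boltzmann weight `Ψ = e^{iu}` of the formal Potts model at imaginary temperature. The points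
are given by a family `q`, and the weight is a function of the finite sets of indices. -/
def pottsWeight {d : ℕ} {ι : Type*} (G : E d → ℝ) (q : ι → MarkedPoint d ⊕ MarkedPoint d)
    (A : Finset ι) : ℂ :=
  Complex.exp (Complex.I * ((∑ i ∈ A, ∑ j ∈ A, pairEnergy G (q i) (q j) : ℝ) : ℂ))

/-- The points of `η` and `n₁` further points in the first component, `n₂` points in the second. -/
def family {d : ℕ} (η : E d →₀ ℝ) {n₁ n₂ : ℕ}
    (p : (Fin n₁ → MarkedPoint d) × (Fin n₂ → MarkedPoint d)) :
    η.support ⊕ (Fin n₁ ⊕ Fin n₂) → MarkedPoint d ⊕ MarkedPoint d :=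
  Sum.elim (fun x => Sum.inl (x.1, η x.1))
    (Sum.elim (fun i => Sum.inl (p.1 i)) (fun j => Sum.inr (p.2 j)))

open Classical in
/-- `φ̃_{(η,0)}(τ)` for the formal Potts model, `τ` consisting of the `n₁` points `p.1` in the first
component and of the `n₂` points `p.2` in the second. -/
def pottsCluster {d : ℕ} (G : E d → ℝ) (η : E d →₀ ℝ) {n₁ n₂ : ℕ}
    (p : (Fin n₁ → MarkedPoint d) × (Fin n₂ → MarkedPoint d)) : ℂ :=
  clusterFun (pottsWeight G (family η p))
    (Finset.univ.map Function.Embedding.inl) (Finset.univ.map Function.Embedding.inr)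

/-- The positive measure `(dy ⊗ r)^{n₁} ⊗ (dy ⊗ |ν|)^{n₂}`. -/
def clusterMeasure (d : ℕ) (r : Measure ℝ) (ν : ComplexMeasure ℝ) (n₁ n₂ : ℕ) :
    Measure ((Fin n₁ → MarkedPoint d) × (Fin n₂ → MarkedPoint d)) :=
  (Measure.pi fun _ => (volume : Measure (E d)).prod r).prod
    (Measure.pi fun _ => (volume : Measure (E d)).prod (modulus ν))

/-- The coefficient of `z^{n₁} β^{n₂}` in the cluster expansion,
`(n₁! n₂!)⁻¹ ∫ φ̃_{(η,0)} d(dy ⊗ r)^{n₁} d(dy ⊗ ν)^{n₂}`, where `dν = h d|ν|`. -/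
def clusterCoeff {d : ℕ} (r : Measure ℝ) (ν : ComplexMeasure ℝ) (G : E d → ℝ)
    (η : E d →₀ ℝ) (n₁ n₂ : ℕ) : ℂ :=
  ((n₁.factorial : ℂ) * (n₂.factorial : ℂ))⁻¹ *
    ∫ p, pottsCluster G η p * ∏ j, density ν (p.2 j).2 ∂(clusterMeasure d r ν n₁ n₂)

/-! ### Checks of the definitions -/

/-- The density does represent the measure: `h d|ν| = dν`. -/
theorem withDensity_density (ν : ComplexMeasure ℝ) :
    (modulus ν).withDensityᵥ (density ν) = ν := by
  have key : ∀ s : SignedMeasure ℝ, s.totalVariation ≤ modulus ν →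
      (modulus ν).withDensityᵥ (s.rnDeriv (modulus ν)) = s := by
    intro s hs
    apply SignedMeasure.withDensityᵥ_rnDeriv_eq
    rw [SignedMeasure.absolutelyContinuous_ennreal_iff, VectorMeasure.ennrealToMeasure_toENNRealVectorMeasure]
    exact Measure.absolutelyContinuous_of_le hs
  have hre := key ν.re (Measure.le_add_right le_rfl)
  have him := key ν.im (Measure.le_add_left le_rfl)
  ext i hi : 1
  have hI := ν.integrable_rnDeriv (modulus ν)
  unfold density
  rw [withDensityᵥ_apply hI hi]
  apply Complex.ext
  · rw [← RCLike.re_eq_complex_re, ← integral_re hI.integrableOn]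
    have := congrArg (fun m : SignedMeasure ℝ => m i) hre
    beta_reduce at this
    rw [withDensityᵥ_apply (SignedMeasure.integrable_rnDeriv _ _) hi] at this
    exact this
  · rw [← RCLike.im_eq_complex_im, ← integral_im hI.integrableOn]
    have := congrArg (fun m : SignedMeasure ℝ => m i) him
    beta_reduce at this
    rw [withDensityᵥ_apply (SignedMeasure.integrable_rnDeriv _ _) hi] at this
    exact this

/-- `|ν|` is invariant under `α ↦ -α` if `ν(A) = conj ν(-A)`. -/
theorem map_neg_modulus (ν : ComplexMeasure ℝ)
    (hν : ∀ A, MeasurableSet A → ν A = starRingEnd ℂ (ν ((fun α => -α) ⁻¹' A))) :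
    (modulus ν).map (fun α => -α) = modulus ν := by
  have hme : MeasurableEmbedding (fun α : ℝ => -α) := (MeasurableEquiv.neg ℝ).measurableEmbedding
  have h1 : ν.re.map (fun α : ℝ => -α) = ν.re := by
    ext i hi
    rw [VectorMeasure.map_apply _ hme.measurable hi]
    have := congrArg Complex.re (hν i hi)
    rw [Complex.conj_re] at this
    exact this.symm
  have h2 : ν.im.map (fun α : ℝ => -α) = -ν.im := by
    ext i hi
    rw [VectorMeasure.map_apply _ hme.measurable hi]
    have := congrArg Complex.im (hν i hi)
    rw [Complex.conj_im] at this
    change ν.im ((fun α : ℝ => -α) ⁻¹' i) = -(ν.im i)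
    exact neg_eq_iff_eq_neg.1 this.symm
  unfold modulus
  rw [Measure.map_add _ _ hme.measurable]
  congr 1
  · rw [SignedMeasure.totalVariation_eq_variation, ← hme.variation_map, h1]
  · rw [SignedMeasure.totalVariation_eq_variation, ← hme.variation_map, h2,
      VectorMeasure.variation_neg]

/-- For `ν(A) = conj ν(-A)` the energy density is real. -/
theorem energyDensityC_im (ν : ComplexMeasure ℝ)
    (hν : ∀ A, MeasurableSet A → ν A = starRingEnd ℂ (ν ((fun α => -α) ⁻¹' A))) (t : ℝ) :
    (energyDensityC ν t).im = 0 := by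
  have hme : MeasurableEmbedding (fun α : ℝ => -α) := (MeasurableEquiv.neg ℝ).measurableEmbedding
  have hmod := map_neg_modulus ν hν
  have hint : Integrable (density ν) (modulus ν) := ν.integrable_rnDeriv (modulus ν)
  have hint' : Integrable (fun α => density ν (-α)) (modulus ν) := by
    have h := hint
    rw [← hmod, hme.integrable_map_iff] at h
    exact h
  have hconj : density ν =ᵐ[modulus ν] fun α => starRingEnd ℂ (density ν (-α)) := by
    have hint'' : Integrable (fun α => starRingEnd ℂ (density ν (-α))) (modulus ν) :=
      Complex.conjCLE.toContinuousLinearMap.integrable_comp hint'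
    refine hint.ae_eq_of_forall_setIntegral_eq _ _ hint'' ?_
    intro s hs _
    have e1 : ∫ x in s, density ν x ∂(modulus ν) = ν s := by
      rw [← withDensityᵥ_apply hint hs, withDensity_density]
    have e2 : ∫ x in (fun α : ℝ => -α) ⁻¹' s, density ν x ∂(modulus ν)
        = ν ((fun α : ℝ => -α) ⁻¹' s) := by
      rw [← withDensityᵥ_apply hint (hme.measurable hs), withDensity_density]
    rw [e1, hν s hs, ← e2, integral_conj]
    congr 1
    conv_lhs => rw [← hmod]
    rw [hme.setIntegral_map]
    congr 2
    ext x
    simp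
  rw [← Complex.conj_eq_iff_im]
  unfold energyDensityC
  rw [← integral_conj]
  conv_rhs => rw [← hmod, hme.integral_map]
  apply integral_congr_ae
  filter_upwards [hconj] with α hα
  rw [hα]
  simp [← Complex.exp_conj]

/-- The law of the Poisson noise is a probability measure. -/
theorem isProbabilityMeasure_poissonLaw {d : ℕ} (z : ℝ) (hz : 0 ≤ z) (r : Measure ℝ)
    [IsProbabilityMeasure r] (Λ : TopologicalSpace.Compacts (E d)) :
    IsProbabilityMeasure (poissonLaw z r Λ) := by
  constructor
  have hfin : volume (Λ : Set (E d)) ≠ ⊤ := Λ.isCompact.measure_lt_top.ne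
  have hm : ∀ n : ℕ, Measurable (fun x : Fin n → MarkedPoint d =>
      (⟨n, x⟩ : Σ n : ℕ, Fin n → MarkedPoint d)) :=
    fun n => Measurable.of_le_map (iInf_le _ n)
  set V := volume.real (Λ : Set (E d)) with hV
  have hV0 : 0 ≤ V := measureReal_nonneg
  have hvol : volume (Λ : Set (E d)) = ENNReal.ofReal V := by
    rw [hV, Measure.real, ENNReal.ofReal_toReal hfin]
  have : IsFiniteMeasure (volume.restrict (Λ : Set (E d))) :=
    ⟨by simpa using Λ.isCompact.measure_lt_top⟩
  have hterm : ∀ n : ℕ, (ENNReal.ofReal (Real.exp (-(z * V)) * z ^ n / (n.factorial : ℝ)) •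
      (Measure.pi fun _ : Fin n => (volume.restrict (Λ : Set (E d))).prod r).map (Sigma.mk n) :
        Measure (Σ n : ℕ, Fin n → MarkedPoint d)) Set.univ = ENNReal.ofReal (Real.exp (-(z * V)) * ((z * V) ^ n / (n.factorial : ℝ))) := by
    intro n
    rw [Measure.smul_apply, Measure.map_apply (hm n) MeasurableSet.univ, Set.preimage_univ,
      Measure.pi_univ]
    simp only [← Set.univ_prod_univ, Measure.prod_prod, measure_univ, mul_one,
      Measure.restrict_apply_univ, hvol, Finset.prod_const, Finset.card_univ, Fintype.card_fin,
      smul_eq_mul]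
    rw [← ENNReal.ofReal_pow hV0, ← ENNReal.ofReal_mul (by positivity)]
    congr 1
    rw [mul_pow]; ring
  unfold poissonLaw
  rw [Measure.sum_apply _ MeasurableSet.univ]
  simp only [← hV]
  rw [tsum_congr hterm, ← ENNReal.ofReal_tsum_of_nonneg]
  · have := NormedSpace.expSeries_div_hasSum_exp (z * V)
    rw [← Real.exp_eq_exp_ℝ] at this
    rw [tsum_mul_left, this.tsum_eq, ← Real.exp_add]
    simp
  · intro n; positivity
  · exact (Real.summable_pow_div_factorial _).mul_left _

end TrigGas

end

noncomputable section

namespace TrigGas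

/-! ### Identities in Ruelle's algebra -/

/-! The trigonometric form of the energy turns the gas into a formal two-component system. Since
`U_Λ(ζ) = |Λ| ν(ℝ) - ∫_Λ ∫ e^{iα(G*ζ)(y)} dν(α) dy` (`interaction_eq`), the factor `e^{-βU_Λ}` is a
constant times the exponential of a phase integral. Its power series in `β` introduces points `(y',
α)` of a second component, in the same way as the Poisson noise introduces points `(y, s)` with
weight `z`. Up to a prefactor that does not depend on `η`, `E[e^{-βU_Λ(η + F_Λ)}]` is therefore the
grand canonical sum of the weights `Ψ(η ∪ ·)` over systems in `Λ` (`hasSum_partitionFunction`).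

The identity `Ψ * φ̃_η = D_η Ψ` becomes, after integration, a Cauchy product of double power series
(`weightIntegral_eq_sum`). Dividing by the series for `η = 0`, whose sum is positive as an
expectation of an exponential, leaves `ρ_Λ(η)` as the series of the cluster integrals over `Λ`
(`corr_eq_tsum`).

Convergence rests on the Kirkwood-Salsburg recursion `clusterFun_insert`. All pair factors have
modulus one, so no stability estimate is needed, and induction on the number of points gives
`lmarginal_clusterFun_le`. For the model at hand the `L¹` norm of the cluster function is at most
`(n₂ C₂)^{n₁} (|η| K + n₁ C₁)^{n₂}`. Divided by `n₁! n₂!` this is geometric with ratios `e C₂ |z|`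
and `e C₁ |β|`, whence the polydisc (`summable_pottsCluster`).

The same majorant serves every `Λ`, so dominated convergence gives the infinite-volume limit.
Analyticity is that of an absolutely convergent double power series. Euclidean invariance holds
coefficient by coefficient, by a change of variables. All of this is done for a measurable,
pointwise even representative of `G`; nothing in the statement sees the difference on a null set. -/

theorem sum_powerset_map {ι ι' : Type*} (e : ι ↪ ι') (τ : Finset ι)
    (F : Finset ι' → ℂ) :
    ∑ σ ∈ (τ.map e).powerset, F σ = ∑ σ ∈ τ.powerset, F (σ.map e) := by
  symm
  refine Finset.sum_bij (fun σ _ => σ.map e) ?_ ?_ ?_ ?_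
  · intro σ hσ
    simpa using hσ
  · intro σ _ σ' _ h
    exact Finset.map_injective e h
  · intro σ hσ
    obtain ⟨u, hu, rfl⟩ := Finset.subset_map_iff.1 (Finset.mem_powerset.1 hσ)
    exact ⟨u, Finset.mem_powerset.2 hu, rfl⟩
  · intro σ _
    rfl

section Algebra

variable {ι : Type*} [DecidableEq ι]

theorem sum_powerset_sdiff_comm {M : Type*} [AddCommMonoid M] (τ : Finset ι)
    (H : Finset ι → Finset ι → M) :
    ∑ σ ∈ τ.powerset, ∑ κ ∈ (τ \ σ).powerset, H σ κ =
      ∑ κ ∈ τ.powerset, ∑ σ ∈ (τ \ κ).powerset, H σ κ := by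
  apply Finset.sum_comm'
  intro σ κ
  simp only [Finset.mem_powerset, Finset.subset_sdiff]
  constructor
  · rintro ⟨h1, h2, h3⟩
    exact ⟨⟨h1, h3.symm⟩, h2⟩
  · rintro ⟨⟨h1, h3⟩, h2⟩
    exact ⟨h1, h2, h3.symm⟩

theorem sum_powerset_reflect {M : Type*} [AddCommMonoid M] (τ : Finset ι)
    (H : Finset ι → Finset ι → M) :
    ∑ σ ∈ τ.powerset, H σ (τ \ σ) = ∑ σ ∈ τ.powerset, H (τ \ σ) σ := by
  refine Finset.sum_nbij' (fun σ => τ \ σ) (fun σ => τ \ σ) ?_ ?_ ?_ ?_ ?_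
  · intro σ _; simp
  · intro σ _; simp
  · intro σ h; simpa using h
  · intro σ h; simpa using h
  · intro σ h
    rw [Finset.sdiff_sdiff_eq_self (Finset.mem_powerset.1 h)]

theorem starMul_comm (Ψ₁ Ψ₂ : Finset ι → ℂ) : starMul Ψ₁ Ψ₂ = starMul Ψ₂ Ψ₁ := by
  funext ξ
  unfold starMul
  rw [sum_powerset_reflect ξ (fun a b => Ψ₁ a * Ψ₂ b)]
  simp_rw [mul_comm]

/-- Multiplying by `Ψ` undoes the multiplication by the inverse of `Ψ`. -/
theorem starMul_starInv_starMul (Ψ F : Finset ι → ℂ) (hΨ : Ψ ∅ = 1) (τ : Finset ι) :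
    starMul Ψ (starMul (starInv Ψ) F) τ = F τ := by
  have h1 : starMul Ψ (starMul (starInv Ψ) F) τ =
      ∑ κ ∈ τ.powerset, F κ * starMul Ψ (starInv Ψ) (τ \ κ) := by
    rw [starMul_comm (starInv Ψ) F]
    unfold starMul
    simp_rw [Finset.mul_sum]
    -- Choosing the argument `κ` of `F` first leaves `Ψ * Ψ⁻¹` on `τ \ κ`, which is the unit, so
    -- only `κ = τ` will survive.
    rw [sum_powerset_sdiff_comm τ (fun σ κ => Ψ σ * (F κ * starInv Ψ ((τ \ σ) \ κ)))]
    refine Finset.sum_congr rfl fun κ _ => Finset.sum_congr rfl fun σ _ => ?_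
    rw [sdiff_right_comm]
    ring
  rw [h1, starMul_comm Ψ]
  simp_rw [starMul_starInv Ψ hΨ]
  rw [Finset.sum_eq_single τ]
  · simp
  · intro κ hκ hne
    rw [if_neg, mul_zero]
    intro h
    exact hne (Finset.Subset.antisymm (Finset.mem_powerset.1 hκ) (Finset.sdiff_eq_empty_iff_subset.1 h))
  · simp

/-- `Ψ * φ̃_ξ = D_ξ Ψ`. -/
theorem sum_mul_clusterFun (Ψ : Finset ι → ℂ) (hΨ : Ψ ∅ = 1) (ξ τ : Finset ι) :
    ∑ σ ∈ τ.powerset, Ψ σ * clusterFun Ψ ξ (τ \ σ) = Ψ (ξ ∪ τ) :=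
  starMul_starInv_starMul Ψ (fun κ => Ψ (ξ ∪ κ)) hΨ τ

theorem clusterFun_empty_left (Ψ : Finset ι → ℂ) (hΨ : Ψ ∅ = 1) (τ : Finset ι) :
    clusterFun Ψ ∅ τ = if τ = ∅ then 1 else 0 := by
  unfold clusterFun
  simp_rw [Finset.empty_union]
  exact starMul_starInv Ψ hΨ τ

/-- The Kirkwood-Salsburg identity: the root `a` is removed from `insert a ξ`. -/
theorem clusterFun_insert (Ψ : Finset ι → ℂ) (g : ι → ι → ℂ)
    (hg : ∀ a A, a ∉ A → Ψ (insert a A) = Ψ A * ∏ b ∈ A, g a b)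
    (a : ι) (ξ τ : Finset ι) (ha : a ∉ ξ) (hd : Disjoint (insert a ξ) τ) :
    clusterFun Ψ (insert a ξ) τ = (∏ b ∈ ξ, g a b) *
      ∑ κ ∈ τ.powerset, (∏ b ∈ κ, (g a b - 1)) * clusterFun Ψ (ξ ∪ κ) (τ \ κ) := by
  have haτ : a ∉ τ := Finset.disjoint_left.1 hd (Finset.mem_insert_self a ξ)
  have hξτ : Disjoint ξ τ := hd.mono_left (Finset.subset_insert a ξ)
  -- The factors between `a` and `ξ` stay as a prefactor; those between `a` and `ρ` are Mayer
  -- expanded, `g = 1 + (g - 1)`.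
  have h1 : ∀ ρ ⊆ τ, Ψ (insert a ξ ∪ ρ) = (∏ b ∈ ξ, g a b) *
      ∑ κ ∈ ρ.powerset, (∏ b ∈ κ, (g a b - 1)) * Ψ (ξ ∪ ρ) := by
    intro ρ hρ
    have : a ∉ ξ ∪ ρ := by
      simp only [Finset.mem_union, not_or]
      exact ⟨ha, fun h => haτ (hρ h)⟩
    rw [Finset.insert_union, hg a _ this, Finset.prod_union (hξτ.mono_right hρ), ← Finset.sum_mul]
    have : ∏ b ∈ ρ, g a b = ∑ κ ∈ ρ.powerset, ∏ b ∈ κ, (g a b - 1) := by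
      rw [← Finset.prod_add_one]
      simp
    rw [this]
    ring
  unfold clusterFun starMul
  have h2 : ∀ σ ∈ τ.powerset, starInv Ψ σ * Ψ (insert a ξ ∪ τ \ σ) =
      (∏ b ∈ ξ, g a b) * ∑ κ ∈ (τ \ σ).powerset,
        starInv Ψ σ * ((∏ b ∈ κ, (g a b - 1)) * Ψ (ξ ∪ τ \ σ)) := by
    intro σ _
    rw [h1 _ Finset.sdiff_subset, ← Finset.mul_sum]
    ring
  -- With the neighbours `κ` of the root chosen first, the remaining sum over `σ ⊆ τ \ κ` is the
  -- cluster function of `ξ ∪ κ`, because `ξ ∪ κ ∪ ((τ \ κ) \ σ) = ξ ∪ (τ \ σ)`.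
  rw [Finset.sum_congr rfl h2, ← Finset.mul_sum,
    sum_powerset_sdiff_comm τ
      (fun σ κ => starInv Ψ σ * ((∏ b ∈ κ, (g a b - 1)) * Ψ (ξ ∪ τ \ σ)))]
  congr 1
  refine Finset.sum_congr rfl fun κ hκ => ?_
  rw [Finset.mul_sum]
  refine Finset.sum_congr rfl fun σ hσ => ?_
  have : ξ ∪ κ ∪ (τ \ κ) \ σ = ξ ∪ τ \ σ := by
    rw [Finset.mem_powerset] at hκ hσ
    rw [Finset.union_assoc]
    congr 1
    ext x
    have h1 := @hκ x
    have h2 := @hσ x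
    simp only [Finset.mem_union, Finset.mem_sdiff] at *
    tauto
  beta_reduce
  rw [this]
  ring

theorem map_sdiff_embedding {ι' : Type*} [DecidableEq ι'] (e : ι ↪ ι') (A B : Finset ι) :
    (A \ B).map e = A.map e \ B.map e := by
  ext x
  simp only [Finset.mem_map, Finset.mem_sdiff]
  constructor
  · rintro ⟨y, ⟨h1, h2⟩, rfl⟩
    refine ⟨⟨y, h1, rfl⟩, ?_⟩
    rintro ⟨y', h', h''⟩
    exact h2 (e.injective h'' ▸ h')
  · rintro ⟨⟨y, h1, rfl⟩, h2⟩
    exact ⟨y, ⟨h1, fun h => h2 ⟨y, h, rfl⟩⟩, rfl⟩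

theorem starMul_map {ι' : Type*} [DecidableEq ι'] (e : ι ↪ ι') (Ψ₁ Ψ₂ : Finset ι' → ℂ)
    (ξ : Finset ι) : starMul Ψ₁ Ψ₂ (ξ.map e) =
      starMul (fun A => Ψ₁ (A.map e)) (fun A => Ψ₂ (A.map e)) ξ := by
  unfold starMul
  rw [sum_powerset_map]
  simp_rw [map_sdiff_embedding]

/-- Both sides solve the same triangular system `Ψ⁻¹ * Ψ = 1`, in which the top term has coefficient
`Ψ ∅ = 1`; induction on subsets identifies them. -/
theorem starInv_map {ι' : Type*} [DecidableEq ι'] (e : ι ↪ ι') (Ψ : Finset ι' → ℂ)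
    (hΨ : Ψ ∅ = 1) (ξ : Finset ι) :
    starInv Ψ (ξ.map e) = starInv (fun A => Ψ (A.map e)) ξ := by
  have h0 : (fun A : Finset ι => Ψ (A.map e)) ∅ = 1 := by simpa using hΨ
  induction ξ using Finset.strongInduction with
  | H ξ ih =>
    have h1 := starMul_starInv Ψ hΨ (ξ.map e)
    have h2 := starMul_starInv (fun A => Ψ (A.map e)) h0 ξ
    rw [starMul_map] at h1
    simp only [Finset.map_eq_empty] at h1
    rw [← h2] at h1
    unfold starMul at h1
    have hs : ξ.powerset = insert ξ ξ.ssubsets := by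
      rw [Finset.ssubsets, Finset.insert_erase (Finset.mem_powerset_self ξ)]
    rw [hs, Finset.sum_insert (by simp [Finset.mem_ssubsets]),
      Finset.sum_insert (by simp [Finset.mem_ssubsets])] at h1
    beta_reduce at h1
    rw [Finset.sum_congr rfl (fun σ hσ => by rw [ih σ (Finset.mem_ssubsets.1 hσ)])] at h1
    simpa [hΨ] using h1

/-- Cluster functions are natural with respect to relabellings of the points. -/
theorem clusterFun_map {ι' : Type*} [DecidableEq ι'] (e : ι ↪ ι') (Ψ : Finset ι' → ℂ)
    (hΨ : Ψ ∅ = 1) (ξ τ : Finset ι) :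
    clusterFun Ψ (ξ.map e) (τ.map e) = clusterFun (fun A => Ψ (A.map e)) ξ τ := by
  unfold clusterFun
  rw [starMul_map]
  simp_rw [starInv_map e Ψ hΨ, Finset.map_union]

end Algebra

/-! ### The tree estimate -/

theorem lintegral_fintype_prod {ι : Type*} [Fintype ι] {X : ι → Type*}
    [∀ i, MeasurableSpace (X i)] (μ : ∀ i, Measure (X i)) [∀ i, SigmaFinite (μ i)]
    (f : ∀ i, X i → ENNReal) (hf : ∀ i, Measurable (f i)) :
    ∫⁻ x, ∏ i, f i (x i) ∂(Measure.pi μ) = ∏ i, ∫⁻ x, f i x ∂(μ i) := by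
  classical
  by_cases hX : Nonempty (∀ i, X i)
  swap
  · rw [not_nonempty_iff] at hX
    rw [lintegral_of_isEmpty]
    obtain ⟨i, hi⟩ := isEmpty_pi.1 hX
    symm
    apply Finset.prod_eq_zero (Finset.mem_univ i)
    rw [lintegral_of_isEmpty]
  obtain ⟨x₀⟩ := hX
  -- Tonelli, one coordinate at a time: the induction is over the set of coordinates already
  -- integrated.
  have key : ∀ s : Finset ι, ∀ x : ∀ i, X i, (∫⋯∫⁻_s, fun x => ∏ i ∈ s, f i (x i) ∂μ) x =
      ∏ i ∈ s, ∫⁻ y, f i y ∂(μ i) := by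
    intro s
    induction s using Finset.induction_on with
    | empty => intro x; simp
    | insert a s ha ih =>
      intro x
      have hm : ∀ t : Finset ι, Measurable fun x : ∀ i, X i => ∏ i ∈ t, f i (x i) :=
        fun t => Finset.measurable_prod t fun i _ => (hf i).comp (measurable_pi_apply i)
      rw [lmarginal_insert' _ (hm _) ha, Finset.prod_insert ha, ← ih x]
      simp_rw [Finset.prod_insert ha, Function.update_self]
      have : ∀ x : ∀ i, X i, ∀ y : X a,
          ∏ i ∈ s, f i (Function.update x a y i) = ∏ i ∈ s, f i (x i) := by
        intro x y
        refine Finset.prod_congr rfl fun i hi => ?_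
        rw [Function.update_of_ne (by rintro rfl; exact ha hi)]
      simp_rw [this]
      have h2 : ∀ x : ∀ i, X i, ∫⁻ y, f a y * ∏ i ∈ s, f i (x i) ∂(μ a) =
          (∫⁻ y, f a y ∂(μ a)) * ∏ i ∈ s, f i (x i) :=
        fun x => lintegral_mul_const _ (hf a)
      simp_rw [h2]
      unfold lmarginal
      rw [lintegral_const_mul]
      exact (hm s).comp measurable_updateFinset
  rw [lintegral_eq_lmarginal_univ x₀, key]

section Estimate

variable {ι : Type*} [DecidableEq ι]

theorem measurable_starInv {Ω : Type*} [MeasurableSpace Ω] (Ψ : Ω → Finset ι → ℂ)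
    (h : ∀ A, Measurable fun x => Ψ x A) (ξ : Finset ι) :
    Measurable fun x => starInv (Ψ x) ξ := by
  induction ξ using Finset.strongInduction with
  | H ξ ih =>
    by_cases h0 : ξ = ∅
    · have : (fun x => starInv (Ψ x) ξ) = fun _ => 1 := by
        funext x
        rw [starInv, if_pos h0]
      rw [this]
      exact measurable_const
    · have : (fun x => starInv (Ψ x) ξ) =
          fun x => -∑ τ ∈ ξ.ssubsets.attach, starInv (Ψ x) τ.1 * Ψ x (ξ \ τ.1) := by
        funext x
        rw [starInv, if_neg h0]
      rw [this]
      exact (Finset.measurable_sum _ fun τ _ =>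
        (ih τ.1 (Finset.mem_ssubsets.1 τ.2)).mul (h _)).neg

theorem measurable_clusterFun {Ω : Type*} [MeasurableSpace Ω] (Ψ : Ω → Finset ι → ℂ)
    (h : ∀ A, Measurable fun x => Ψ x A) (ξ τ : Finset ι) :
    Measurable fun x => clusterFun (Ψ x) ξ τ := by
  unfold clusterFun starMul
  exact Finset.measurable_sum _ fun σ _ => (measurable_starInv Ψ h σ).mul (h _)

/-- With the root frozen, its Mayer factors to distinct neighbours depend on distinct coordinates
and integrate independently. -/
theorem lmarginal_prod_kernel_le {X : Type*} [MeasurableSpace X] (μ : ι → Measure X)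
    [∀ i, SigmaFinite (μ i)] (κ : Finset ι) (k : ι → X → ENNReal) (hk : ∀ b, Measurable (k b))
    (B : ι → ENNReal) (hB : ∀ b, ∫⁻ y, k b y ∂(μ b) ≤ B b) (x : ι → X) :
    (∫⋯∫⁻_κ, fun x => ∏ b ∈ κ, k b (x b) ∂μ) x ≤ ∏ b ∈ κ, B b := by
  unfold lmarginal
  have h : ∀ y : (i : κ) → X, ∏ b ∈ κ, k b (Function.updateFinset x κ y b) =
      ∏ b : κ, k b (y b) := by
    intro y
    rw [← Finset.prod_coe_sort]
    refine Finset.prod_congr rfl fun b _ => ?_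
    simp [Function.updateFinset]
  simp_rw [h]
  rw [lintegral_fintype_prod (fun i : κ => μ i) (fun b : κ => k b) (fun b => hk b),
    Finset.prod_coe_sort κ (fun b => ∫⁻ y, k b y ∂(μ b))]
  exact Finset.prod_le_prod' fun b _ => hB b

/-- The tree estimate for cluster functions with factors of modulus at most one. -/
theorem lmarginal_clusterFun_le {X : Type*} [MeasurableSpace X] (μ : ι → Measure X)
    [∀ i, SigmaFinite (μ i)] (Ψ : (ι → X) → Finset ι → ℂ) (g : ι → ι → X → X → ℂ)
    (hΨ : ∀ x, Ψ x ∅ = 1) (hΨm : ∀ A, Measurable fun x => Ψ x A)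
    (hg : ∀ x a A, a ∉ A → Ψ x (insert a A) = Ψ x A * ∏ b ∈ A, g a b (x a) (x b))
    (hgm : ∀ a b, Measurable (Function.uncurry (g a b))) (hg1 : ∀ a b s t, ‖g a b s t‖ ≤ 1)
    (B : ι → ι → ENNReal) (hB : ∀ a b s, ∫⁻ t, ‖g a b s t - 1‖ₑ ∂(μ b) ≤ B a b)
    (ξ τ : Finset ι) (hd : Disjoint ξ τ) (x : ι → X) :
    (∫⋯∫⁻_τ, fun x => ‖clusterFun (Ψ x) ξ τ‖ₑ ∂μ) x ≤ ∏ j ∈ τ, ∑ i ∈ ξ ∪ τ, B i j := by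
  -- Removing the root lowers `|ξ ∪ τ|` by one, since its neighbours `κ` only move from `τ` to `ξ`.
  -- The base point `x` varies too, so the bound is uniform in the frozen coordinates.
  induction hn : (ξ ∪ τ).card generalizing ξ τ x with
  | zero =>
    rw [Finset.card_eq_zero, Finset.union_eq_empty] at hn
    obtain ⟨rfl, rfl⟩ := hn
    rw [lmarginal_empty]
    simp [clusterFun_empty_left _ (hΨ x)]
  | succ n ih =>
    -- Without a root the cluster function vanishes on nonempty `τ`.
    rcases Finset.eq_empty_or_nonempty ξ with rfl | ⟨a, haξ⟩
    · have hτ : τ ≠ ∅ := by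
        rintro rfl
        simp at hn
      have : (fun x => ‖clusterFun (Ψ x) ∅ τ‖ₑ) = fun _ => 0 := by
        funext x
        rw [clusterFun_empty_left _ (hΨ x), if_neg hτ, enorm_zero]
      rw [this]
      simp [lmarginal]
    obtain ⟨ζ, haζ, rfl⟩ : ∃ ζ, a ∉ ζ ∧ insert a ζ = ξ :=
      ⟨ξ.erase a, Finset.notMem_erase a ξ, Finset.insert_erase haξ⟩
    have haτ : a ∉ τ := Finset.disjoint_left.1 hd haξ
    have hζτ : Disjoint ζ τ := hd.mono_left (Finset.subset_insert a ζ)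
    have hcard : (ζ ∪ τ).card = n := by
      rw [Finset.insert_union, Finset.card_insert_of_notMem (by simp [haζ, haτ])] at hn
      omega
    have hmφ : ∀ ξ' τ', Measurable fun x => ‖clusterFun (Ψ x) ξ' τ'‖ₑ :=
      fun ξ' τ' => (measurable_clusterFun Ψ hΨm ξ' τ').enorm
    have hmk : ∀ κ : Finset ι, Measurable fun x : ι → X =>
        ∏ b ∈ κ, ‖g a b (x a) (x b) - 1‖ₑ := by
      intro κ
      refine Finset.measurable_prod κ fun b _ => ?_
      have hab : Measurable fun x : ι → X => (x a, x b) :=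
        (measurable_pi_apply a).prodMk (measurable_pi_apply b)
      exact (((hgm a b).comp hab).sub_const 1).enorm
    have hpt : ∀ x, ‖clusterFun (Ψ x) (insert a ζ) τ‖ₑ ≤
        ∑ κ ∈ τ.powerset, (∏ b ∈ κ, ‖g a b (x a) (x b) - 1‖ₑ) *
          ‖clusterFun (Ψ x) (ζ ∪ κ) (τ \ κ)‖ₑ := by
      intro x
      rw [clusterFun_insert (Ψ x) (fun a b => g a b (x a) (x b)) (hg x) a ζ τ haζ hd, enorm_mul]
      -- The prefactor between the root and the other points of `ξ` is a product of numbers of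
      -- modulus at most one. This replaces the stability assumption of the usual cluster
      -- expansions.
      calc _ ≤ 1 * ‖∑ κ ∈ τ.powerset, (∏ b ∈ κ, (g a b (x a) (x b) - 1)) *
              clusterFun (Ψ x) (ζ ∪ κ) (τ \ κ)‖ₑ := by
            gcongr
            rw [← ofReal_norm, norm_prod, ENNReal.ofReal_le_one]
            exact Finset.prod_le_one (fun _ _ => norm_nonneg _) fun b _ => hg1 _ _ _ _
        _ ≤ _ := by
            rw [one_mul]
            refine (enorm_sum_le _ _).trans (le_of_eq ?_)
            refine Finset.sum_congr rfl fun κ _ => ?_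
            rw [enorm_mul]
            congr 1
            simp only [← ofReal_norm, norm_prod]
            rw [ENNReal.ofReal_prod_of_nonneg fun _ _ => norm_nonneg _]
    calc (∫⋯∫⁻_τ, fun x => ‖clusterFun (Ψ x) (insert a ζ) τ‖ₑ ∂μ) x
        ≤ (∫⋯∫⁻_τ, fun x => ∑ κ ∈ τ.powerset, (∏ b ∈ κ, ‖g a b (x a) (x b) - 1‖ₑ) *
          ‖clusterFun (Ψ x) (ζ ∪ κ) (τ \ κ)‖ₑ ∂μ) x := lmarginal_mono (fun x => hpt x) x
      _ = ∑ κ ∈ τ.powerset, (∫⋯∫⁻_τ, fun x => (∏ b ∈ κ, ‖g a b (x a) (x b) - 1‖ₑ) *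
          ‖clusterFun (Ψ x) (ζ ∪ κ) (τ \ κ)‖ₑ ∂μ) x := by
          unfold lmarginal
          rw [lintegral_finsetSum]
          intro κ _
          exact ((hmk κ).mul (hmφ _ _)).comp measurable_updateFinset
      _ ≤ ∑ κ ∈ τ.powerset, (∏ b ∈ κ, B a b) * ∏ j ∈ τ \ κ, ∑ i ∈ ζ ∪ τ, B i j := by
          refine Finset.sum_le_sum fun κ hκ => ?_
          rw [Finset.mem_powerset] at hκ
          have hu : ζ ∪ κ ∪ τ \ κ = ζ ∪ τ := by
            rw [Finset.union_assoc, Finset.union_sdiff_of_subset hκ]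
          have hd' : Disjoint (ζ ∪ κ) (τ \ κ) := by
            rw [Finset.disjoint_union_left]
            exact ⟨hζτ.mono_right Finset.sdiff_subset, Finset.disjoint_sdiff⟩
          -- The points of `τ \ κ` are integrated first. The Mayer factors involve only `a` and `κ`,
          -- so they are constants here and the induction hypothesis applies.
          have hin : ∀ x, (∫⋯∫⁻_(τ \ κ), fun x => (∏ b ∈ κ, ‖g a b (x a) (x b) - 1‖ₑ) *
              ‖clusterFun (Ψ x) (ζ ∪ κ) (τ \ κ)‖ₑ ∂μ) x ≤
              (∏ b ∈ κ, ‖g a b (x a) (x b) - 1‖ₑ) * ∏ j ∈ τ \ κ, ∑ i ∈ ζ ∪ τ, B i j := by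
            intro x
            have := ih (ζ ∪ κ) (τ \ κ) hd' x (by rw [hu, hcard])
            rw [hu] at this
            refine le_trans (le_of_eq ?_) (mul_le_mul_right this _)
            unfold lmarginal
            rw [← lintegral_const_mul]
            · refine lintegral_congr fun y => ?_
              beta_reduce
              congr 1
              refine Finset.prod_congr rfl fun b hb => ?_
              have h1 : Function.updateFinset x (τ \ κ) y a = x a := by
                simp [Function.updateFinset, haτ]
              have h2 : Function.updateFinset x (τ \ κ) y b = x b := by
                simp [Function.updateFinset, hb]
              rw [h1, h2]
            · exact (hmφ _ _).comp measurable_updateFinset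
          have haκ : a ∉ κ := fun h => haτ (hκ h)
          have hsplit : ∀ F : (ι → X) → ENNReal, Measurable F →
              ∫⋯∫⁻_τ, F ∂μ = ∫⋯∫⁻_κ, ∫⋯∫⁻_(τ \ κ), F ∂μ ∂μ := by
            intro F hF
            rw [← lmarginal_union _ _ hF Finset.disjoint_sdiff, Finset.union_sdiff_of_subset hκ]
          refine (le_of_eq (congrFun (hsplit _ ((hmk κ).mul (hmφ (ζ ∪ κ) (τ \ κ)))) x)).trans ?_
          refine (lmarginal_mono hin x).trans ?_
          have h3 := lmarginal_prod_kernel_le μ κ (fun b t => ‖g a b (x a) t - 1‖ₑ)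
            (fun b => (((hgm a b).comp measurable_prodMk_left).sub_const 1).enorm)
            (B a) (fun b => hB a b (x a)) x
          refine le_trans (le_of_eq ?_) (mul_le_mul_left h3 _)
          unfold lmarginal
          rw [← lintegral_mul_const]
          · refine lintegral_congr fun y => ?_
            have h1 : Function.updateFinset x κ y a = x a := by
              simp [Function.updateFinset, haκ]
            beta_reduce
            rw [h1]
          · have hm' : Measurable fun x' : ι → X => ∏ b ∈ κ, ‖g a b (x a) (x' b) - 1‖ₑ :=
              Finset.measurable_prod _ fun b _ =>
                ((((hgm a b).comp measurable_prodMk_left).sub_const 1).enorm).comp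
                  (measurable_pi_apply b)
            exact hm'.comp measurable_updateFinset
      _ = ∏ j ∈ τ, ∑ i ∈ insert a ζ ∪ τ, B i j := by
          -- The bound reproduces itself exactly: the sum over `κ` expands `∏ j, (B a j + ∑ i ∈ ζ ∪
          -- τ, B i j)`. It sums over all maps `τ → ξ ∪ τ`, an overcount of rooted forests that is
          -- simpler to handle.
          rw [← Finset.prod_add]
          refine Finset.prod_congr rfl fun j _ => ?_
          rw [Finset.insert_union, Finset.sum_insert (by simp [haζ, haτ])]

end Estimate

/-! ### The weights of the formal Potts model -/

section Weight

variable {d : ℕ}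

/-- Padding the charges of the wrong component by zero removes the case distinction and makes
measurability on the sum type a matter of composition. -/
theorem pairEnergy_eq (G : E d → ℝ) (u v : MarkedPoint d ⊕ MarkedPoint d) :
    pairEnergy G u v = Sum.elim Prod.snd (fun _ => 0) u * Sum.elim (fun _ => 0) Prod.snd v *
      G (Sum.elim Prod.fst Prod.fst u - Sum.elim Prod.fst Prod.fst v) := by
  rcases u with u | u <;> rcases v with v | v <;> simp [pairEnergy]

theorem measurable_pairEnergy {G : E d → ℝ} (hG : Measurable G) {Ω : Type*} [MeasurableSpace Ω]
    {u v : Ω → MarkedPoint d ⊕ MarkedPoint d} (hu : Measurable u) (hv : Measurable v) :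
    Measurable fun x => pairEnergy G (u x) (v x) := by
  have h1 : Measurable (Sum.elim Prod.snd (fun _ => 0) : MarkedPoint d ⊕ MarkedPoint d → ℝ) :=
    measurable_snd.sumElim measurable_const
  have h2 : Measurable (Sum.elim (fun _ => 0) Prod.snd : MarkedPoint d ⊕ MarkedPoint d → ℝ) :=
    measurable_const.sumElim measurable_snd
  have h3 : Measurable (Sum.elim Prod.fst Prod.fst : MarkedPoint d ⊕ MarkedPoint d → E d) :=
    measurable_fst.sumElim measurable_fst
  simp_rw [pairEnergy_eq]
  exact ((h1.comp hu).mul (h2.comp hv)).mul (hG.comp ((h3.comp hu).sub (h3.comp hv)))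

theorem pairEnergy_self (G : E d → ℝ) (u : MarkedPoint d ⊕ MarkedPoint d) :
    pairEnergy G u u = 0 := by
  rcases u with u | u <;> rfl

/-- The factor of the Boltzmann weight that belongs to an unordered pair of points. -/
def pairFactor (G : E d → ℝ) (u v : MarkedPoint d ⊕ MarkedPoint d) : ℂ :=
  Complex.exp (Complex.I * ((pairEnergy G u v + pairEnergy G v u : ℝ) : ℂ))

theorem norm_pairFactor (G : E d → ℝ) (u v : MarkedPoint d ⊕ MarkedPoint d) :
    ‖pairFactor G u v‖ = 1 := Complex.norm_exp_I_mul_ofReal _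

variable {ι : Type*}

theorem pottsWeight_empty (G : E d → ℝ) (q : ι → MarkedPoint d ⊕ MarkedPoint d) :
    pottsWeight G q ∅ = 1 := by
  simp [pottsWeight]

theorem norm_pottsWeight (G : E d → ℝ) (q : ι → MarkedPoint d ⊕ MarkedPoint d) (A : Finset ι) :
    ‖pottsWeight G q A‖ = 1 := Complex.norm_exp_I_mul_ofReal _

/-- The new index enters the double sum once in each order, and the diagonal vanishes. For two given
points at most one order carries energy, which is why `pairFactor` adds both. -/
theorem pottsWeight_insert [DecidableEq ι] (G : E d → ℝ)
    (q : ι → MarkedPoint d ⊕ MarkedPoint d) (a : ι) (A : Finset ι) (ha : a ∉ A) :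
    pottsWeight G q (insert a A) = pottsWeight G q A * ∏ b ∈ A, pairFactor G (q a) (q b) := by
  unfold pottsWeight pairFactor
  rw [← Complex.exp_sum, ← Complex.exp_add]
  congr 1
  rw [← Finset.mul_sum, ← mul_add]
  congr 1
  rw [← Complex.ofReal_sum, ← Complex.ofReal_add]
  congr 1
  simp_rw [Finset.sum_insert ha, Finset.sum_add_distrib, pairEnergy_self]
  ring

theorem pottsWeight_map {ι' : Type*} (G : E d → ℝ) (q : ι' → MarkedPoint d ⊕ MarkedPoint d)
    (e : ι ↪ ι') (A : Finset ι) :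
    pottsWeight G q (A.map e) = pottsWeight G (q ∘ e) A := by
  simp [pottsWeight]

theorem measurable_pottsWeight {G : E d → ℝ} (hG : Measurable G) {Ω : Type*} [MeasurableSpace Ω]
    {q : Ω → ι → MarkedPoint d ⊕ MarkedPoint d} (hq : ∀ i, Measurable fun x => q x i)
    (A : Finset ι) : Measurable fun x => pottsWeight G (q x) A := by
  unfold pottsWeight
  refine Complex.measurable_exp.comp (measurable_const.mul (Complex.measurable_ofReal.comp ?_))
  exact Finset.measurable_sum _ fun i _ => Finset.measurable_sum _ fun j _ =>
    measurable_pairEnergy hG (hq i) (hq j)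

theorem pottsWeight_congr {G G' : E d → ℝ} {q q' : ι → MarkedPoint d ⊕ MarkedPoint d}
    (h : ∀ i j, pairEnergy G (q i) (q j) = pairEnergy G' (q' i) (q' j)) :
    pottsWeight G q = pottsWeight G' q' := by
  funext A
  unfold pottsWeight
  simp_rw [h]

theorem measurable_family (η : E d →₀ ℝ) {n₁ n₂ : ℕ} (i : η.support ⊕ (Fin n₁ ⊕ Fin n₂)) :
    Measurable fun p : (Fin n₁ → MarkedPoint d) × (Fin n₂ → MarkedPoint d) => family η p i := by
  rcases i with i | i | i
  · exact measurable_const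
  · exact measurable_inl.comp ((measurable_pi_apply i).comp measurable_fst)
  · exact measurable_inr.comp ((measurable_pi_apply i).comp measurable_snd)

theorem measurable_pottsCluster {G : E d → ℝ} (hG : Measurable G) (η : E d →₀ ℝ) (n₁ n₂ : ℕ) :
    Measurable fun p : (Fin n₁ → MarkedPoint d) × (Fin n₂ → MarkedPoint d) =>
      pottsCluster G η p := by
  classical
  unfold pottsCluster
  exact measurable_clusterFun _ (fun A => measurable_pottsWeight hG (measurable_family η) A) _ _

theorem pottsCluster_congr {G G' : E d → ℝ} {η : E d →₀ ℝ} {n₁ n₂ : ℕ}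
    {p p' : (Fin n₁ → MarkedPoint d) × (Fin n₂ → MarkedPoint d)}
    (h : ∀ i j, pairEnergy G (family η p i) (family η p j) =
      pairEnergy G' (family η p' i) (family η p' j)) :
    pottsCluster G η p = pottsCluster G' η p' := by
  unfold pottsCluster
  rw [pottsWeight_congr h]

end Weight

/-! ### The constants -/

section Constants

variable {d : ℕ} (r : Measure ℝ) (ν : ComplexMeasure ℝ) (G : E d → ℝ)

/-- The modulus of the Mayer factor `e^{isαG(x-y)} - 1`. -/
def mayer (G : E d → ℝ) (p p' : MarkedPoint d) : ENNReal :=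
  ‖Complex.exp (Complex.I * ((p.2 * p'.2 * G (p.1 - p'.1) : ℝ) : ℂ)) - 1‖ₑ

variable {G} in
theorem measurable_mayer (hG : Measurable G) {Ω : Type*} [MeasurableSpace Ω]
    {p p' : Ω → MarkedPoint d} (hp : Measurable p) (hp' : Measurable p') :
    Measurable fun x => mayer G (p x) (p' x) := by
  unfold TrigGas.mayer
  have : Measurable fun x => (p x).2 * (p' x).2 * G ((p x).1 - (p' x).1) :=
    ((measurable_snd.comp hp).mul (measurable_snd.comp hp')).mul
      (hG.comp ((measurable_fst.comp hp).sub (measurable_fst.comp hp')))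
  exact ((Complex.measurable_exp.comp (measurable_const.mul
    (Complex.measurable_ofReal.comp this))).sub_const 1).enorm

variable {G} in
theorem measurable_mayer_left (hG : Measurable G) (p : MarkedPoint d) :
    Measurable fun p' => mayer G p p' :=
  measurable_mayer hG measurable_const measurable_id

variable {G} in
theorem measurable_mayer_right (hG : Measurable G) (p' : MarkedPoint d) :
    Measurable fun p => mayer G p p' :=
  measurable_mayer hG measurable_id measurable_const

/-- From `|e^{it} - 1| ≤ |t|`; this is how `G ∈ L¹` and bounded marks make `C₁` and `C₂` finite. -/
theorem mayer_le (p p' : MarkedPoint d) :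
    mayer G p p' ≤ ‖p.2‖ₑ * ‖p'.2‖ₑ * ‖G (p.1 - p'.1)‖ₑ := by
  unfold mayer
  refine Real.enorm_exp_I_mul_ofReal_sub_one_le.trans (le_of_eq ?_)
  rw [enorm_mul, enorm_mul]

theorem mayer_zero_left (y : E d) (p' : MarkedPoint d) : mayer G (y, 0) p' = 0 := by
  simp [mayer]

theorem mayer_zero_right (y : E d) (p : MarkedPoint d) : mayer G p (y, 0) = 0 := by
  simp [mayer]

variable {G} in
theorem lintegral_mayer_le_C₁ (hG : Measurable G) (y : E d) {s : ℝ} (hs : s ∈ r.support) :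
    ∫⁻ p', mayer G (y, s) p' ∂((volume : Measure (E d)).prod (modulus ν)) ≤ C₁ r ν G := by
  rw [lintegral_prod _ (measurable_mayer_left hG _).aemeasurable]
  exact le_iSup_of_le y (le_iSup₂_of_le s hs le_rfl)

variable {G} in
theorem lintegral_mayer_le_C₂ (hG : Measurable G) [SFinite r] (y : E d) {α : ℝ}
    (hα : α ∈ (modulus ν).support) :
    ∫⁻ p, mayer G p (y, α) ∂((volume : Measure (E d)).prod r) ≤ C₂ r ν G := by
  rw [lintegral_prod _ (measurable_mayer_right hG _).aemeasurable]
  exact le_iSup_of_le y (le_iSup₂_of_le α hα le_rfl)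

variable {G} in
theorem lintegral_mayer_le_first (hG : Measurable G) (y : E d) (s : ℝ) :
    ∫⁻ p', mayer G (y, s) p' ∂((volume : Measure (E d)).prod (modulus ν)) ≤
      ‖s‖ₑ * (∫⁻ α, ‖α‖ₑ ∂(modulus ν)) * ∫⁻ x, ‖G x‖ₑ := by
  calc _ ≤ ∫⁻ p' : MarkedPoint d, ‖G (y - p'.1)‖ₑ * (‖s‖ₑ * ‖p'.2‖ₑ) ∂(volume.prod (modulus ν)) := by
        refine lintegral_mono fun p' => (mayer_le G _ _).trans (le_of_eq ?_)
        rw [mul_comm]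
    _ = _ := by
        rw [lintegral_prod_mul (f := fun x : E d => ‖G (y - x)‖ₑ) (g := fun α : ℝ => ‖s‖ₑ * ‖α‖ₑ)
          (hG.comp (measurable_const.sub measurable_id)).enorm.aemeasurable
          (measurable_enorm.const_mul _).aemeasurable,
          lintegral_sub_left_eq_self (fun x => ‖G x‖ₑ) y,
          lintegral_const_mul _ measurable_enorm]
        ring

variable {G} in
theorem lintegral_mayer_le_second (hG : Measurable G) [SFinite r] (y : E d) (α : ℝ) :
    ∫⁻ p, mayer G p (y, α) ∂((volume : Measure (E d)).prod r) ≤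
      ‖α‖ₑ * (∫⁻ s, ‖s‖ₑ ∂r) * ∫⁻ x, ‖G x‖ₑ := by
  calc _ ≤ ∫⁻ p : MarkedPoint d, ‖G (p.1 - y)‖ₑ * (‖α‖ₑ * ‖p.2‖ₑ) ∂(volume.prod r) := by
        refine lintegral_mono fun p' => (mayer_le G _ _).trans (le_of_eq ?_)
        rw [mul_comm, mul_comm ‖α‖ₑ]
    _ = _ := by
        rw [lintegral_prod_mul (f := fun x : E d => ‖G (x - y)‖ₑ) (g := fun s : ℝ => ‖α‖ₑ * ‖s‖ₑ)
          (hG.comp (measurable_id.sub measurable_const)).enorm.aemeasurable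
          (measurable_enorm.const_mul _).aemeasurable,
          lintegral_sub_right_eq_self (fun x => ‖G x‖ₑ) y,
          lintegral_const_mul _ measurable_enorm]
        ring

theorem lintegral_enorm_lt_top_of_support (m : Measure ℝ) [IsFiniteMeasure m] (c : ℝ)
    (h : m.support ⊆ Set.Icc (-c) c) : ∫⁻ s, ‖s‖ₑ ∂m < ⊤ := by
  calc ∫⁻ s, ‖s‖ₑ ∂m ≤ ∫⁻ s, ENNReal.ofReal c ∂m := by
        refine lintegral_mono_ae ?_
        filter_upwards [Measure.support_mem_ae (μ := m)] with s hs
        have h1 := h hs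
        rw [← ofReal_norm]
        exact ENNReal.ofReal_le_ofReal (abs_le.2 h1)
    _ < ⊤ := by
        rw [lintegral_const]
        exact ENNReal.mul_lt_top ENNReal.ofReal_lt_top (measure_lt_top _ _)

theorem enorm_le_of_mem_Icc {c s : ℝ} (h : s ∈ Set.Icc (-c) c) : ‖s‖ₑ ≤ ENNReal.ofReal c := by
  rw [← ofReal_norm]
  exact ENNReal.ofReal_le_ofReal (abs_le.2 h)

variable {G r ν}

theorem C₁_lt_top (hG : Measurable G) (hGi : Integrable G) {c c' : ℝ}
    (hrc : r.support ⊆ Set.Icc (-c) c) (hνc' : (modulus ν).support ⊆ Set.Icc (-c') c') :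
    C₁ r ν G < ⊤ := by
  have hfin := lintegral_enorm_lt_top_of_support (modulus ν) c' hνc'
  have hGf : ∫⁻ x, ‖G x‖ₑ < ⊤ := hGi.2
  refine lt_of_le_of_lt (b := ENNReal.ofReal c * (∫⁻ α, ‖α‖ₑ ∂(modulus ν)) * ∫⁻ x, ‖G x‖ₑ) ?_ ?_
  · refine iSup_le fun y => iSup₂_le fun s hs => ?_
    have := lintegral_mayer_le_first ν hG y s
    rw [lintegral_prod _ (measurable_mayer_left hG _).aemeasurable] at this
    refine this.trans ?_
    gcongr
    exact enorm_le_of_mem_Icc (hrc hs)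
  · exact ENNReal.mul_lt_top (ENNReal.mul_lt_top ENNReal.ofReal_lt_top hfin) hGf

theorem C₂_lt_top [IsFiniteMeasure r] (hG : Measurable G) (hGi : Integrable G) {c c' : ℝ}
    (hrc : r.support ⊆ Set.Icc (-c) c) (hνc' : (modulus ν).support ⊆ Set.Icc (-c') c') :
    C₂ r ν G < ⊤ := by
  have hfin := lintegral_enorm_lt_top_of_support r c hrc
  have hGf : ∫⁻ x, ‖G x‖ₑ < ⊤ := hGi.2
  refine lt_of_le_of_lt (b := ENNReal.ofReal c' * (∫⁻ s, ‖s‖ₑ ∂r) * ∫⁻ x, ‖G x‖ₑ) ?_ ?_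
  · refine iSup_le fun y => iSup₂_le fun α hα => ?_
    have := lintegral_mayer_le_second r hG y α
    rw [lintegral_prod _ (measurable_mayer_right hG _).aemeasurable] at this
    refine this.trans ?_
    gcongr
    exact enorm_le_of_mem_Icc (hνc' hα)
  · exact ENNReal.mul_lt_top (ENNReal.mul_lt_top ENNReal.ofReal_lt_top hfin) hGf

end Constants

/-! ### Integrability of the cluster functions -/

section ClusterBound

variable {d : ℕ}

theorem enorm_pairFactor_inl_inr (G : E d → ℝ) (p p' : MarkedPoint d) :
    ‖pairFactor G (Sum.inl p) (Sum.inr p') - 1‖ₑ = mayer G p p' := by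
  simp [pairFactor, mayer, pairEnergy]

theorem enorm_pairFactor_inr_inl (G : E d → ℝ) (p p' : MarkedPoint d) :
    ‖pairFactor G (Sum.inr p') (Sum.inl p) - 1‖ₑ = mayer G p p' := by
  simp [pairFactor, mayer, pairEnergy]

theorem enorm_pairFactor_inl_inl (G : E d → ℝ) (p p' : MarkedPoint d) :
    ‖pairFactor G (Sum.inl p) (Sum.inl p') - 1‖ₑ = 0 := by
  simp [pairFactor, pairEnergy]

theorem enorm_pairFactor_inr_inr (G : E d → ℝ) (p p' : MarkedPoint d) :
    ‖pairFactor G (Sum.inr p) (Sum.inr p') - 1‖ₑ = 0 := by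
  simp [pairFactor, pairEnergy]

/-- Replace marks outside of `S` by zero. -/
def clampMark (S : Set ℝ) (p : MarkedPoint d) : MarkedPoint d := (p.1, S.indicator id p.2)

theorem measurable_clampMark {S : Set ℝ} (hS : MeasurableSet S) :
    Measurable (clampMark S : MarkedPoint d → MarkedPoint d) :=
  measurable_fst.prodMk ((measurable_id.indicator hS).comp measurable_snd)

/-- Clamping changes no integral, yet a clamped mark either lies in the support or is zero. Thus the
bounds by `C₁` and `C₂`, suprema over the supports only, become valid for every mark, as the tree
estimate demands. -/
theorem ae_clampMark (m : Measure ℝ) [SFinite m] :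
    ∀ᵐ p ∂((volume : Measure (E d)).prod m), clampMark m.support p = p := by
  have h := (Measure.quasiMeasurePreserving_snd (μ := (volume : Measure (E d))) (ν := m)).ae
    (Measure.support_mem_ae (μ := m))
  filter_upwards [h] with p hp
  unfold clampMark
  rw [Set.indicator_of_mem hp]
  rfl

variable (r : Measure ℝ) (ν : ComplexMeasure ℝ) (G : E d → ℝ)

/-- The measure `(m ⊗ r)^{n₁} ⊗ (m ⊗ |ν|)^{n₂}`. -/
def boxMeasure (m : Measure (E d)) (r : Measure ℝ) (ν : ComplexMeasure ℝ) (n₁ n₂ : ℕ) :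
    Measure ((Fin n₁ → MarkedPoint d) × (Fin n₂ → MarkedPoint d)) :=
  (Measure.pi fun _ => m.prod r).prod (Measure.pi fun _ => m.prod (modulus ν))

theorem quasiMeasurePreserving_first (m : Measure (E d)) [SigmaFinite m] [IsFiniteMeasure r]
    {n₁ n₂ : ℕ} (i : Fin n₁) :
    Measure.QuasiMeasurePreserving
      (fun p : (Fin n₁ → MarkedPoint d) × (Fin n₂ → MarkedPoint d) => p.1 i)
      (boxMeasure m r ν n₁ n₂) (m.prod r) := by
  have h1 := Measure.quasiMeasurePreserving_eval (μ := fun _ : Fin n₁ => m.prod r) i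
  have h2 := Measure.quasiMeasurePreserving_fst (μ := Measure.pi fun _ : Fin n₁ => m.prod r)
    (ν := Measure.pi fun _ : Fin n₂ => m.prod (modulus ν))
  exact h1.comp h2

theorem quasiMeasurePreserving_second (m : Measure (E d)) [SigmaFinite m] [IsFiniteMeasure r]
    {n₁ n₂ : ℕ} (j : Fin n₂) :
    Measure.QuasiMeasurePreserving
      (fun p : (Fin n₁ → MarkedPoint d) × (Fin n₂ → MarkedPoint d) => p.2 j)
      (boxMeasure m r ν n₁ n₂) (m.prod (modulus ν)) := by
  have h1 := Measure.quasiMeasurePreserving_eval (μ := fun _ : Fin n₂ => m.prod (modulus ν)) j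
  have h2 := Measure.quasiMeasurePreserving_snd (μ := Measure.pi fun _ : Fin n₁ => m.prod r)
    (ν := Measure.pi fun _ : Fin n₂ => m.prod (modulus ν))
  exact h1.comp h2

theorem ae_clampMark_clusterMeasure [IsFiniteMeasure r] (n₁ n₂ : ℕ) :
    ∀ᵐ p ∂(clusterMeasure d r ν n₁ n₂),
      ((fun i => clampMark r.support (p.1 i)), fun j => clampMark (modulus ν).support (p.2 j)) = p := by
  have h1 : ∀ᵐ p ∂(clusterMeasure d r ν n₁ n₂), ∀ i, clampMark r.support (p.1 i) = p.1 i :=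
    ae_all_iff.2 fun i => (quasiMeasurePreserving_first r ν volume i).ae (ae_clampMark r)
  have h2 : ∀ᵐ p ∂(clusterMeasure d r ν n₁ n₂), ∀ j,
      clampMark (modulus ν).support (p.2 j) = p.2 j :=
    ae_all_iff.2 fun j => (quasiMeasurePreserving_second r ν volume j).ae (ae_clampMark (modulus ν))
  filter_upwards [h1, h2] with p hp1 hp2
  ext1
  · funext i; exact hp1 i
  · funext j; exact hp2 j

/-- The point with a given index, as a function of the corresponding coordinate. -/
def indexedPoint (η : E d →₀ ℝ) (n₁ n₂ : ℕ) :
    η.support ⊕ (Fin n₁ ⊕ Fin n₂) → MarkedPoint d → MarkedPoint d ⊕ MarkedPoint d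
  | Sum.inl x, _ => Sum.inl (x.1, η x.1)
  | Sum.inr (Sum.inl _), p => Sum.inl (clampMark r.support p)
  | Sum.inr (Sum.inr _), p => Sum.inr (clampMark (modulus ν).support p)

/-- The reference measure of a point with a given index. -/
def indexedMeasure (η : E d →₀ ℝ) (n₁ n₂ : ℕ) :
    η.support ⊕ (Fin n₁ ⊕ Fin n₂) → Measure (MarkedPoint d)
  | Sum.inl _ => 0
  | Sum.inr (Sum.inl _) => volume.prod r
  | Sum.inr (Sum.inr _) => volume.prod (modulus ν)

/-- Bounds for the integrals of the Mayer factors; `K` is the bound for the points of `η`. -/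
def indexedBound (K : ENNReal) (η : E d →₀ ℝ) (n₁ n₂ : ℕ) :
    η.support ⊕ (Fin n₁ ⊕ Fin n₂) → η.support ⊕ (Fin n₁ ⊕ Fin n₂) → ENNReal
  | Sum.inl _, Sum.inr (Sum.inr _) => K
  | Sum.inr (Sum.inl _), Sum.inr (Sum.inr _) => C₁ r ν G
  | Sum.inr (Sum.inr _), Sum.inr (Sum.inl _) => C₂ r ν G
  | _, _ => 0

variable {G} in
theorem lintegral_pairFactor_le [IsFiniteMeasure r] (hG : Measurable G) (K : ENNReal)
    (η : E d →₀ ℝ) (n₁ n₂ : ℕ)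
    (hK : ∀ x, ∫⁻ p', mayer G (x, η x) p' ∂(volume.prod (modulus ν)) ≤ K)
    (a b : η.support ⊕ (Fin n₁ ⊕ Fin n₂)) (s : MarkedPoint d) :
    ∫⁻ t, ‖pairFactor G (indexedPoint r ν η n₁ n₂ a s) (indexedPoint r ν η n₁ n₂ b t) - 1‖ₑ
      ∂(indexedMeasure r ν η n₁ n₂ b) ≤ indexedBound r ν G K η n₁ n₂ a b := by
  rcases b with b | b | b
  -- The points of `η` are never integrated over, so their measure is set to zero and the bound is
  -- trivial.
  · simp [indexedMeasure]
  · rcases a with a | a | a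
    · simp only [indexedPoint, enorm_pairFactor_inl_inl]; simp
    · simp only [indexedPoint, enorm_pairFactor_inl_inl]; simp
    · simp only [indexedPoint, enorm_pairFactor_inr_inl, indexedMeasure, indexedBound]
      -- Outside the support the clamped mark is zero and so is the Mayer factor.
      by_cases hs : s.2 ∈ (modulus ν).support
      · refine le_trans (le_of_eq (lintegral_congr_ae ?_)) (lintegral_mayer_le_C₂ r ν hG s.1 hs)
        filter_upwards [ae_clampMark r] with t ht
        rw [ht, clampMark, Set.indicator_of_mem hs]
        rfl
      · simp [clampMark, Set.indicator_of_notMem hs, mayer_zero_right]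
  · rcases a with a | a | a
    · simp only [indexedPoint, enorm_pairFactor_inl_inr, indexedMeasure, indexedBound]
      refine le_trans (le_of_eq (lintegral_congr_ae ?_)) (hK a.1)
      filter_upwards [ae_clampMark (modulus ν)] with t ht
      rw [ht]
    · simp only [indexedPoint, enorm_pairFactor_inl_inr, indexedMeasure, indexedBound]
      by_cases hs : s.2 ∈ r.support
      · refine le_trans (le_of_eq (lintegral_congr_ae ?_)) (lintegral_mayer_le_C₁ r ν hG s.1 hs)
        filter_upwards [ae_clampMark (modulus ν)] with t ht
        rw [ht, clampMark, Set.indicator_of_mem hs]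
        rfl
      · simp [clampMark, Set.indicator_of_notMem hs, mayer_zero_left]
    · simp only [indexedPoint, enorm_pairFactor_inr_inr]; simp

variable {G} in
/-- The bound for the `L¹` norms of the cluster functions. -/
theorem lintegral_pottsCluster_le [IsFiniteMeasure r] (hG : Measurable G) (K : ENNReal)
    (η : E d →₀ ℝ) (n₁ n₂ : ℕ)
    (hK : ∀ x, ∫⁻ p', mayer G (x, η x) p' ∂(volume.prod (modulus ν)) ≤ K) :
    ∫⁻ p, ‖pottsCluster G η p‖ₑ ∂(clusterMeasure d r ν n₁ n₂) ≤
      (n₂ * C₂ r ν G) ^ n₁ * (η.support.card * K + n₁ * C₁ r ν G) ^ n₂ := by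
  classical
  set ι := η.support ⊕ (Fin n₁ ⊕ Fin n₂)
  set pt := indexedPoint r ν η n₁ n₂ with hpt
  set μ := indexedMeasure r ν η n₁ n₂ with hμ
  have : ∀ i, SigmaFinite (μ i) := by
    rintro (i | i | i) <;> simp only [hμ, indexedMeasure] <;> infer_instance
  have hptm : ∀ i, Measurable (pt i) := by
    rintro (i | i | i)
    · exact measurable_const
    · exact measurable_inl.comp (measurable_clampMark Measure.isClosed_support.measurableSet)
    · exact measurable_inr.comp (measurable_clampMark Measure.isClosed_support.measurableSet)
  have hpf : ∀ a b, Measurable (Function.uncurry fun s t => pairFactor G (pt a s) (pt b t)) := by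
    intro a b
    unfold Function.uncurry pairFactor
    refine Complex.measurable_exp.comp (measurable_const.mul (Complex.measurable_ofReal.comp ?_))
    exact (measurable_pairEnergy hG ((hptm a).comp measurable_fst)
      ((hptm b).comp measurable_snd)).add (measurable_pairEnergy hG
      ((hptm b).comp measurable_snd) ((hptm a).comp measurable_fst))
  have key := lmarginal_clusterFun_le μ
    (fun x A => pottsWeight G (fun i => pt i (x i)) A)
    (fun a b s t => pairFactor G (pt a s) (pt b t))
    (fun x => pottsWeight_empty _ _)
    (fun A => measurable_pottsWeight hG
      (fun i => (hptm i).comp (measurable_pi_apply i)) A)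
    (fun x a A ha => pottsWeight_insert _ _ a A ha) hpf
    (fun a b s t => (norm_pairFactor _ _ _).le)
    (indexedBound r ν G K η n₁ n₂) (lintegral_pairFactor_le r ν hG K η n₁ n₂ hK)
    (Finset.univ.map Function.Embedding.inl) (Finset.univ.map Function.Embedding.inr)
    (by
      rw [Finset.disjoint_left]
      simp)
    (fun _ => 0)
  set F : (Fin n₁ ⊕ Fin n₂ → MarkedPoint d) → ENNReal := fun x =>
    ‖pottsCluster G η ((fun i => clampMark r.support (x (Sum.inl i))),
      fun j => clampMark (modulus ν).support (x (Sum.inr j)))‖ₑ with hF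
  have hFm : Measurable F := by
    refine ((measurable_pottsCluster hG η n₁ n₂).comp (Measurable.prodMk ?_ ?_)).enorm
    · exact measurable_pi_lambda _ fun i =>
        (measurable_clampMark Measure.isClosed_support.measurableSet).comp (measurable_pi_apply _)
    · exact measurable_pi_lambda _ fun i =>
        (measurable_clampMark Measure.isClosed_support.measurableSet).comp (measurable_pi_apply _)
  have h1 : ∫⁻ p, ‖pottsCluster G η p‖ₑ ∂(clusterMeasure d r ν n₁ n₂) =
      ∫⁻ x, F x ∂(Measure.pi fun i => μ (Sum.inr i)) := by
    rw [← (measurePreserving_sumPiEquivProdPi_symm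
      (fun i : Fin n₁ ⊕ Fin n₂ => μ (Sum.inr i))).lintegral_comp_emb
      (MeasurableEquiv.measurableEmbedding _)]
    refine lintegral_congr_ae ?_
    filter_upwards [ae_clampMark_clusterMeasure r ν n₁ n₂] with p hp
    conv_lhs => rw [← hp]
    rfl
  -- The tree estimate speaks of a marginal over the indices outside `η`. As the integrand ignores
  -- the coordinates of `η`, this is a plain integral; the base point `0` is immaterial.
  have h2 := lmarginal_image (X := fun _ : ι => MarkedPoint d) (μ := μ)
    (e := (Sum.inr : Fin n₁ ⊕ Fin n₂ → ι)) Sum.inr_injective Finset.univ hFm (fun _ => 0)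
  rw [lmarginal_univ] at h2
  rw [h1]
  refine le_trans (le_of_eq ?_) (key.trans (le_of_eq ?_))
  · refine h2.symm.trans ?_
    have h3 : (Finset.univ.map Function.Embedding.inr : Finset ι) = Finset.univ.image Sum.inr := by
      rw [Finset.map_eq_image]; rfl
    rw [h3]
    refine congrFun (congrArg (lmarginal μ _) (funext fun x => ?_)) _
    simp only [hF, Function.comp, pottsCluster]
    have h4 : family η ((fun i => clampMark r.support (x (Sum.inr (Sum.inl i)))),
        fun j => clampMark (modulus ν).support (x (Sum.inr (Sum.inr j)))) =
        fun i => pt i (x i) := by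
      funext i
      rcases i with i | i | i <;> rfl
    rw [← h3, ← h4]
  · have hu : (Finset.univ.map Function.Embedding.inl ∪ Finset.univ.map Function.Embedding.inr :
        Finset ι) = Finset.univ := by
      ext i
      simp only [Finset.mem_union, Finset.mem_map, Finset.mem_univ, true_and, iff_true]
      rcases i with i | i
      · exact Or.inl ⟨i, rfl⟩
      · exact Or.inr ⟨i, rfl⟩
    -- A point of the first component meets only the `n₂` points of the second; one of the second
    -- meets the points of `η` and the `n₁` points of the first.
    have hs₁ : ∀ a : Fin n₁, ∑ i : ι, indexedBound r ν G K η n₁ n₂ i (Sum.inr (Sum.inl a)) =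
        n₂ * C₂ r ν G := by
      intro a
      rw [Fintype.sum_sum_type, Fintype.sum_sum_type]
      simp [indexedBound]
    have hs₂ : ∀ a : Fin n₂, ∑ i : ι, indexedBound r ν G K η n₁ n₂ i (Sum.inr (Sum.inr a)) =
        η.support.card * K + n₁ * C₁ r ν G := by
      intro a
      rw [Fintype.sum_sum_type, Fintype.sum_sum_type]
      simp [indexedBound]
    rw [hu, Finset.prod_map, Fintype.prod_sum_type]
    refine (congrArg₂ (· * ·) (Finset.prod_congr rfl fun a _ => hs₁ a)
      (Finset.prod_congr rfl fun a _ => hs₂ a)).trans ?_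
    simp

end ClusterBound

/-! ### Bound for the density of `ν` with respect to `|ν|` -/

theorem abs_signedMeasure_le {s : SignedMeasure ℝ} {i : Set ℝ} (hi : MeasurableSet i) :
    |s i| ≤ s.totalVariation.real i := by
  have h : s i = s.toJordanDecomposition.posPart.real i - s.toJordanDecomposition.negPart.real i := by
    conv_lhs => rw [← s.toSignedMeasure_toJordanDecomposition]
    rw [JordanDecomposition.toSignedMeasure, sub_apply,
      Measure.toSignedMeasure_apply_measurable hi, Measure.toSignedMeasure_apply_measurable hi]
  have h2 : s.totalVariation.real i = s.toJordanDecomposition.posPart.real i +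
      s.toJordanDecomposition.negPart.real i := by
    rw [SignedMeasure.totalVariation, measureReal_add_apply]
  rw [h, h2]
  have h3 : 0 ≤ s.toJordanDecomposition.posPart.real i := measureReal_nonneg
  have h4 : 0 ≤ s.toJordanDecomposition.negPart.real i := measureReal_nonneg
  rw [abs_le]
  constructor <;> linarith

/-- The density of a complex measure with respect to its modulus is bounded by one. -/
theorem ae_norm_density_le (ν : ComplexMeasure ℝ) : ∀ᵐ α ∂(modulus ν), ‖density ν α‖ ≤ 1 := by
  have hI : Integrable (density ν) (modulus ν) := ν.integrable_rnDeriv (modulus ν)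
  have hIre : Integrable (fun x => (density ν x).re) (modulus ν) := hI.re
  have hIim : Integrable (fun x => (density ν x).im) (modulus ν) := hI.im
  -- Because `|ν| = |Re ν| + |Im ν|`, the stronger bound `|Re h| + |Im h| ≤ 1` holds; it consists of
  -- four linear inequalities, one for each choice of signs, and each can be tested on sets.
  have key : ∀ a b : ℝ, |a| = 1 → |b| = 1 → ∀ᵐ α ∂(modulus ν),
      a * (density ν α).re + b * (density ν α).im ≤ 1 := by
    intro a b ha hb
    refine ae_le_of_forall_setIntegral_le ((hIre.const_mul a).add (hIim.const_mul b))
      (integrable_const 1) fun s hs _ => ?_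
    have h1 : ∫ x in s, density ν x ∂(modulus ν) = ν s := by
      rw [← withDensityᵥ_apply hI hs, withDensity_density]
    have hre : ∫ x in s, (density ν x).re ∂(modulus ν) = (ν s).re := by
      rw [← h1]; exact integral_re hI.integrableOn
    have him : ∫ x in s, (density ν x).im ∂(modulus ν) = (ν s).im := by
      rw [← h1]; exact integral_im hI.integrableOn
    have e : ∫ x in s, (a * (density ν x).re + b * (density ν x).im) ∂(modulus ν) =
        a * (ν s).re + b * (ν s).im := by
      rw [integral_add (hIre.const_mul a).integrableOn (hIim.const_mul b).integrableOn]
      rw [← hre, ← him, ← integral_const_mul, ← integral_const_mul]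
    refine (le_of_eq e).trans ?_
    have hm : ∫ _ in s, (1 : ℝ) ∂(modulus ν) =
        ν.re.totalVariation.real s + ν.im.totalVariation.real s := by
      rw [setIntegral_const, smul_eq_mul, mul_one, modulus, measureReal_add_apply]
    rw [hm]
    have h2 : |(ν s).re| ≤ _ := abs_signedMeasure_le (s := ν.re) hs
    have h3 : |(ν s).im| ≤ _ := abs_signedMeasure_le (s := ν.im) hs
    have h4 : a * (ν s).re ≤ |(ν s).re| := by
      refine (le_abs_self _).trans ?_
      rw [abs_mul, ha, one_mul]
    have h5 : b * (ν s).im ≤ |(ν s).im| := by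
      refine (le_abs_self _).trans ?_
      rw [abs_mul, hb, one_mul]
    linarith
  filter_upwards [key 1 1 (by simp) (by simp), key 1 (-1) (by simp) (by simp),
    key (-1) 1 (by simp) (by simp), key (-1) (-1) (by simp) (by simp)] with α h1 h2 h3 h4
  refine (Complex.norm_le_abs_re_add_abs_im _).trans ?_
  rcases abs_cases (density ν α).re with h | h <;> rcases abs_cases (density ν α).im with h' | h' <;>
    linarith

theorem measurable_density (ν : ComplexMeasure ℝ) : Measurable (density ν) := by
  have h : density ν = fun x => ((ν.re.rnDeriv (modulus ν) x : ℝ) : ℂ) +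
      ((ν.im.rnDeriv (modulus ν) x : ℝ) : ℂ) * Complex.I := by
    funext x
    exact (Complex.re_add_im (density ν x)).symm
  rw [h]
  exact (Complex.measurable_ofReal.comp (SignedMeasure.measurable_rnDeriv _ _)).add
    ((Complex.measurable_ofReal.comp (SignedMeasure.measurable_rnDeriv _ _)).mul_const _)

/-! ### Summation of the cluster expansion -/

/-- The strict inequality leaves room to enlarge `C` to a positive real number. Positivity matters
when `C` vanishes, since the summation divides by this number. -/
theorem exists_pos_bound {C : ENNReal} (hC : C < ⊤) (b : ℂ)
    (h : ENNReal.ofReal (Real.exp 1) * C * ‖b‖ₑ < 1) :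
    ∃ a : ℝ, 0 < a ∧ C ≤ ENNReal.ofReal a ∧ Real.exp 1 * (‖b‖ * a) < 1 := by
  lift C to NNReal using hC.ne
  have he := Real.exp_pos 1
  rw [← ofReal_norm, ← ENNReal.ofReal_coe_nnreal, ← ENNReal.ofReal_mul he.le,
    ← ENNReal.ofReal_mul (by positivity), ENNReal.ofReal_lt_one] at h
  -- The slack `δ` is divided by `e‖b‖ + 1`, so that the enlargement of `C` costs strictly less than
  -- `δ`, also for `b = 0`.
  set δ := 1 - Real.exp 1 * C * ‖b‖ with hδ
  have hδ0 : 0 < δ := by linarith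
  have hden : 0 < Real.exp 1 * ‖b‖ + 1 := by positivity
  refine ⟨C + δ / (Real.exp 1 * ‖b‖ + 1), by positivity, ?_, ?_⟩
  · rw [← ENNReal.ofReal_coe_nnreal]
    exact ENNReal.ofReal_le_ofReal (le_add_of_nonneg_right (by positivity))
  · have h1 : Real.exp 1 * ‖b‖ * (δ / (Real.exp 1 * ‖b‖ + 1)) < δ := by
      rw [mul_div_assoc', div_lt_iff₀ hden]
      nlinarith
    nlinarith

/-- Each factorial is paired with the power having the same exponent: `m^n / n! ≤ e^m` and `(k +
n)^m / m! ≤ e^{k + n}`. These exponentials are the source of the factor `e` in the radii. -/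
theorem pow_div_factorial_mul_le (x y k : ℝ) (hx : 0 ≤ x) (hy : 0 ≤ y) (hk : 0 ≤ k) (n m : ℕ) :
    x ^ n * y ^ m / ((n.factorial : ℝ) * (m.factorial : ℝ)) * ((m : ℝ) ^ n * (k + n) ^ m) ≤
      Real.exp k * ((Real.exp 1 * x) ^ n * (Real.exp 1 * y) ^ m) := by
  have h1 : (m : ℝ) ^ n / (n.factorial : ℝ) ≤ Real.exp 1 ^ m := by
    rw [← Real.exp_nat_mul, mul_one]
    exact Real.pow_div_factorial_le_exp _ (by positivity) _
  have h2 : (k + n) ^ m / (m.factorial : ℝ) ≤ Real.exp k * Real.exp 1 ^ n := by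
    rw [← Real.exp_nat_mul, mul_one, ← Real.exp_add]
    exact Real.pow_div_factorial_le_exp _ (by positivity) _
  calc _ = x ^ n * y ^ m * ((m : ℝ) ^ n / (n.factorial : ℝ) * ((k + n) ^ m / (m.factorial : ℝ))) := by
        ring
    _ ≤ x ^ n * y ^ m * (Real.exp 1 ^ m * (Real.exp k * Real.exp 1 ^ n)) := by
        gcongr
    _ = _ := by ring

theorem summable_geometric_prod {x y : ℝ} (hx : 0 ≤ x) (hy : 0 ≤ y) (hx1 : x < 1) (hy1 : y < 1) :
    Summable fun n : ℕ × ℕ => x ^ n.1 * y ^ n.2 :=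
  (summable_geometric_of_lt_one hx hx1).mul_of_nonneg (summable_geometric_of_lt_one hy hy1)
    (fun _ => by positivity) (fun _ => by positivity)

section Summation

variable {d : ℕ} {r : Measure ℝ} [IsFiniteMeasure r] {ν : ComplexMeasure ℝ} {G : E d → ℝ}
  {c c' : ℝ}

/-- The charges of `η` are bounded by `c` but need not lie in the support of `r`, so `C₁` does not
control them. A cruder finite `K` suffices, because it affects only a multiplicative constant and
not the radii. -/
theorem exists_bound_mayer (hG : Measurable G) (hGi : Integrable G)
    (hνc' : (modulus ν).support ⊆ Set.Icc (-c') c') (η : E d →₀ ℝ) (hη : η ∈ Gamma0 d c) :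
    ∃ K : ENNReal, K < ⊤ ∧
      ∀ x, ∫⁻ p', mayer G (x, η x) p' ∂(volume.prod (modulus ν)) ≤ K := by
  refine ⟨ENNReal.ofReal c * (∫⁻ α, ‖α‖ₑ ∂(modulus ν)) * ∫⁻ x, ‖G x‖ₑ, ?_, fun x => ?_⟩
  · exact ENNReal.mul_lt_top (ENNReal.mul_lt_top ENNReal.ofReal_lt_top
      (lintegral_enorm_lt_top_of_support _ c' hνc')) hGi.2
  · refine (lintegral_mayer_le_first ν hG x (η x)).trans ?_
    gcongr
    exact enorm_le_of_mem_Icc (abs_le.1 (hη x))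

theorem integrable_pottsCluster (hG : Measurable G) (hGi : Integrable G)
    (hrc : r.support ⊆ Set.Icc (-c) c) (hνc' : (modulus ν).support ⊆ Set.Icc (-c') c')
    (η : E d →₀ ℝ) (hη : η ∈ Gamma0 d c) (n₁ n₂ : ℕ) :
    Integrable (fun p => pottsCluster G η p) (clusterMeasure d r ν n₁ n₂) := by
  obtain ⟨K, hK, hK'⟩ := exists_bound_mayer hG hGi hνc' η hη
  refine ⟨(measurable_pottsCluster hG η n₁ n₂).aestronglyMeasurable, ?_⟩
  refine lt_of_le_of_lt (lintegral_pottsCluster_le r ν hG K η n₁ n₂ hK') ?_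
  have h1 := C₁_lt_top hG hGi hrc hνc'
  have h2 := C₂_lt_top hG hGi hrc hνc'
  refine ENNReal.mul_lt_top (ENNReal.pow_lt_top (ENNReal.mul_lt_top (by simp) h2))
    (ENNReal.pow_lt_top (ENNReal.add_lt_top.2 ⟨ENNReal.mul_lt_top (by simp) hK,
      ENNReal.mul_lt_top (by simp) h1⟩))

/-- Absolute convergence of the cluster expansion on the polydisc. -/
theorem summable_pottsCluster (hG : Measurable G) (hGi : Integrable G)
    (hrc : r.support ⊆ Set.Icc (-c) c) (hνc' : (modulus ν).support ⊆ Set.Icc (-c') c')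
    (η : E d →₀ ℝ) (hη : η ∈ Gamma0 d c) (p : ℂ × ℂ) (hp : p ∈ polydisc r ν G) :
    Summable fun n : ℕ × ℕ =>
      ‖p.1‖ ^ n.1 * ‖p.2‖ ^ n.2 / ((n.1.factorial : ℝ) * (n.2.factorial : ℝ)) *
        ∫ q, ‖pottsCluster G η q‖ ∂(clusterMeasure d r ν n.1 n.2) := by
  obtain ⟨K, hK, hK'⟩ := exists_bound_mayer hG hGi hνc' η hη
  obtain ⟨a₂, ha₂, hC₂, hz⟩ := exists_pos_bound (C₂_lt_top hG hGi hrc hνc') p.1 hp.1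
  obtain ⟨a₁, ha₁, hC₁, hβ⟩ := exists_pos_bound (C₁_lt_top hG hGi hrc hνc') p.2 hp.2
  have he := Real.exp_pos 1
  -- Chosen so that `|η| K + n a₁ = a₁ (k + n)`: the points of `η` count like `k` extra points of
  -- the first component.
  set k : ℝ := η.support.card * K.toReal / a₁ with hk
  have hk0 : 0 ≤ k := by positivity
  refine Summable.of_nonneg_of_le (fun n => ?_) (fun n => ?_)
    ((summable_geometric_prod (x := Real.exp 1 * (‖p.1‖ * a₂)) (y := Real.exp 1 * (‖p.2‖ * a₁))
      (by positivity) (by positivity) hz hβ).mul_left (Real.exp k))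
  · exact mul_nonneg (by positivity) (integral_nonneg fun _ => norm_nonneg _)
  obtain ⟨n, m⟩ := n
  have hint : ∫ q, ‖pottsCluster G η q‖ ∂(clusterMeasure d r ν n m) ≤
      (m * a₂) ^ n * (a₁ * (k + n)) ^ m := by
    rw [integral_norm_eq_lintegral_enorm
      (measurable_pottsCluster hG η n m).aestronglyMeasurable]
    refine ENNReal.toReal_le_of_le_ofReal (by positivity) ?_
    refine (lintegral_pottsCluster_le r ν hG K η n m hK').trans ?_
    rw [ENNReal.ofReal_mul (by positivity), ENNReal.ofReal_pow (by positivity),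
      ENNReal.ofReal_pow (by positivity)]
    have hk' : a₁ * (k + n) = η.support.card * K.toReal + n * a₁ := by
      rw [hk]; field_simp
    rw [hk', ENNReal.ofReal_add (by positivity) (by positivity), ENNReal.ofReal_mul (by positivity),
      ENNReal.ofReal_mul (by positivity), ENNReal.ofReal_mul (by positivity),
      ENNReal.ofReal_toReal hK.ne, ENNReal.ofReal_natCast, ENNReal.ofReal_natCast,
      ENNReal.ofReal_natCast]
    gcongr
  calc _ ≤ ‖p.1‖ ^ n * ‖p.2‖ ^ m / ((n.factorial : ℝ) * (m.factorial : ℝ)) *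
        ((m * a₂) ^ n * (a₁ * (k + n)) ^ m) := by
        gcongr
    _ = (‖p.1‖ * a₂) ^ n * (‖p.2‖ * a₁) ^ m / ((n.factorial : ℝ) * (m.factorial : ℝ)) *
        ((m : ℝ) ^ n * (k + n) ^ m) := by
        rw [mul_pow a₁]; ring
    _ ≤ _ := pow_div_factorial_mul_le _ _ k (by positivity) (by positivity) hk0 n m

end Summation

/-! ### Splitting of the points of a finite system into two groups -/

section Splitting

theorem measurePreserving_prodProdProdComm {A B C D : Type*} [MeasurableSpace A]
    [MeasurableSpace B] [MeasurableSpace C] [MeasurableSpace D] (a : Measure A) (b : Measure B)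
    (c : Measure C) (d : Measure D) [SFinite a] [SFinite b] [SFinite c] [SFinite d] :
    MeasurePreserving (fun p : (A × B) × (C × D) => ((p.1.1, p.2.1), (p.1.2, p.2.2)))
      ((a.prod b).prod (c.prod d)) ((a.prod c).prod (b.prod d)) := by
  have h1 : MeasurePreserving (MeasurableEquiv.prodAssoc : (A × B) × (C × D) ≃ᵐ _)
      ((a.prod b).prod (c.prod d)) (a.prod (b.prod (c.prod d))) :=
    ⟨MeasurableEquiv.prodAssoc.measurable, Measure.prodAssoc_prod⟩
  have h2 : MeasurePreserving (MeasurableEquiv.prodAssoc : (B × C) × D ≃ᵐ _)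
      ((b.prod c).prod d) (b.prod (c.prod d)) :=
    ⟨MeasurableEquiv.prodAssoc.measurable, Measure.prodAssoc_prod⟩
  have h3 : MeasurePreserving (MeasurableEquiv.prodAssoc : (C × B) × D ≃ᵐ _)
      ((c.prod b).prod d) (c.prod (b.prod d)) :=
    ⟨MeasurableEquiv.prodAssoc.measurable, Measure.prodAssoc_prod⟩
  have h4 : MeasurePreserving (MeasurableEquiv.prodAssoc : (A × C) × (B × D) ≃ᵐ _)
      ((a.prod c).prod (b.prod d)) (a.prod (c.prod (b.prod d))) :=
    ⟨MeasurableEquiv.prodAssoc.measurable, Measure.prodAssoc_prod⟩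
  have h5 : MeasurePreserving (Prod.map Prod.swap id : (B × C) × D → (C × B) × D)
      ((b.prod c).prod d) ((c.prod b).prod d) :=
    Measure.measurePreserving_swap.prod (MeasurePreserving.id d)
  exact h4.symm.comp (((MeasurePreserving.id a).prod (h3.comp (h5.comp h2.symm))).comp h1)

/-- Restriction of a family along the two parts of a splitting of its index set. -/
theorem measurePreserving_split {X : Type*} [MeasurableSpace X] (μ : Measure X) [SigmaFinite μ]
    {k l n : ℕ} (e : Fin k ⊕ Fin l ≃ Fin n) :
    MeasurePreserving (fun x : Fin n → X => (fun i => x (e (Sum.inl i)), fun i => x (e (Sum.inr i))))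
      (Measure.pi fun _ => μ) ((Measure.pi fun _ => μ).prod (Measure.pi fun _ => μ)) := by
  have h1 := (measurePreserving_piCongrLeft (α := fun _ => X) (fun _ : Fin n => μ) e).symm
  have h2 := measurePreserving_sumPiEquivProdPi (X := fun _ : Fin k ⊕ Fin l => X) (fun _ => μ)
  exact h2.comp h1

variable {X Y : Type*} [MeasurableSpace X] [MeasurableSpace Y]

/-- The first group of a splitting of the points of two components. -/
def splitLeft {k₁ l₁ n₁ k₂ l₂ n₂ : ℕ} (e₁ : Fin k₁ ⊕ Fin l₁ ≃ Fin n₁) (e₂ : Fin k₂ ⊕ Fin l₂ ≃ Fin n₂)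
    (p : (Fin n₁ → X) × (Fin n₂ → Y)) : (Fin k₁ → X) × (Fin k₂ → Y) :=
  (fun i => p.1 (e₁ (Sum.inl i)), fun i => p.2 (e₂ (Sum.inl i)))

/-- The second group of a splitting of the points of two components. -/
def splitRight {k₁ l₁ n₁ k₂ l₂ n₂ : ℕ} (e₁ : Fin k₁ ⊕ Fin l₁ ≃ Fin n₁)
    (e₂ : Fin k₂ ⊕ Fin l₂ ≃ Fin n₂)
    (p : (Fin n₁ → X) × (Fin n₂ → Y)) : (Fin l₁ → X) × (Fin l₂ → Y) :=
  (fun i => p.1 (e₁ (Sum.inr i)), fun i => p.2 (e₂ (Sum.inr i)))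

theorem measurePreserving_splitPair (μ : Measure X) (ν : Measure Y) [SigmaFinite μ] [SigmaFinite ν]
    {k₁ l₁ n₁ k₂ l₂ n₂ : ℕ} (e₁ : Fin k₁ ⊕ Fin l₁ ≃ Fin n₁) (e₂ : Fin k₂ ⊕ Fin l₂ ≃ Fin n₂) :
    MeasurePreserving (fun p : (Fin n₁ → X) × (Fin n₂ → Y) => (splitLeft e₁ e₂ p, splitRight e₁ e₂ p))
      ((Measure.pi fun _ => μ).prod (Measure.pi fun _ => ν))
      (((Measure.pi fun _ => μ).prod (Measure.pi fun _ => ν)).prod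
        ((Measure.pi fun _ => μ).prod (Measure.pi fun _ => ν))) :=
  (measurePreserving_prodProdProdComm _ _ _ _).comp
    ((measurePreserving_split μ e₁).prod (measurePreserving_split ν e₂))

theorem integrable_split (μ : Measure X) (ν : Measure Y) [SigmaFinite μ] [SigmaFinite ν]
    {k₁ l₁ n₁ k₂ l₂ n₂ : ℕ} (e₁ : Fin k₁ ⊕ Fin l₁ ≃ Fin n₁) (e₂ : Fin k₂ ⊕ Fin l₂ ≃ Fin n₂)
    {F : (Fin k₁ → X) × (Fin k₂ → Y) → ℂ} {H : (Fin l₁ → X) × (Fin l₂ → Y) → ℂ}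
    (hF : Integrable F ((Measure.pi fun _ => μ).prod (Measure.pi fun _ => ν)))
    (hH : Integrable H ((Measure.pi fun _ => μ).prod (Measure.pi fun _ => ν))) :
    Integrable (fun p => F (splitLeft e₁ e₂ p) * H (splitRight e₁ e₂ p))
      ((Measure.pi fun _ => μ).prod (Measure.pi fun _ => ν)) :=
  (measurePreserving_splitPair μ ν e₁ e₂).integrable_comp_of_integrable (hF.mul_prod hH)

theorem integral_split (μ : Measure X) (ν : Measure Y) [SigmaFinite μ] [SigmaFinite ν]
    {k₁ l₁ n₁ k₂ l₂ n₂ : ℕ} (e₁ : Fin k₁ ⊕ Fin l₁ ≃ Fin n₁) (e₂ : Fin k₂ ⊕ Fin l₂ ≃ Fin n₂)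
    {F : (Fin k₁ → X) × (Fin k₂ → Y) → ℂ} {H : (Fin l₁ → X) × (Fin l₂ → Y) → ℂ}
    (hF : Integrable F ((Measure.pi fun _ => μ).prod (Measure.pi fun _ => ν)))
    (hH : Integrable H ((Measure.pi fun _ => μ).prod (Measure.pi fun _ => ν))) :
    ∫ p, F (splitLeft e₁ e₂ p) * H (splitRight e₁ e₂ p)
        ∂((Measure.pi fun _ => μ).prod (Measure.pi fun _ => ν)) =
      (∫ p, F p ∂((Measure.pi fun _ => μ).prod (Measure.pi fun _ => ν))) *
        ∫ p, H p ∂((Measure.pi fun _ => μ).prod (Measure.pi fun _ => ν)) := by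
  have h := measurePreserving_splitPair μ ν e₁ e₂
  rw [← integral_prod_mul, ← h.map_eq, integral_map h.aemeasurable]
  rw [h.map_eq]
  exact (hF.mul_prod hH).aestronglyMeasurable

end Splitting

/-! ### The convolution identity for the weights of a finite system -/

section Convolution

variable {d : ℕ}

/-- The Boltzmann weight of the points of `η` together with the points of `p`. -/
def fullWeight (G : E d → ℝ) (η : E d →₀ ℝ) {n₁ n₂ : ℕ}
    (p : (Fin n₁ → MarkedPoint d) × (Fin n₂ → MarkedPoint d)) : ℂ :=
  pottsWeight G (family η p) Finset.univ

theorem norm_fullWeight (G : E d → ℝ) (η : E d →₀ ℝ) {n₁ n₂ : ℕ}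
    (p : (Fin n₁ → MarkedPoint d) × (Fin n₂ → MarkedPoint d)) : ‖fullWeight G η p‖ = 1 :=
  norm_pottsWeight _ _ _

theorem measurable_fullWeight {G : E d → ℝ} (hG : Measurable G) (η : E d →₀ ℝ) (n₁ n₂ : ℕ) :
    Measurable fun p : (Fin n₁ → MarkedPoint d) × (Fin n₂ → MarkedPoint d) => fullWeight G η p :=
  measurable_pottsWeight hG (measurable_family η) _

theorem sum_finset_sum_type {α β : Type*} [Fintype α] [Fintype β] {M : Type*} [AddCommMonoid M]
    [DecidableEq α] [DecidableEq β] (F : Finset (α ⊕ β) → M) :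
    ∑ σ : Finset (α ⊕ β), F σ = ∑ σ₁ : Finset α, ∑ σ₂ : Finset β, F (σ₁.disjSum σ₂) := by
  exact ((Finset.sumEquiv (α := α) (β := β)).symm.toEquiv.sum_comp F).symm.trans
    (Fintype.sum_prod_type _)

/-- The splitting of `Fin n` into a finite set and its complement. -/
def finsetSplit {n : ℕ} (σ : Finset (Fin n)) : Fin σ.card ⊕ Fin (n - σ.card) ≃ Fin n :=
  finSumEquivOfFinset rfl (by rw [Finset.card_compl, Fintype.card_fin])

theorem finsetSplit_inl_mem {n : ℕ} (σ : Finset (Fin n)) (i : Fin n) :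
    (∃ j, finsetSplit σ (Sum.inl j) = i) ↔ i ∈ σ := by
  unfold finsetSplit
  simp only [finSumEquivOfFinset_inl]
  rw [← Set.mem_range, Finset.range_orderEmbOfFin]
  rfl

theorem finsetSplit_inr_mem {n : ℕ} (σ : Finset (Fin n)) (i : Fin n) :
    (∃ j, finsetSplit σ (Sum.inr j) = i) ↔ i ∉ σ := by
  unfold finsetSplit
  simp only [finSumEquivOfFinset_inr]
  rw [← Set.mem_range, Finset.range_orderEmbOfFin]
  simp

/-- This is `Ψ * φ̃_η = D_η Ψ` with the subsets renumbered. The argument of `Ψ` contains no point of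
`η`, hence the weight for `0`; naturality of cluster functions handles the other factor. -/
theorem fullWeight_eq_sum (G : E d → ℝ) (η : E d →₀ ℝ) {n₁ n₂ : ℕ}
    (p : (Fin n₁ → MarkedPoint d) × (Fin n₂ → MarkedPoint d)) :
    fullWeight G η p = ∑ σ₁ : Finset (Fin n₁), ∑ σ₂ : Finset (Fin n₂),
      fullWeight G 0 (splitLeft (finsetSplit σ₁) (finsetSplit σ₂) p) *
        pottsCluster G η (splitRight (finsetSplit σ₁) (finsetSplit σ₂) p) := by
  classical
  have h := sum_mul_clusterFun (pottsWeight G (family η p)) (pottsWeight_empty _ _)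
    (Finset.univ.map Function.Embedding.inl) (Finset.univ.map Function.Embedding.inr)
  have h0 : IsEmpty ((0 : E d →₀ ℝ).support) := by
    rw [Finsupp.support_zero]; infer_instance
  have hu : (Finset.univ.map Function.Embedding.inl ∪ Finset.univ.map Function.Embedding.inr :
      Finset (η.support ⊕ (Fin n₁ ⊕ Fin n₂))) = Finset.univ := by
    ext i
    simp only [Finset.mem_union, Finset.mem_map, Finset.mem_univ, true_and, iff_true]
    rcases i with i | i
    · exact Or.inl ⟨i, rfl⟩
    · exact Or.inr ⟨i, rfl⟩
  rw [hu] at h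
  unfold fullWeight
  rw [← h, sum_powerset_map, Finset.powerset_univ, sum_finset_sum_type]
  refine Finset.sum_congr rfl fun σ₁ _ => Finset.sum_congr rfl fun σ₂ _ => ?_
  congr 1
  -- The first summand is empty; `f` enumerates the chosen points, and the next `f` enumerates `η`
  -- with the points left over.
  · let f : (0 : E d →₀ ℝ).support ⊕ (Fin σ₁.card ⊕ Fin σ₂.card) ↪
        η.support ⊕ (Fin n₁ ⊕ Fin n₂) :=
      ⟨Sum.elim (fun x => h0.elim x)
        (fun i => Sum.inr (Sum.map (fun j => finsetSplit σ₁ (Sum.inl j))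
          (fun j => finsetSplit σ₂ (Sum.inl j)) i)), by
        rintro (x | i | i) (y | j | j) hij
        all_goals first | exact h0.elim x | exact h0.elim y | simpa using hij⟩
    have h1 : (σ₁.disjSum σ₂).map Function.Embedding.inr = Finset.univ.map f := by
      ext i
      simp only [Finset.mem_map, Finset.mem_univ, true_and]
      constructor
      · rintro ⟨j | j, hj, rfl⟩
        · obtain ⟨k, hk⟩ := (finsetSplit_inl_mem σ₁ j).2 (by simpa using hj)
          exact ⟨Sum.inr (Sum.inl k), by simp [f, hk]⟩
        · obtain ⟨k, hk⟩ := (finsetSplit_inl_mem σ₂ j).2 (by simpa using hj)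
          exact ⟨Sum.inr (Sum.inr k), by simp [f, hk]⟩
      · rintro ⟨x | k | k, rfl⟩
        · exact h0.elim x
        · exact ⟨Sum.inl (finsetSplit σ₁ (Sum.inl k)),
            by simpa using (finsetSplit_inl_mem σ₁ _).1 ⟨k, rfl⟩, rfl⟩
        · exact ⟨Sum.inr (finsetSplit σ₂ (Sum.inl k)),
            by simpa using (finsetSplit_inl_mem σ₂ _).1 ⟨k, rfl⟩, rfl⟩
    rw [h1, pottsWeight_map]
    congr 1
    funext i
    rcases i with x | i | i
    · exact h0.elim x
    · rfl
    · rfl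
  · let f : η.support ⊕ (Fin (n₁ - σ₁.card) ⊕ Fin (n₂ - σ₂.card)) ↪
        η.support ⊕ (Fin n₁ ⊕ Fin n₂) :=
      ⟨Sum.map id (Sum.map (fun j => finsetSplit σ₁ (Sum.inr j))
          (fun j => finsetSplit σ₂ (Sum.inr j))), by
        rintro (x | i | i) (y | j | j) hij
        all_goals simpa using hij⟩
    have h1 : (Finset.univ.map Function.Embedding.inr \
        (σ₁.disjSum σ₂).map Function.Embedding.inr : Finset (η.support ⊕ (Fin n₁ ⊕ Fin n₂))) =
        (Finset.univ.map Function.Embedding.inr).map f := by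
      rw [← map_sdiff_embedding]
      ext i
      simp only [Finset.mem_map, Finset.mem_univ, true_and, Finset.mem_sdiff]
      constructor
      · rintro ⟨j | j, hj, rfl⟩
        · obtain ⟨k, hk⟩ := (finsetSplit_inr_mem σ₁ j).2 (by simpa using hj)
          exact ⟨Sum.inr (Sum.inl k), ⟨Sum.inl k, rfl⟩, by rw [← hk]; rfl⟩
        · obtain ⟨k, hk⟩ := (finsetSplit_inr_mem σ₂ j).2 (by simpa using hj)
          exact ⟨Sum.inr (Sum.inr k), ⟨Sum.inr k, rfl⟩, by rw [← hk]; rfl⟩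
      · rintro ⟨_, ⟨k | k, rfl⟩, rfl⟩
        · exact ⟨Sum.inl (finsetSplit σ₁ (Sum.inr k)),
            by simpa using (finsetSplit_inr_mem σ₁ _).1 ⟨k, rfl⟩, rfl⟩
        · exact ⟨Sum.inr (finsetSplit σ₂ (Sum.inr k)),
            by simpa using (finsetSplit_inr_mem σ₂ _).1 ⟨k, rfl⟩, rfl⟩
    have h2 : (Finset.univ.map Function.Embedding.inl : Finset (η.support ⊕ (Fin n₁ ⊕ Fin n₂))) =
        (Finset.univ.map Function.Embedding.inl).map f := by
      rw [Finset.map_map]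
      rfl
    rw [h1, h2, clusterFun_map f _ (pottsWeight_empty _ _)]
    simp_rw [pottsWeight_map]
    unfold pottsCluster
    have h3 : family η p ∘ f =
        family η (splitRight (finsetSplit σ₁) (finsetSplit σ₂) p) := by
      funext i
      rcases i with x | i | i <;> rfl
    rw [h3]

end Convolution

section ConvolutionIntegrals

variable {d : ℕ} (m : Measure (E d)) (r : Measure ℝ) (ν : ComplexMeasure ℝ) (G : E d → ℝ)
  (η : E d →₀ ℝ)

/-- The product of the densities of the marks of the second component. -/
def densityProd {n₁ n₂ : ℕ} (p : (Fin n₁ → MarkedPoint d) × (Fin n₂ → MarkedPoint d)) : ℂ :=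
  ∏ j, density ν (p.2 j).2

theorem measurable_densityProd (n₁ n₂ : ℕ) :
    Measurable (densityProd ν :
      (Fin n₁ → MarkedPoint d) × (Fin n₂ → MarkedPoint d) → ℂ) :=
  Finset.measurable_prod _ fun j _ => (measurable_density ν).comp
    (measurable_snd.comp ((measurable_pi_apply j).comp measurable_snd))

theorem ae_norm_densityProd_le [SigmaFinite m] [IsFiniteMeasure r] (n₁ n₂ : ℕ) :
    ∀ᵐ p ∂(boxMeasure m r ν n₁ n₂), ‖densityProd ν p‖ ≤ 1 := by
  have h : ∀ᵐ p ∂(boxMeasure m r ν n₁ n₂), ∀ j, ‖density ν (p.2 j).2‖ ≤ 1 :=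
    ae_all_iff.2 fun j => (quasiMeasurePreserving_second r ν m j).ae
      ((Measure.quasiMeasurePreserving_snd (μ := m) (ν := modulus ν)).ae (ae_norm_density_le ν))
  filter_upwards [h] with p hp
  rw [densityProd, norm_prod]
  exact Finset.prod_le_one (fun _ _ => norm_nonneg _) fun j _ => hp j

/-- The integral of the weight over a finite system. -/
def weightIntegral (n₁ n₂ : ℕ) : ℂ :=
  ((n₁.factorial : ℂ) * (n₂.factorial : ℂ))⁻¹ *
    ∫ p, fullWeight G η p * densityProd ν p ∂(boxMeasure m r ν n₁ n₂)

/-- The integral of the cluster function over a finite system. -/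
def clusterIntegral (n₁ n₂ : ℕ) : ℂ :=
  ((n₁.factorial : ℂ) * (n₂.factorial : ℂ))⁻¹ *
    ∫ p, pottsCluster G η p * densityProd ν p ∂(boxMeasure m r ν n₁ n₂)

instance isFiniteMeasure_boxMeasure [IsFiniteMeasure m] [IsFiniteMeasure r] (n₁ n₂ : ℕ) :
    IsFiniteMeasure (boxMeasure m r ν n₁ n₂) := by
  unfold boxMeasure; infer_instance

variable {m r G η}

theorem integrable_mul_densityProd [SigmaFinite m] [IsFiniteMeasure r] {n₁ n₂ : ℕ}
    {f : (Fin n₁ → MarkedPoint d) × (Fin n₂ → MarkedPoint d) → ℂ}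
    (hf : Integrable f (boxMeasure m r ν n₁ n₂)) :
    Integrable (fun p => f p * densityProd ν p) (boxMeasure m r ν n₁ n₂) := by
  refine hf.mono (hf.aestronglyMeasurable.mul (measurable_densityProd ν n₁ n₂).aestronglyMeasurable)
    ?_
  filter_upwards [ae_norm_densityProd_le m r ν n₁ n₂] with p hp
  rw [norm_mul]
  exact mul_le_of_le_one_right (norm_nonneg _) hp

/-- Passage from the complex measure `ν` to `|ν|`, at no cost because the density has modulus at
most one. -/
theorem norm_integral_mul_densityProd_le [SigmaFinite m] [IsFiniteMeasure r] {n₁ n₂ : ℕ}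
    {f : (Fin n₁ → MarkedPoint d) × (Fin n₂ → MarkedPoint d) → ℂ}
    (hf : Integrable f (boxMeasure m r ν n₁ n₂)) :
    ‖∫ p, f p * densityProd ν p ∂(boxMeasure m r ν n₁ n₂)‖ ≤
      ∫ p, ‖f p‖ ∂(boxMeasure m r ν n₁ n₂) := by
  refine (norm_integral_le_integral_norm _).trans (integral_mono_ae
    (integrable_mul_densityProd ν hf).norm hf.norm ?_)
  filter_upwards [ae_norm_densityProd_le m r ν n₁ n₂] with p hp
  rw [norm_mul]
  exact mul_le_of_le_one_right (norm_nonneg _) hp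

theorem integrable_fullWeight [IsFiniteMeasure m] [IsFiniteMeasure r] (hG : Measurable G)
    (n₁ n₂ : ℕ) :
    Integrable (fun p => fullWeight G η p) (boxMeasure m r ν n₁ n₂) :=
  Integrable.of_bound (measurable_fullWeight hG η n₁ n₂).aestronglyMeasurable 1
    (ae_of_all _ fun p => (norm_fullWeight G η p).le)

theorem densityProd_split {k₁ l₁ n₁ k₂ l₂ n₂ : ℕ} (e₁ : Fin k₁ ⊕ Fin l₁ ≃ Fin n₁)
    (e₂ : Fin k₂ ⊕ Fin l₂ ≃ Fin n₂)
    (p : (Fin n₁ → MarkedPoint d) × (Fin n₂ → MarkedPoint d)) :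
    densityProd ν p = densityProd ν (splitLeft e₁ e₂ p) * densityProd ν (splitRight e₁ e₂ p) := by
  unfold densityProd
  rw [← e₂.prod_comp, Fintype.prod_sum_type]
  rfl

/-- The convolution identity for the integrals over a finite system. -/
theorem weightIntegral_eq_sum [IsFiniteMeasure m] [IsFiniteMeasure r] (hG : Measurable G)
    (hφ : ∀ n₁ n₂, Integrable (fun p => pottsCluster G η p) (boxMeasure m r ν n₁ n₂))
    (n₁ n₂ : ℕ) :
    weightIntegral m r ν G η n₁ n₂ =
      ∑ k ∈ Finset.HasAntidiagonal.antidiagonal n₁, ∑ l ∈ Finset.HasAntidiagonal.antidiagonal n₂,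
        weightIntegral m r ν G 0 k.1 l.1 * clusterIntegral m r ν G η k.2 l.2 := by
  set W : ℕ → ℕ → ℂ := fun k l =>
    ∫ p, fullWeight G 0 p * densityProd ν p ∂(boxMeasure m r ν k l) with hW
  set Φ : ℕ → ℕ → ℂ := fun k l =>
    ∫ p, pottsCluster G η p * densityProd ν p ∂(boxMeasure m r ν k l) with hΦ
  have hIW := fun k l => integrable_mul_densityProd ν
    (integrable_fullWeight (m := m) (r := r) (η := 0) ν hG k l)
  have hIΦ := fun k l => integrable_mul_densityProd ν (hφ k l)
  have h1 : ∫ p, fullWeight G η p * densityProd ν p ∂(boxMeasure m r ν n₁ n₂) =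
      ∑ σ₁ : Finset (Fin n₁), ∑ σ₂ : Finset (Fin n₂),
        W σ₁.card σ₂.card * Φ (n₁ - σ₁.card) (n₂ - σ₂.card) := by
    have hpt : ∀ p : (Fin n₁ → MarkedPoint d) × (Fin n₂ → MarkedPoint d),
        fullWeight G η p * densityProd ν p =
        ∑ σ₁ : Finset (Fin n₁), ∑ σ₂ : Finset (Fin n₂),
          (fun p => fullWeight G 0 p * densityProd ν p)
            (splitLeft (finsetSplit σ₁) (finsetSplit σ₂) p) *
          (fun p => pottsCluster G η p * densityProd ν p)
            (splitRight (finsetSplit σ₁) (finsetSplit σ₂) p) := by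
      intro p
      rw [fullWeight_eq_sum, Finset.sum_mul]
      refine Finset.sum_congr rfl fun σ₁ _ => ?_
      rw [Finset.sum_mul]
      refine Finset.sum_congr rfl fun σ₂ _ => ?_
      rw [densityProd_split ν (finsetSplit σ₁) (finsetSplit σ₂) p]
      ring
    have hI : ∀ (σ₁ : Finset (Fin n₁)) (σ₂ : Finset (Fin n₂)), Integrable (fun p =>
        (fun p => fullWeight G 0 p * densityProd ν p)
            (splitLeft (finsetSplit σ₁) (finsetSplit σ₂) p) *
          (fun p => pottsCluster G η p * densityProd ν p)
            (splitRight (finsetSplit σ₁) (finsetSplit σ₂) p)) (boxMeasure m r ν n₁ n₂) :=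
      fun σ₁ σ₂ => integrable_split _ _ (finsetSplit σ₁) (finsetSplit σ₂)
        (hIW _ _) (hIΦ _ _)
    rw [integral_congr_ae (ae_of_all _ hpt), integral_finsetSum _ fun σ₁ _ =>
      integrable_finsetSum _ fun σ₂ _ => hI σ₁ σ₂]
    refine Finset.sum_congr rfl fun σ₁ _ => ?_
    rw [integral_finsetSum _ fun σ₂ _ => hI σ₁ σ₂]
    refine Finset.sum_congr rfl fun σ₂ _ => ?_
    exact integral_split _ _ (finsetSplit σ₁) (finsetSplit σ₂) (hIW _ _) (hIΦ _ _)
  -- After integration only the sizes of the subsets matter; the binomial coefficients counting them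
  -- cancel the factorials.
  have h2 : ∀ (n : ℕ) (f : ℕ → ℂ), ∑ σ : Finset (Fin n), f σ.card =
      ∑ k ∈ Finset.HasAntidiagonal.antidiagonal n, (n.factorial : ℂ) / (k.1.factorial * k.2.factorial) * f k.1 := by
    intro n f
    rw [← Finset.powerset_univ, Finset.sum_powerset_apply_card, Finset.card_univ, Fintype.card_fin,
      Finset.Nat.sum_antidiagonal_eq_sum_range_succ_mk]
    refine Finset.sum_congr rfl fun k hk => ?_
    have hk' : k ≤ n := Nat.lt_succ_iff.1 (Finset.mem_range.1 hk)
    rw [nsmul_eq_mul, Nat.cast_choose ℂ hk']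
  rw [weightIntegral, h1, h2 n₁ (fun a => ∑ σ₂ : Finset (Fin n₂), W a σ₂.card * Φ (n₁ - a)
    (n₂ - σ₂.card)), Finset.mul_sum]
  refine Finset.sum_congr rfl fun k hk => ?_
  rw [h2 n₂ (fun b => W k.1 b * Φ (n₁ - k.1) (n₂ - b)), Finset.mul_sum, Finset.mul_sum]
  refine Finset.sum_congr rfl fun l hl => ?_
  rw [Finset.HasAntidiagonal.mem_antidiagonal] at hk hl
  have e1 : n₁ - k.1 = k.2 := by omega
  have e2 : n₂ - l.1 = l.2 := by omega
  rw [e1, e2, weightIntegral, clusterIntegral]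
  have f1 : (n₁.factorial : ℂ) ≠ 0 := by exact_mod_cast n₁.factorial_ne_zero
  have f2 : (n₂.factorial : ℂ) ≠ 0 := by exact_mod_cast n₂.factorial_ne_zero
  have f3 : (k.1.factorial : ℂ) ≠ 0 := by exact_mod_cast k.1.factorial_ne_zero
  have f4 : (k.2.factorial : ℂ) ≠ 0 := by exact_mod_cast k.2.factorial_ne_zero
  have f5 : (l.1.factorial : ℂ) ≠ 0 := by exact_mod_cast l.1.factorial_ne_zero
  have f6 : (l.2.factorial : ℂ) ≠ 0 := by exact_mod_cast l.2.factorial_ne_zero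
  simp only [hW, hΦ]
  field_simp

end ConvolutionIntegrals

/-! ### Cauchy products of double series -/

/-- Pairs of natural numbers have antidiagonals. -/
instance hasAntidiagonalNatProd : Finset.HasAntidiagonal (ℕ × ℕ) where
  antidiagonal n := (Finset.HasAntidiagonal.antidiagonal n.1 ×ˢ Finset.HasAntidiagonal.antidiagonal n.2).map
    (Equiv.prodProdProdComm ℕ ℕ ℕ ℕ).toEmbedding
  mem_antidiagonal {n a} := by
    obtain ⟨n₁, n₂⟩ := n
    obtain ⟨⟨a, b⟩, ⟨c, d⟩⟩ := a
    simp only [Finset.mem_map_equiv, Finset.mem_product, Finset.HasAntidiagonal.mem_antidiagonal,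
      Equiv.prodProdProdComm_symm, Equiv.prodProdProdComm_apply, Prod.mk_add_mk, Prod.mk.injEq]

theorem tsum_mul_tsum_natProd {f g : ℕ × ℕ → ℂ} (hf : Summable fun n => ‖f n‖)
    (hg : Summable fun n => ‖g n‖) :
    (∑' n, f n) * ∑' n, g n = ∑' n : ℕ × ℕ, ∑ k ∈ Finset.HasAntidiagonal.antidiagonal n.1,
      ∑ l ∈ Finset.HasAntidiagonal.antidiagonal n.2, f (k.1, l.1) * g (k.2, l.2) := by
  rw [hf.of_norm.tsum_mul_tsum_eq_tsum_sum_antidiagonal hg.of_norm (summable_mul_of_summable_norm hf hg)]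
  refine tsum_congr fun n => ?_
  rw [← Finset.sum_product']
  exact Finset.sum_map _ _ _

/-! ### The partition functions of a finite volume -/

theorem measurable_sigma_of_forall {ι : Type*} {X : ι → Type*} {Y : Type*}
    [∀ i, MeasurableSpace (X i)] [MeasurableSpace Y] {f : (Σ i, X i) → Y}
    (h : ∀ i, Measurable fun x : X i => f ⟨i, x⟩) : Measurable f := by
  intro t ht
  refine MeasurableSpace.measurableSet_iInf.2 fun i => ?_
  exact h i ht

theorem measurable_sigmaMk' {ι : Type*} {X : ι → Type*} [∀ i, MeasurableSpace (X i)] (i : ι) :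
    Measurable (Sigma.mk i : X i → Σ i, X i) :=
  Measurable.of_le_map (iInf_le _ i)

section FiniteVolume

variable {d : ℕ}

theorem field_add_config (G : E d → ℝ) (η : E d →₀ ℝ) (n : ℕ) (x : Fin n → MarkedPoint d) (y : E d) :
    field G (η + config ⟨n, x⟩) y = field G η y + ∑ j, (x j).2 * G (y - (x j).1) := by
  have h0 : ∀ a : E d, (0 : ℝ) * G (y - a) = 0 := fun a => zero_mul _
  have hadd : ∀ (a : E d) (s t : ℝ), (s + t) * G (y - a) = s * G (y - a) + t * G (y - a) :=
    fun a s t => add_mul _ _ _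
  unfold field config
  rw [Finsupp.sum_add_index' h0 hadd, ← Finsupp.sum_finsetSum_index h0 hadd]
  congr 1
  exact Finset.sum_congr rfl fun j _ => Finsupp.sum_single_index (zero_mul _)

theorem measurable_field {G : E d → ℝ} (hG : Measurable G) (η : E d →₀ ℝ) :
    Measurable (field G η) := by
  unfold field Finsupp.sum
  exact Finset.measurable_sum _ fun a _ =>
    (hG.comp (measurable_id.sub measurable_const)).const_mul _

theorem measurable_field_config {G : E d → ℝ} (hG : Measurable G) (η : E d →₀ ℝ) (n : ℕ)
    {Ω : Type*} [MeasurableSpace Ω] {x : Ω → Fin n → MarkedPoint d} {y : Ω → E d}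
    (hx : Measurable x) (hy : Measurable y) :
    Measurable fun ω => field G (η + config ⟨n, x ω⟩) (y ω) := by
  simp_rw [field_add_config]
  refine ((measurable_field hG η).comp hy).add (Finset.measurable_sum _ fun j _ => ?_)
  have hj : Measurable fun ω => x ω j := (measurable_pi_apply j).comp hx
  exact (measurable_snd.comp hj).mul (hG.comp (hy.sub (measurable_fst.comp hj)))

/-- There is no interaction within a component, so for a fixed first component the points of the
second are independent, each in the field of `η` and `x`. Evenness of `G` reconciles the `G(x - y)`
of the pair energy with the reversed difference in the field. -/
theorem fullWeight_eq_prod {G : E d → ℝ} (hGe : ∀ x, G (-x) = G x) (η : E d →₀ ℝ) {n₁ n₂ : ℕ}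
    (x : Fin n₁ → MarkedPoint d) (q : Fin n₂ → MarkedPoint d) :
    fullWeight G η (x, q) =
      ∏ j, Complex.exp (Complex.I * (((q j).2 * field G (η + config ⟨n₁, x⟩) (q j).1 : ℝ) : ℂ)) := by
  unfold fullWeight pottsWeight
  rw [← Complex.exp_sum, ← Finset.mul_sum, ← Complex.ofReal_sum]
  congr 3
  have hG' : ∀ a b : E d, G (a - b) = G (b - a) := by
    intro a b
    rw [← hGe, neg_sub]
  simp only [Fintype.sum_sum_type, family, Sum.elim_inl, Sum.elim_inr, pairEnergy,
    Finset.sum_const_zero, zero_add, add_zero]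
  rw [Finset.sum_comm, Finset.sum_comm (s := (Finset.univ : Finset (Fin n₁))),
    ← Finset.sum_add_distrib]
  refine Finset.sum_congr rfl fun j _ => ?_
  rw [field_add_config, mul_add, Finset.mul_sum]
  congr 1
  · unfold field Finsupp.sum
    rw [Finset.mul_sum]
    refine Eq.trans (Finset.sum_congr rfl fun a _ => ?_) (Finset.sum_coe_sort η.support
      (fun a => (q j).2 * (η a * G ((q j).1 - a))))
    rw [hG']
    ring
  · refine Finset.sum_congr rfl fun i _ => ?_
    rw [hG']
    ring

variable (m : Measure (E d)) (r : Measure ℝ) (ν : ComplexMeasure ℝ) (G : E d → ℝ)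

/-- The phase integral `∫ dm(y) ∫ e^{iα(G*η)(y)} dν(α)`. -/
def phaseIntegral (η : E d →₀ ℝ) : ℂ :=
  ∫ q : MarkedPoint d, Complex.exp (Complex.I * ((q.2 * field G η q.1 : ℝ) : ℂ)) * density ν q.2
    ∂(m.prod (modulus ν))

variable {G}

theorem measurable_phase {Ω : Type*} [MeasurableSpace Ω] {f a : Ω → ℝ} (hf : Measurable f)
    (ha : Measurable a) :
    Measurable fun x => Complex.exp (Complex.I * ((a x * f x : ℝ) : ℂ)) * density ν (a x) :=
  (Complex.measurable_exp.comp (measurable_const.mul (Complex.measurable_ofReal.comp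
    (ha.mul hf)))).mul ((measurable_density ν).comp ha)

theorem ae_norm_phase_le [SFinite m] (f : E d → ℝ) :
    ∀ᵐ q ∂(m.prod (modulus ν)),
      ‖Complex.exp (Complex.I * ((q.2 * f q.1 : ℝ) : ℂ)) * density ν q.2‖ ≤ 1 := by
  filter_upwards [(Measure.quasiMeasurePreserving_snd (μ := m) (ν := modulus ν)).ae
    (ae_norm_density_le ν)] with q hq
  rw [norm_mul, Complex.norm_exp_I_mul_ofReal, one_mul]
  exact hq

theorem integrable_phase [IsFiniteMeasure m] (hG : Measurable G) (η : E d →₀ ℝ) :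
    Integrable (fun q : MarkedPoint d =>
      Complex.exp (Complex.I * ((q.2 * field G η q.1 : ℝ) : ℂ)) * density ν q.2)
      (m.prod (modulus ν)) :=
  Integrable.of_bound (measurable_phase ν ((measurable_field hG η).comp measurable_fst)
    measurable_snd).aestronglyMeasurable 1 (ae_norm_phase_le m ν _)

theorem norm_phaseIntegral_le [IsFiniteMeasure m] (η : E d →₀ ℝ) :
    ‖phaseIntegral m ν G η‖ ≤ (m.prod (modulus ν)).real Set.univ := by
  have h := norm_integral_le_of_norm_le_const (ae_norm_phase_le m ν (field G η))
  rwa [one_mul] at h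

theorem measurable_phaseIntegral [IsFiniteMeasure m] (hG : Measurable G) (η : E d →₀ ℝ) (n : ℕ) :
    Measurable fun x : Fin n → MarkedPoint d => phaseIntegral m ν G (η + config ⟨n, x⟩) := by
  have hf : Measurable fun p : (Fin n → MarkedPoint d) × MarkedPoint d =>
      field G (η + config ⟨n, p.1⟩) p.2.1 :=
    measurable_field_config hG η n measurable_fst (measurable_fst.comp measurable_snd)
  have ha : Measurable fun p : (Fin n → MarkedPoint d) × MarkedPoint d => p.2.2 :=
    measurable_snd.comp measurable_snd
  have h := measurable_phase ν hf ha
  unfold phaseIntegral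
  exact (h.stronglyMeasurable.integral_prod_right (ν := m.prod (modulus ν))).measurable

/-- The total mass `ν(ℝ)`. -/
def totalMass : ℂ := ∫ α, density ν α ∂(modulus ν)

/-- The term `1` of `1 - e^{iαt}` yields the volume term, independent of `η`. The symmetry of `ν` is
what makes the real energy density equal to its complex form. -/
theorem interaction_eq (hν : ∀ A, MeasurableSet A → ν A = starRingEnd ℂ (ν ((fun α => -α) ⁻¹' A)))
    (hG : Measurable G) (Λ : TopologicalSpace.Compacts (E d)) (η : E d →₀ ℝ) :
    ((interaction ν G Λ η : ℝ) : ℂ) = (volume.real (Λ : Set (E d)) : ℂ) * totalMass ν -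
      phaseIntegral (volume.restrict (Λ : Set (E d))) ν G η := by
  have : IsFiniteMeasure (volume.restrict (Λ : Set (E d))) :=
    ⟨by simpa using Λ.isCompact.measure_lt_top⟩
  have hI : Integrable (density ν) (modulus ν) := ν.integrable_rnDeriv (modulus ν)
  have h1 : ∀ t : ℝ, ((energyDensity ν t : ℝ) : ℂ) = totalMass ν -
      ∫ α, Complex.exp (Complex.I * ((α * t : ℝ) : ℂ)) * density ν α ∂(modulus ν) := by
    intro t
    have hre : ((energyDensity ν t : ℝ) : ℂ) = energyDensityC ν t :=
      Complex.ext (by simp [energyDensity]) (by simp [energyDensityC_im ν hν t])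
    have hI2 : Integrable (fun α => Complex.exp (Complex.I * ((α * t : ℝ) : ℂ)) * density ν α)
        (modulus ν) := by
      refine hI.mono (measurable_phase ν measurable_const measurable_id).aestronglyMeasurable
        (ae_of_all _ fun α => ?_)
      rw [norm_mul, Complex.norm_exp_I_mul_ofReal, one_mul]
    rw [hre, energyDensityC, totalMass, ← integral_sub hI hI2]
    simp_rw [sub_mul, one_mul]
  have hint := integrable_phase (volume.restrict (Λ : Set (E d))) ν hG η
  unfold interaction
  rw [← integral_complex_ofReal, integral_congr_ae (ae_of_all _ fun x => h1 (field G η x)),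
    integral_sub (integrable_const _) hint.integral_prod_left, phaseIntegral, integral_prod _ hint,
    integral_const]
  simp [Measure.real]

theorem exp_interaction_eq
    (hν : ∀ A, MeasurableSet A → ν A = starRingEnd ℂ (ν ((fun α => -α) ⁻¹' A)))
    (hG : Measurable G) (Λ : TopologicalSpace.Compacts (E d)) (η : E d →₀ ℝ) (β : ℝ) :
    ((Real.exp (-β * interaction ν G Λ η) : ℝ) : ℂ) =
      Complex.exp (-(β * (volume.real (Λ : Set (E d)) * totalMass ν))) *
        Complex.exp (β * phaseIntegral (volume.restrict (Λ : Set (E d))) ν G η) := by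
  rw [← Complex.exp_add, Complex.ofReal_exp]
  congr 1
  rw [Complex.ofReal_mul, interaction_eq ν hν hG]
  push_cast
  ring

/-- By independence the second component contributes one phase integral per point; so the powers of
`β` will resum to an exponential. -/
theorem integral_fullWeight_right [IsFiniteMeasure m] (hGe : ∀ x, G (-x) = G x) (η : E d →₀ ℝ)
    {n₁ : ℕ} (n₂ : ℕ) (x : Fin n₁ → MarkedPoint d) :
    ∫ q : Fin n₂ → MarkedPoint d, fullWeight G η (x, q) * densityProd ν (x, q)
        ∂(Measure.pi fun _ => m.prod (modulus ν)) =
      phaseIntegral m ν G (η + config ⟨n₁, x⟩) ^ n₂ := by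
  have h := integral_fintype_prod_eq_pow (ι := Fin n₂) (μ := m.prod (modulus ν))
    (fun q : MarkedPoint d => Complex.exp (Complex.I *
      ((q.2 * field G (η + config ⟨n₁, x⟩) q.1 : ℝ) : ℂ)) * density ν q.2)
  rw [Fintype.card_fin] at h
  rw [phaseIntegral, ← h]
  refine integral_congr_ae (ae_of_all _ fun q => ?_)
  simp only [fullWeight_eq_prod hGe, densityProd, ← Finset.prod_mul_distrib]

/-- The expansion of the phase factor in powers of `β`, integrated over the first component. -/
theorem hasSum_integral_exp_phaseIntegral [IsFiniteMeasure m] [IsFiniteMeasure r]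
    (hG : Measurable G) (hGe : ∀ x, G (-x) = G x) (η : E d →₀ ℝ) (n₁ : ℕ) (β : ℂ) :
    HasSum (fun n₂ : ℕ => β ^ n₂ * ((n₁.factorial : ℂ) * weightIntegral m r ν G η n₁ n₂))
      (∫ x : Fin n₁ → MarkedPoint d, Complex.exp (β * phaseIntegral m ν G (η + config ⟨n₁, x⟩))
        ∂(Measure.pi fun _ => m.prod r)) := by
  set A : (Fin n₁ → MarkedPoint d) → ℂ := fun x => phaseIntegral m ν G (η + config ⟨n₁, x⟩) with hA
  have hAm : Measurable A := measurable_phaseIntegral m ν hG η n₁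
  set M := (m.prod (modulus ν)).real Set.univ
  have hAb : ∀ x, ‖A x‖ ≤ M := fun x => norm_phaseIntegral_le m ν _
  set F : ℕ → (Fin n₁ → MarkedPoint d) → ℂ := fun n x => (β * A x) ^ n / (n.factorial : ℂ) with hF
  have hFm : ∀ n, Measurable (F n) := fun n => ((hAm.const_mul β).pow_const n).div_const _
  have hFb : ∀ n x, ‖F n x‖ ≤ (‖β‖ * M) ^ n / (n.factorial : ℝ) := by
    intro n x
    rw [hF]
    simp only [norm_div, norm_pow, norm_mul, Complex.norm_natCast]
    gcongr
    exact hAb x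
  have hFi : ∀ n, Integrable (F n) (Measure.pi fun _ : Fin n₁ => m.prod r) := fun n =>
    Integrable.of_bound (hFm n).aestronglyMeasurable _ (ae_of_all _ (hFb n))
  -- The phase integral is bounded uniformly in `x`, so an exponential series dominates and sum and
  -- integral may be exchanged.
  have hs : Summable fun n => ∫ x, ‖F n x‖ ∂(Measure.pi fun _ : Fin n₁ => m.prod r) := by
    refine Summable.of_nonneg_of_le (fun n => integral_nonneg fun _ => norm_nonneg _) (fun n => ?_)
      ((Real.summable_pow_div_factorial (‖β‖ * M)).mul_right
        ((Measure.pi fun _ : Fin n₁ => m.prod r).real Set.univ))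
    refine (integral_mono (hFi n).norm (integrable_const _) (hFb n)).trans (le_of_eq ?_)
    rw [integral_const, smul_eq_mul, mul_comm]
  have key := hasSum_integral_of_summable_integral_norm hFi hs
  have hexp : ∀ x, ∑' n, F n x = Complex.exp (β * A x) := by
    intro x
    rw [Complex.exp_eq_exp_ℂ]
    exact (NormedSpace.expSeries_div_hasSum_exp (β * A x)).tsum_eq
  simp_rw [hexp] at key
  refine (funext fun n => ?_ : (fun n₂ : ℕ => β ^ n₂ *
    ((n₁.factorial : ℂ) * weightIntegral m r ν G η n₁ n₂)) = _) ▸ key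
  have hint := integrable_mul_densityProd ν
    (integrable_fullWeight (m := m) (r := r) (η := η) ν hG n₁ n)
  have hprod : ∫ p, fullWeight G η p * densityProd ν p ∂(boxMeasure m r ν n₁ n) =
      ∫ x, A x ^ n ∂(Measure.pi fun _ : Fin n₁ => m.prod r) := by
    refine (integral_prod _ hint).trans (integral_congr_ae (ae_of_all _ fun x => ?_))
    exact integral_fullWeight_right m ν hGe η n x
  rw [weightIntegral, hprod]
  simp only [hF, mul_pow]
  rw [integral_div, integral_const_mul]
  have f1 : (n₁.factorial : ℂ) ≠ 0 := by exact_mod_cast n₁.factorial_ne_zero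
  have f2 : (n.factorial : ℂ) ≠ 0 := by exact_mod_cast n.factorial_ne_zero
  field_simp

/-- In finite volume the weights have modulus one and the measures are finite, so two exponential
series dominate, for all complex `z` and `β`. -/
theorem summable_norm_weightIntegral [IsFiniteMeasure m] [IsProbabilityMeasure r]
    (hG : Measurable G) (η : E d →₀ ℝ) (z β : ℂ) :
    Summable fun n : ℕ × ℕ => ‖weightIntegral m r ν G η n.1 n.2 * z ^ n.1 * β ^ n.2‖ := by
  set V := (m.prod r).real Set.univ
  set M := (m.prod (modulus ν)).real Set.univ
  have hs : Summable fun n : ℕ × ℕ => (‖z‖ * V) ^ n.1 / (n.1.factorial : ℝ) *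
      ((‖β‖ * M) ^ n.2 / (n.2.factorial : ℝ)) :=
    (Real.summable_pow_div_factorial _).mul_of_nonneg (Real.summable_pow_div_factorial _)
      (fun _ => by positivity) (fun _ => by positivity)
  refine Summable.of_nonneg_of_le (fun _ => norm_nonneg _) (fun n => ?_) hs
  have hI := integrable_fullWeight (m := m) (r := r) (η := η) ν hG n.1 n.2
  have h1 : ‖∫ p, fullWeight G η p * densityProd ν p ∂(boxMeasure m r ν n.1 n.2)‖ ≤
      V ^ n.1 * M ^ n.2 := by
    refine (norm_integral_mul_densityProd_le ν hI).trans (le_of_eq ?_)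
    simp_rw [norm_fullWeight]
    rw [integral_const, smul_eq_mul, mul_one, boxMeasure, Measure.real, ← Set.univ_prod_univ,
      Measure.prod_prod, Measure.pi_univ, Measure.pi_univ]
    simp [V, M, Measure.real]
  rw [weightIntegral, norm_mul, norm_mul, norm_mul, norm_inv, norm_mul, norm_pow, norm_pow,
    Complex.norm_natCast, Complex.norm_natCast]
  calc _ ≤ ((n.1.factorial : ℝ) * (n.2.factorial : ℝ))⁻¹ * (V ^ n.1 * M ^ n.2) * ‖z‖ ^ n.1 *
        ‖β‖ ^ n.2 := by gcongr
    _ = _ := by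
      rw [mul_pow, mul_pow]
      field_simp

end FiniteVolume

/-! ### Correlation functionals in finite volume -/

section Correlation

variable {d : ℕ} {r : Measure ℝ} [IsProbabilityMeasure r] (ν : ComplexMeasure ℝ) {G : E d → ℝ}

/-- The unnormalized correlation functional. -/
def partitionFunction (r : Measure ℝ) (ν : ComplexMeasure ℝ) (G : E d → ℝ) (z β : ℝ)
    (Λ : TopologicalSpace.Compacts (E d)) (η : E d →₀ ℝ) : ℝ :=
  ∫ ω, Real.exp (-β * interaction ν G Λ (η + config ω)) ∂(poissonLaw z r Λ)

instance isFiniteMeasure_restrict_compacts (Λ : TopologicalSpace.Compacts (E d)) :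
    IsFiniteMeasure (volume.restrict (Λ : Set (E d))) :=
  ⟨by simpa using Λ.isCompact.measure_lt_top⟩

theorem integrable_exp_interaction
    (hν : ∀ A, MeasurableSet A → ν A = starRingEnd ℂ (ν ((fun α => -α) ⁻¹' A)))
    (hG : Measurable G) {z : ℝ} (hz : 0 ≤ z) (β : ℝ)
    (Λ : TopologicalSpace.Compacts (E d)) (η : E d →₀ ℝ) :
    Integrable (fun ω => Real.exp (-β * interaction ν G Λ (η + config ω))) (poissonLaw z r Λ) := by
  have := isProbabilityMeasure_poissonLaw z hz r Λ
  set m := volume.restrict (Λ : Set (E d))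
  -- The form with the phase integral gives both measurability in `ω` and a bound uniform in the
  -- number of points.
  have hexp : ∀ ω, Real.exp (-β * interaction ν G Λ (η + config ω)) =
      ‖Complex.exp (-(β * (volume.real (Λ : Set (E d)) * totalMass ν))) *
        Complex.exp (β * phaseIntegral m ν G (η + config ω))‖ := by
    intro ω
    rw [← exp_interaction_eq ν hν hG, Complex.norm_real, Real.norm_eq_abs, Real.abs_exp]
  simp_rw [hexp]
  refine Integrable.of_bound (Measurable.aestronglyMeasurable (measurable_sigma_of_forall
    fun n => ?_)) (‖Complex.exp (-(β * (volume.real (Λ : Set (E d)) * totalMass ν)))‖ *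
      Real.exp (|β| * (m.prod (modulus ν)).real Set.univ)) (ae_of_all _ fun ω => ?_)
  · exact ((Complex.measurable_exp.comp
      ((measurable_phaseIntegral m ν hG η n).const_mul (β : ℂ))).const_mul _).norm
  · rw [norm_norm, norm_mul]
    gcongr
    refine (Complex.norm_exp_le_exp_norm _).trans (Real.exp_le_exp.2 ?_)
    rw [norm_mul, Complex.norm_real, Real.norm_eq_abs]
    gcongr
    exact norm_phaseIntegral_le m ν _

/-- Justifies the division by the partition function: for real `β` and `z ≥ 0` it is the expectation
of a positive variable, so no analysis of zeros is needed. -/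
theorem partitionFunction_pos
    (hν : ∀ A, MeasurableSet A → ν A = starRingEnd ℂ (ν ((fun α => -α) ⁻¹' A)))
    (hG : Measurable G) {z : ℝ} (hz : 0 ≤ z) (β : ℝ)
    (Λ : TopologicalSpace.Compacts (E d)) (η : E d →₀ ℝ) :
    0 < partitionFunction r ν G z β Λ η := by
  have := isProbabilityMeasure_poissonLaw z hz r Λ
  exact integral_exp_pos (integrable_exp_interaction ν hν hG hz β Λ η)

/-- The expansion of the unnormalized correlation functional in powers of `z` and `β`. -/
theorem hasSum_partitionFunction
    (hν : ∀ A, MeasurableSet A → ν A = starRingEnd ℂ (ν ((fun α => -α) ⁻¹' A)))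
    (hG : Measurable G) (hGe : ∀ x, G (-x) = G x) {z : ℝ} (hz : 0 ≤ z) (β : ℝ)
    (Λ : TopologicalSpace.Compacts (E d)) (η : E d →₀ ℝ) :
    HasSum (fun n : ℕ × ℕ => weightIntegral (volume.restrict (Λ : Set (E d))) r ν G η n.1 n.2 *
        (z : ℂ) ^ n.1 * (β : ℂ) ^ n.2)
      (Complex.exp (z * volume.real (Λ : Set (E d))) *
        Complex.exp (β * (volume.real (Λ : Set (E d)) * totalMass ν)) *
        (partitionFunction r ν G z β Λ η : ℂ)) := by
  set m := volume.restrict (Λ : Set (E d)) with hm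
  set V := volume.real (Λ : Set (E d)) with hV
  set c₀ := Complex.exp (-(β * (V * totalMass ν))) with hc₀
  set J : ℕ → ℂ := fun n => ∫ x : Fin n → MarkedPoint d,
    Complex.exp (β * phaseIntegral m ν G (η + config ⟨n, x⟩)) ∂(Measure.pi fun _ => m.prod r) with hJ
  set w : ℕ → ℝ := fun n => Real.exp (-(z * V)) * z ^ n / (n.factorial : ℝ) with hw
  have hw0 : ∀ n, 0 ≤ w n := fun n => by positivity
  have hI : Integrable (fun ω => ((Real.exp (-β * interaction ν G Λ (η + config ω)) : ℝ) : ℂ))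
      (poissonLaw z r Λ) := (integrable_exp_interaction (r := r) ν hν hG hz β Λ η).ofReal
  -- Conditioning on the number `n` of points of the noise.
  have h1 : HasSum (fun n => (w n : ℂ) * (c₀ * J n)) (partitionFunction r ν G z β Λ η : ℂ) := by
    have h2 := hasSum_integral_measure hI
    have h3 : (partitionFunction r ν G z β Λ η : ℂ) = ∫ ω,
        ((Real.exp (-β * interaction ν G Λ (η + config ω)) : ℝ) : ℂ) ∂(poissonLaw z r Λ) :=
      integral_complex_ofReal.symm
    rw [h3]
    refine (funext fun n => ?_ : (fun n => (w n : ℂ) * (c₀ * J n)) = _) ▸ h2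
    have hm' : Measurable fun ω : Σ n : ℕ, Fin n → MarkedPoint d =>
        ((Real.exp (-β * interaction ν G Λ (η + config ω)) : ℝ) : ℂ) := by
      simp_rw [exp_interaction_eq ν hν hG]
      exact measurable_sigma_of_forall fun n => (Complex.measurable_exp.comp
        ((measurable_phaseIntegral m ν hG η n).const_mul (β : ℂ))).const_mul _
    have hmap := integral_map (μ := Measure.pi fun _ : Fin n => m.prod r)
      (measurable_sigmaMk' (X := fun n : ℕ => Fin n → MarkedPoint d) n).aemeasurable
      hm'.aestronglyMeasurable
    rw [integral_smul_measure, hmap, ENNReal.toReal_ofReal (hw0 n), Complex.real_smul]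
    congr 1
    rw [hJ, ← integral_const_mul]
    refine integral_congr_ae (ae_of_all _ fun x => ?_)
    exact (exp_interaction_eq ν hν hG Λ (η + config ⟨n, x⟩) β).symm
  have hs := summable_norm_weightIntegral (m := m) (r := r) ν hG η (z : ℂ) (β : ℂ)
  obtain ⟨S, hS⟩ := hs.of_norm
  have hfib : ∀ n₁ : ℕ, HasSum (fun n₂ : ℕ => weightIntegral m r ν G η n₁ n₂ * (z : ℂ) ^ n₁ *
      (β : ℂ) ^ n₂) ((z : ℂ) ^ n₁ / (n₁.factorial : ℂ) * J n₁) := by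
    intro n₁
    have f1 : (n₁.factorial : ℂ) ≠ 0 := by exact_mod_cast n₁.factorial_ne_zero
    have h := (hasSum_integral_exp_phaseIntegral m r ν hG hGe η n₁ (β : ℂ)).mul_left
      ((z : ℂ) ^ n₁ / (n₁.factorial : ℂ))
    refine (funext fun n₂ => ?_ : (fun n₂ : ℕ => weightIntegral m r ν G η n₁ n₂ * (z : ℂ) ^ n₁ *
      (β : ℂ) ^ n₂) = _) ▸ h
    field_simp
  have h4 := hS.prod_fiberwise hfib
  -- The prefactor in the statement removes the Poisson normalization `e^{-z|Λ|}` and the volume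
  -- term of the energy; being independent of `η`, it drops out of quotients.
  have hcancel : Complex.exp (z * V) * Complex.exp (β * (V * totalMass ν)) *
      (Complex.exp (-(z * V)) * c₀) = 1 := by
    rw [hc₀, ← Complex.exp_add, ← Complex.exp_add, ← Complex.exp_add, ← Complex.exp_zero]
    congr 1
    ring
  have h5 := h1.mul_left (Complex.exp (z * V) * Complex.exp (β * (V * totalMass ν)))
  have h6 : (fun n => Complex.exp (z * V) * Complex.exp (β * (V * totalMass ν)) *
      ((w n : ℂ) * (c₀ * J n))) = fun n => (z : ℂ) ^ n / (n.factorial : ℂ) * J n := by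
    funext n
    have hwn : (w n : ℂ) = Complex.exp (-(z * V)) * ((z : ℂ) ^ n / (n.factorial : ℂ)) := by
      rw [hw]; push_cast; ring
    rw [hwn]
    linear_combination ((z : ℂ) ^ n / (n.factorial : ℂ) * J n) * hcancel
  rw [h6] at h5
  rwa [← h4.unique h5]

/-- The set of families of points with all positions in `Λ`. -/
def boxSet (Λ : Set (E d)) (n₁ n₂ : ℕ) :
    Set ((Fin n₁ → MarkedPoint d) × (Fin n₂ → MarkedPoint d)) :=
  (Set.univ.pi fun _ => Λ ×ˢ Set.univ) ×ˢ (Set.univ.pi fun _ => Λ ×ˢ Set.univ)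

/-- Finite-volume integrals are infinite-volume integrals over a box: this yields bounds uniform in
`Λ` and turns the limit into one of indicators. -/
theorem boxMeasure_restrict (m : Measure (E d)) [SigmaFinite m] (r : Measure ℝ) [IsFiniteMeasure r]
    (Λ : Set (E d)) (n₁ n₂ : ℕ) :
    boxMeasure (m.restrict Λ) r ν n₁ n₂ = (boxMeasure m r ν n₁ n₂).restrict (boxSet Λ n₁ n₂) := by
  have h2 : ∀ (k : Measure ℝ) [IsFiniteMeasure k] (n : ℕ),
      (Measure.pi fun _ : Fin n => (m.restrict Λ).prod k) =
        (Measure.pi fun _ : Fin n => m.prod k).restrict (Set.univ.pi fun _ => Λ ×ˢ Set.univ) := by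
    intro k _ n
    rw [Measure.restrict_pi_pi, ← Measure.prod_restrict, Measure.restrict_univ]
  rw [boxMeasure, boxMeasure, boxSet, h2 r, h2 (modulus ν)]
  exact Measure.prod_restrict _ _

theorem boxMeasure_restrict_le (r : Measure ℝ) [IsFiniteMeasure r] (Λ : Set (E d)) (n₁ n₂ : ℕ) :
    boxMeasure (volume.restrict Λ) r ν n₁ n₂ ≤ clusterMeasure d r ν n₁ n₂ := by
  rw [boxMeasure_restrict]
  exact Measure.restrict_le_self (μ := boxMeasure volume r ν n₁ n₂)

theorem integrable_pottsCluster_box (hG : Measurable G) (hGi : Integrable G) {c c' : ℝ}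
    (hrc : r.support ⊆ Set.Icc (-c) c) (hνc' : (modulus ν).support ⊆ Set.Icc (-c') c')
    (η : E d →₀ ℝ) (hη : η ∈ Gamma0 d c) (Λ : Set (E d)) (n₁ n₂ : ℕ) :
    Integrable (fun p => pottsCluster G η p) (boxMeasure (volume.restrict Λ) r ν n₁ n₂) := by
  refine (integrable_pottsCluster (ν := ν) hG hGi hrc hνc' η hη n₁ n₂).mono_measure
    (boxMeasure_restrict_le ν r Λ n₁ n₂)

theorem norm_clusterIntegral_le (hG : Measurable G) (hGi : Integrable G) {c c' : ℝ}
    (hrc : r.support ⊆ Set.Icc (-c) c) (hνc' : (modulus ν).support ⊆ Set.Icc (-c') c')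
    (η : E d →₀ ℝ) (hη : η ∈ Gamma0 d c) (Λ : Set (E d)) (n : ℕ × ℕ) (z β : ℂ) :
    ‖clusterIntegral (volume.restrict Λ) r ν G η n.1 n.2 * z ^ n.1 * β ^ n.2‖ ≤
      ‖z‖ ^ n.1 * ‖β‖ ^ n.2 / ((n.1.factorial : ℝ) * (n.2.factorial : ℝ)) *
        ∫ q, ‖pottsCluster G η q‖ ∂(clusterMeasure d r ν n.1 n.2) := by
  have hI := integrable_pottsCluster (ν := ν) hG hGi hrc hνc' η hη n.1 n.2
  have h1 := norm_integral_mul_densityProd_le ν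
    (integrable_pottsCluster_box ν hG hGi hrc hνc' η hη Λ n.1 n.2)
  have h2 : ∫ q, ‖pottsCluster G η q‖ ∂(boxMeasure (volume.restrict Λ) r ν n.1 n.2) ≤
      ∫ q, ‖pottsCluster G η q‖ ∂(clusterMeasure d r ν n.1 n.2) := by
    exact integral_mono_measure (boxMeasure_restrict_le ν r Λ n.1 n.2)
      (ae_of_all _ fun _ => norm_nonneg _) hI.norm
  rw [clusterIntegral, norm_mul, norm_mul, norm_mul, norm_inv, norm_mul, norm_pow, norm_pow,
    Complex.norm_natCast, Complex.norm_natCast]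
  calc _ ≤ ((n.1.factorial : ℝ) * (n.2.factorial : ℝ))⁻¹ *
        (∫ q, ‖pottsCluster G η q‖ ∂(clusterMeasure d r ν n.1 n.2)) * ‖z‖ ^ n.1 * ‖β‖ ^ n.2 := by
        gcongr
        exact h1.trans h2
    _ = _ := by ring

/-- Division of power series in two variables. -/
theorem div_eq_tsum_of_convolution {F W g : ℕ → ℕ → ℂ} {z β c₁ ZF ZW : ℂ}
    (hconv : ∀ n₁ n₂, F n₁ n₂ = ∑ k ∈ Finset.HasAntidiagonal.antidiagonal n₁,
      ∑ l ∈ Finset.HasAntidiagonal.antidiagonal n₂, W k.1 l.1 * g k.2 l.2)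
    (hF : HasSum (fun n : ℕ × ℕ => F n.1 n.2 * z ^ n.1 * β ^ n.2) (c₁ * ZF))
    (hW : HasSum (fun n : ℕ × ℕ => W n.1 n.2 * z ^ n.1 * β ^ n.2) (c₁ * ZW))
    (hWs : Summable fun n : ℕ × ℕ => ‖W n.1 n.2 * z ^ n.1 * β ^ n.2‖)
    (hgs : Summable fun n : ℕ × ℕ => ‖g n.1 n.2 * z ^ n.1 * β ^ n.2‖)
    (hc₁ : c₁ ≠ 0) (hZ : ZW ≠ 0) :
    ZF / ZW = ∑' n : ℕ × ℕ, g n.1 n.2 * z ^ n.1 * β ^ n.2 := by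
  have h2 := tsum_mul_tsum_natProd hWs hgs
  have h3 : ∀ n : ℕ × ℕ, ∑ k ∈ Finset.HasAntidiagonal.antidiagonal n.1,
      ∑ l ∈ Finset.HasAntidiagonal.antidiagonal n.2,
        (W k.1 l.1 * z ^ k.1 * β ^ l.1) * (g k.2 l.2 * z ^ k.2 * β ^ l.2) =
      F n.1 n.2 * z ^ n.1 * β ^ n.2 := by
    intro n
    rw [hconv, Finset.sum_mul, Finset.sum_mul]
    refine Finset.sum_congr rfl fun k hk => ?_
    rw [Finset.sum_mul, Finset.sum_mul]
    refine Finset.sum_congr rfl fun l hl => ?_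
    rw [Finset.HasAntidiagonal.mem_antidiagonal] at hk hl
    rw [← hk, ← hl, pow_add, pow_add]
    ring
  rw [tsum_congr h3, hW.tsum_eq, hF.tsum_eq] at h2
  rw [div_eq_iff hZ]
  apply mul_left_cancel₀ hc₁
  rw [← h2]
  ring

theorem corr_eq_div (r : Measure ℝ) {z β : ℝ} {η : E d →₀ ℝ} (Λ : TopologicalSpace.Compacts (E d))
    (hΛ : (η.support : Set (E d)) ⊆ Λ) :
    corr r ν G z β Λ η = partitionFunction r ν G z β Λ η / partitionFunction r ν G z β Λ 0 := by
  rw [corr, if_pos hΛ, partitionFunction, partitionFunction]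
  simp_rw [zero_add]

theorem summable_norm_clusterIntegral (hG : Measurable G) (hGi : Integrable G) {c c' : ℝ}
    (hrc : r.support ⊆ Set.Icc (-c) c) (hνc' : (modulus ν).support ⊆ Set.Icc (-c') c')
    {η : E d →₀ ℝ} (hη : η ∈ Gamma0 d c) {z β : ℂ} (hD : (z, β) ∈ polydisc r ν G) (Λ : Set (E d)) :
    Summable fun n : ℕ × ℕ =>
      ‖clusterIntegral (volume.restrict Λ) r ν G η n.1 n.2 * z ^ n.1 * β ^ n.2‖ := by
  have h := summable_pottsCluster hG hGi hrc hνc' η hη _ hD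
  have h2 := fun n => norm_clusterIntegral_le ν hG hGi hrc hνc' η hη Λ n z β
  dsimp only at h
  generalize hf : (fun n : ℕ × ℕ => ‖z‖ ^ n.1 * ‖β‖ ^ n.2 /
    ((n.1.factorial : ℝ) * (n.2.factorial : ℝ)) *
    ∫ q, ‖pottsCluster G η q‖ ∂(clusterMeasure d r ν n.1 n.2)) = f at h
  refine Summable.of_nonneg_of_le (fun _ => norm_nonneg _) (fun n => ?_) h
  rw [← hf]
  exact h2 n

/-- The cluster expansion in a finite volume. -/
theorem corr_eq_tsum
    (hν : ∀ A, MeasurableSet A → ν A = starRingEnd ℂ (ν ((fun α => -α) ⁻¹' A)))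
    (hG : Measurable G) (hGi : Integrable G) (hGe : ∀ x, G (-x) = G x) {c c' : ℝ}
    (hrc : r.support ⊆ Set.Icc (-c) c) (hνc' : (modulus ν).support ⊆ Set.Icc (-c') c')
    {η : E d →₀ ℝ} (hη : η ∈ Gamma0 d c) {z β : ℝ} (hz : 0 ≤ z)
    (hD : ((z : ℂ), (β : ℂ)) ∈ polydisc r ν G)
    (Λ : TopologicalSpace.Compacts (E d)) (hΛ : (η.support : Set (E d)) ⊆ Λ) :
    (corr r ν G z β Λ η : ℂ) = ∑' n : ℕ × ℕ,
      clusterIntegral (volume.restrict (Λ : Set (E d))) r ν G η n.1 n.2 *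
        (z : ℂ) ^ n.1 * (β : ℂ) ^ n.2 := by
  rw [corr_eq_div ν r Λ hΛ, Complex.ofReal_div]
  exact div_eq_tsum_of_convolution
    (weightIntegral_eq_sum ν hG
      (integrable_pottsCluster_box ν hG hGi hrc hνc' η hη (Λ : Set (E d))))
    (hasSum_partitionFunction (r := r) ν hν hG hGe hz β Λ η)
    (hasSum_partitionFunction (r := r) ν hν hG hGe hz β Λ 0)
    (summable_norm_weightIntegral (m := volume.restrict (Λ : Set (E d))) (r := r) ν hG 0
      (z : ℂ) (β : ℂ))
    (summable_norm_clusterIntegral ν hG hGi hrc hνc' hη hD _)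
    (mul_ne_zero (Complex.exp_ne_zero _) (Complex.exp_ne_zero _))
    (Complex.ofReal_ne_zero.2 (partitionFunction_pos (r := r) ν hν hG hz β Λ 0).ne')

end Correlation

/-! ### Infinite-volume limit along compact sets -/

theorem isCountablyGenerated_atTop_compacts (d : ℕ) :
    (atTop : Filter (TopologicalSpace.Compacts (E d))).IsCountablyGenerated := by
  -- Closed balls of integer radius are cofinal among the compact sets; dominated convergence of
  -- integrals needs a countably generated filter.
  let K : ℕ → TopologicalSpace.Compacts (E d) := fun n =>
    ⟨Metric.closedBall 0 n, isCompact_closedBall 0 (n : ℝ)⟩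
  have hK : ∀ Λ : TopologicalSpace.Compacts (E d), ∃ n, Λ ≤ K n := by
    intro Λ
    obtain ⟨R, hR⟩ := Λ.isCompact.isBounded.subset_closedBall 0
    obtain ⟨n, hn⟩ := exists_nat_ge R
    exact ⟨n, hR.trans (Metric.closedBall_subset_closedBall hn)⟩
  have hb : (atTop : Filter (TopologicalSpace.Compacts (E d))).HasBasis (fun _ : ℕ => True)
      (fun n => Set.Ici (K n)) := by
    refine ⟨fun t => ⟨fun ht => ?_, fun ⟨n, _, hn⟩ => mem_of_superset (Ici_mem_atTop _) hn⟩⟩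
    obtain ⟨Λ, hΛ⟩ := mem_atTop_sets.1 ht
    obtain ⟨n, hn⟩ := hK Λ
    exact ⟨n, trivial, fun Λ' h => hΛ Λ' (hn.trans h)⟩
  exact HasCountableBasis.isCountablyGenerated ⟨hb, Set.to_countable _⟩

theorem eventually_finite_subset {d : ℕ} {s : Set (E d)} (hs : s.Finite) :
    ∀ᶠ Λ : TopologicalSpace.Compacts (E d) in atTop, s ⊆ Λ := by
  filter_upwards [eventually_ge_atTop (⟨s, hs.isCompact⟩ : TopologicalSpace.Compacts (E d))]
    with Λ hΛ
  exact hΛ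

theorem eventually_mem_boxSet {d n₁ n₂ : ℕ}
    (p : (Fin n₁ → MarkedPoint d) × (Fin n₂ → MarkedPoint d)) :
    ∀ᶠ Λ : TopologicalSpace.Compacts (E d) in atTop, p ∈ boxSet (Λ : Set (E d)) n₁ n₂ := by
  filter_upwards [eventually_finite_subset (Set.finite_range fun i => (p.1 i).1),
    eventually_finite_subset (Set.finite_range fun i => (p.2 i).1)] with Λ h1 h2
  exact ⟨fun i _ => ⟨h1 ⟨i, rfl⟩, trivial⟩, fun i _ => ⟨h2 ⟨i, rfl⟩, trivial⟩⟩

theorem measurableSet_boxSet {d : ℕ} {Λ : Set (E d)} (hΛ : MeasurableSet Λ) (n₁ n₂ : ℕ) :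
    MeasurableSet (boxSet Λ n₁ n₂) :=
  (MeasurableSet.univ_pi fun _ => hΛ.prod MeasurableSet.univ).prod
    (MeasurableSet.univ_pi fun _ => hΛ.prod MeasurableSet.univ)

section Limit

variable {d : ℕ} (m : Measure (E d)) [SigmaFinite m] (r : Measure ℝ) [IsFiniteMeasure r]
  (ν : ComplexMeasure ℝ)

/-- Every finite family of points is eventually contained in `Λ`, so the indicators converge
pointwise, dominated by `‖f‖`. -/
theorem tendsto_integral_boxMeasure {n₁ n₂ : ℕ}
    {f : (Fin n₁ → MarkedPoint d) × (Fin n₂ → MarkedPoint d) → ℂ}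
    (hf : Integrable f (boxMeasure m r ν n₁ n₂)) :
    Tendsto (fun Λ : TopologicalSpace.Compacts (E d) =>
      ∫ p, f p ∂(boxMeasure (m.restrict (Λ : Set (E d))) r ν n₁ n₂)) atTop
      (𝓝 (∫ p, f p ∂(boxMeasure m r ν n₁ n₂))) := by
  have := isCountablyGenerated_atTop_compacts d
  have hm : ∀ Λ : TopologicalSpace.Compacts (E d), MeasurableSet (boxSet (Λ : Set (E d)) n₁ n₂) :=
    fun Λ => measurableSet_boxSet Λ.isCompact.isClosed.measurableSet n₁ n₂
  have h : ∀ Λ : TopologicalSpace.Compacts (E d),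
      ∫ p, f p ∂(boxMeasure (m.restrict (Λ : Set (E d))) r ν n₁ n₂) =
        ∫ p, (boxSet (Λ : Set (E d)) n₁ n₂).indicator f p ∂(boxMeasure m r ν n₁ n₂) := by
    intro Λ
    rw [boxMeasure_restrict, integral_indicator (hm Λ)]
  simp_rw [h]
  refine tendsto_integral_filter_of_dominated_convergence (fun p => ‖f p‖)
    (Eventually.of_forall fun Λ => hf.aestronglyMeasurable.indicator (hm Λ))
    (Eventually.of_forall fun Λ => ae_of_all _ fun p => norm_indicator_le_norm_self _ _)
    hf.norm (ae_of_all _ fun p => ?_)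
  refine tendsto_const_nhds.congr' ?_
  filter_upwards [eventually_mem_boxSet p] with Λ hΛ
  rw [Set.indicator_of_mem hΛ]

theorem tendsto_clusterIntegral {G : E d → ℝ} {η : E d →₀ ℝ} {n₁ n₂ : ℕ}
    (hφ : Integrable (fun p => pottsCluster G η p) (boxMeasure m r ν n₁ n₂)) :
    Tendsto (fun Λ : TopologicalSpace.Compacts (E d) =>
      clusterIntegral (m.restrict (Λ : Set (E d))) r ν G η n₁ n₂) atTop
      (𝓝 (clusterIntegral m r ν G η n₁ n₂)) :=
  (tendsto_integral_boxMeasure m r ν (integrable_mul_densityProd ν hφ)).const_mul _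

end Limit

section Thermodynamic

variable {d : ℕ} {r : Measure ℝ} [IsProbabilityMeasure r] (ν : ComplexMeasure ℝ) {G : E d → ℝ}
  {c c' : ℝ}

theorem summable_norm_clusterCoeff (hG : Measurable G) (hGi : Integrable G)
    (hrc : r.support ⊆ Set.Icc (-c) c) (hνc' : (modulus ν).support ⊆ Set.Icc (-c') c')
    {η : E d →₀ ℝ} (hη : η ∈ Gamma0 d c) {z β : ℂ} (hD : (z, β) ∈ polydisc r ν G) :
    Summable fun n : ℕ × ℕ => ‖clusterCoeff r ν G η n.1 n.2 * z ^ n.1 * β ^ n.2‖ := by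
  have h := summable_norm_clusterIntegral ν hG hGi hrc hνc' hη hD Set.univ
  rw [Measure.restrict_univ] at h
  exact h

/-- Each coefficient converges, and the `L¹` norms over all of space give a summable majorant
independent of `Λ`, so the series converges as well. -/
theorem tendsto_ofReal_corr
    (hν : ∀ A, MeasurableSet A → ν A = starRingEnd ℂ (ν ((fun α => -α) ⁻¹' A)))
    (hG : Measurable G) (hGi : Integrable G) (hGe : ∀ x, G (-x) = G x)
    (hrc : r.support ⊆ Set.Icc (-c) c) (hνc' : (modulus ν).support ⊆ Set.Icc (-c') c')
    {η : E d →₀ ℝ} (hη : η ∈ Gamma0 d c) {z β : ℝ} (hz : 0 ≤ z)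
    (hD : ((z : ℂ), (β : ℂ)) ∈ polydisc r ν G) :
    Tendsto (fun Λ : TopologicalSpace.Compacts (E d) => (corr r ν G z β Λ η : ℂ)) atTop
      (𝓝 (∑' n : ℕ × ℕ, clusterCoeff r ν G η n.1 n.2 * (z : ℂ) ^ n.1 * (β : ℂ) ^ n.2)) := by
  have hs := summable_pottsCluster hG hGi hrc hνc' η hη _ hD
  have hlim : ∀ n : ℕ × ℕ, Tendsto (fun Λ : TopologicalSpace.Compacts (E d) =>
      clusterIntegral (volume.restrict (Λ : Set (E d))) r ν G η n.1 n.2 *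
        (z : ℂ) ^ n.1 * (β : ℂ) ^ n.2) atTop
      (𝓝 (clusterCoeff r ν G η n.1 n.2 * (z : ℂ) ^ n.1 * (β : ℂ) ^ n.2)) := fun n =>
    ((tendsto_clusterIntegral volume r ν
      (integrable_pottsCluster (ν := ν) hG hGi hrc hνc' η hη n.1 n.2)).mul_const _).mul_const _
  have hb := fun (Λ : TopologicalSpace.Compacts (E d)) (n : ℕ × ℕ) =>
    norm_clusterIntegral_le ν hG hGi hrc hνc' η hη (Λ : Set (E d)) n (z : ℂ) (β : ℂ)
  dsimp only at hs
  refine (tendsto_tsum_of_dominated_convergence hs hlim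
    (Eventually.of_forall hb)).congr' ?_
  filter_upwards [eventually_finite_subset η.support.finite_toSet] with Λ hΛ
  exact (corr_eq_tsum ν hν hG hGi hGe hrc hνc' hη hz hD Λ hΛ).symm

/-- The infinite volume limit and its cluster expansion. -/
theorem tendsto_corr
    (hν : ∀ A, MeasurableSet A → ν A = starRingEnd ℂ (ν ((fun α => -α) ⁻¹' A)))
    (hG : Measurable G) (hGi : Integrable G) (hGe : ∀ x, G (-x) = G x)
    (hrc : r.support ⊆ Set.Icc (-c) c) (hνc' : (modulus ν).support ⊆ Set.Icc (-c') c')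
    {η : E d →₀ ℝ} (hη : η ∈ Gamma0 d c) {z β : ℝ} (hz : 0 ≤ z)
    (hD : ((z : ℂ), (β : ℂ)) ∈ polydisc r ν G) :
    Tendsto (fun Λ : TopologicalSpace.Compacts (E d) => corr r ν G z β Λ η) atTop
      (𝓝 (∑' n : ℕ × ℕ, clusterCoeff r ν G η n.1 n.2 * (z : ℂ) ^ n.1 * (β : ℂ) ^ n.2).re) ∧
    (∑' n : ℕ × ℕ, clusterCoeff r ν G η n.1 n.2 * (z : ℂ) ^ n.1 * (β : ℂ) ^ n.2).im = 0 := by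
  have h := tendsto_ofReal_corr ν hν hG hGi hGe hrc hνc' hη hz hD
  refine ⟨(Complex.continuous_re.tendsto _).comp h, ?_⟩
  -- The sum is real as a limit of the real numbers `ρ_Λ(η)`.
  have h2 := (Complex.continuous_im.tendsto _).comp h
  refine tendsto_nhds_unique h2 ?_
  simp only [Function.comp_def, Complex.ofReal_im]
  exact tendsto_const_nhds

end Thermodynamic

/-- Summation of a double power series over the first index first. -/
theorem hasSum_iterated {a : ℕ → ℕ → ℂ} {z β : ℂ} {S : ℂ}
    (h : HasSum (fun n : ℕ × ℕ => a n.1 n.2 * z ^ n.1 * β ^ n.2) S) :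
    HasSum (fun n₂ : ℕ => (∑' n₁ : ℕ, a n₁ n₂ * z ^ n₁) * β ^ n₂) S := by
  have h1 : HasSum (fun n : ℕ × ℕ => a n.2 n.1 * z ^ n.2 * β ^ n.1) S :=
    (Equiv.prodComm ℕ ℕ).hasSum_iff.2 h
  have h2 := h1.prod_fiberwise fun n₂ => (h1.summable.prod_factor n₂).hasSum
  simpa only [tsum_mul_right] using h2

/-! ### Analyticity of double power series -/

/-- The multilinear map with diagonal `z ^ i β ^ (n - i)`. -/
def monomialMap (n i : ℕ) : ContinuousMultilinearMap ℂ (fun _ : Fin n => ℂ × ℂ) ℂ :=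
  (ContinuousMultilinearMap.mkPiAlgebra ℂ (Fin n) ℂ).compContinuousLinearMap fun k =>
    if (k : ℕ) < i then ContinuousLinearMap.fst ℂ ℂ ℂ else ContinuousLinearMap.snd ℂ ℂ ℂ

theorem monomialMap_apply (i j : ℕ) (p : ℂ × ℂ) :
    monomialMap (i + j) i (fun _ => p) = p.1 ^ i * p.2 ^ j := by
  have h : monomialMap (i + j) i (fun _ => p) =
      ∏ k : Fin (i + j), if (k : ℕ) < i then p.1 else p.2 := by
    rw [monomialMap, ContinuousMultilinearMap.compContinuousLinearMap_apply,
      ContinuousMultilinearMap.mkPiAlgebra_apply]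
    refine Finset.prod_congr rfl fun k _ => ?_
    split_ifs <;> rfl
  rw [h, Fin.prod_univ_add]
  simp

/-- The norm of `ℂ × ℂ` is the maximum norm, so each coordinate projection is a contraction and the
unit ball is a polydisc. -/
theorem norm_monomialMap_le (n i : ℕ) : ‖monomialMap n i‖ ≤ 1 := by
  refine ContinuousMultilinearMap.opNorm_le_bound zero_le_one fun v => ?_
  rw [monomialMap, ContinuousMultilinearMap.compContinuousLinearMap_apply,
    ContinuousMultilinearMap.mkPiAlgebra_apply, norm_prod, one_mul]
  refine Finset.prod_le_prod (fun _ _ => norm_nonneg _) fun k _ => ?_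
  split_ifs
  · exact norm_fst_le (v k)
  · exact norm_snd_le (v k)

/-- The formal power series `∑ a i j z ^ i β ^ j`. -/
def doubleSeries (a : ℕ → ℕ → ℂ) : FormalMultilinearSeries ℂ (ℂ × ℂ) ℂ := fun n =>
  ∑ k ∈ Finset.HasAntidiagonal.antidiagonal n, a k.1 k.2 • monomialMap n k.1

theorem doubleSeries_apply (a : ℕ → ℕ → ℂ) (n : ℕ) (p : ℂ × ℂ) :
    doubleSeries a n (fun _ => p) = ∑ k ∈ Finset.HasAntidiagonal.antidiagonal n,
      a k.1 k.2 * p.1 ^ k.1 * p.2 ^ k.2 := by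
  rw [doubleSeries, sum_apply]
  refine Finset.sum_congr rfl fun k hk => ?_
  rw [Finset.HasAntidiagonal.mem_antidiagonal] at hk
  subst hk
  rw [smul_apply, monomialMap_apply, smul_eq_mul, mul_assoc]

theorem hasSum_antidiagonal {R : Type*} [AddCommMonoid R] [TopologicalSpace R] [ContinuousAdd R]
    [RegularSpace R] {f : ℕ × ℕ → R} {S : R} (h : HasSum f S) :
    HasSum (fun n => ∑ k ∈ Finset.HasAntidiagonal.antidiagonal n, f k) S := by
  have h1 := (Finset.HasAntidiagonal.sigmaAntidiagonalEquivProd (A := ℕ)).hasSum_iff.2 h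
  refine h1.sigma fun n => ?_
  rw [← Finset.sum_coe_sort]
  exact hasSum_fintype _

theorem hasFPowerSeriesOnBall_doubleSeries {a : ℕ → ℕ → ℂ}
    (ha : Summable fun n : ℕ × ℕ => ‖a n.1 n.2‖) :
    HasFPowerSeriesOnBall (fun p : ℂ × ℂ => ∑' n : ℕ × ℕ, a n.1 n.2 * p.1 ^ n.1 * p.2 ^ n.2)
      (doubleSeries a) 0 1 where
  r_le := by
    have h : Summable fun n => ‖doubleSeries a n‖ * ((1 : NNReal) : ℝ) ^ n := by
      refine Summable.of_nonneg_of_le (fun _ => by positivity) (fun n => ?_)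
        (hasSum_antidiagonal ha.hasSum).summable
      rw [NNReal.coe_one, one_pow, mul_one, doubleSeries]
      refine (norm_sum_le _ _).trans (Finset.sum_le_sum fun k _ => ?_)
      rw [norm_smul]
      exact mul_le_of_le_one_right (norm_nonneg _) (norm_monomialMap_le _ _)
    exact_mod_cast (doubleSeries a).le_radius_of_summable_norm h
  r_pos := zero_lt_one
  hasSum := by
    intro p hp
    have hp' : ‖p‖ < 1 := by
      rw [Metric.mem_eball, edist_zero_right] at hp
      rw [← ofReal_norm, ENNReal.ofReal_lt_one] at hp
      exact hp
    simp_rw [doubleSeries_apply, zero_add]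
    refine hasSum_antidiagonal (f := fun n : ℕ × ℕ => a n.1 n.2 * p.1 ^ n.1 * p.2 ^ n.2)
      (Summable.hasSum (Summable.of_norm_bounded ha fun n => ?_))
    rw [norm_mul, norm_mul, norm_pow, norm_pow, mul_assoc]
    refine mul_le_of_le_one_right (norm_nonneg _) (mul_le_one₀ ?_ (by positivity) ?_)
    · exact pow_le_one₀ (norm_nonneg _) ((norm_fst_le p).trans hp'.le)
    · exact pow_le_one₀ (norm_nonneg _) ((norm_snd_le p).trans hp'.le)

/-- Rescaling the variables by `R₁` and `R₂` carries the polydisc of these radii to the unit ball.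
-/
theorem analyticAt_tsum_natProd {a : ℕ → ℕ → ℂ} {p : ℂ × ℂ} {R₁ R₂ : ℝ} (h₁ : ‖p.1‖ < R₁)
    (h₂ : ‖p.2‖ < R₂)
    (ha : Summable fun n : ℕ × ℕ => ‖a n.1 n.2 * (R₁ : ℂ) ^ n.1 * (R₂ : ℂ) ^ n.2‖) :
    AnalyticAt ℂ (fun p : ℂ × ℂ => ∑' n : ℕ × ℕ, a n.1 n.2 * p.1 ^ n.1 * p.2 ^ n.2) p := by
  have hR₁ : 0 < R₁ := (norm_nonneg _).trans_lt h₁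
  have hR₂ : 0 < R₂ := (norm_nonneg _).trans_lt h₂
  have hc₁ : (R₁ : ℂ) ≠ 0 := Complex.ofReal_ne_zero.2 hR₁.ne'
  have hc₂ : (R₂ : ℂ) ≠ 0 := Complex.ofReal_ne_zero.2 hR₂.ne'
  set b : ℕ → ℕ → ℂ := fun i j => a i j * (R₁ : ℂ) ^ i * (R₂ : ℂ) ^ j with hb
  set L : ℂ × ℂ → ℂ × ℂ := fun q => (q.1 / R₁, q.2 / R₂) with hL
  have hLa : AnalyticAt ℂ L p := (analyticAt_fst.div_const).prod (analyticAt_snd.div_const)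
  have hmem : L p ∈ Metric.eball (0 : ℂ × ℂ) 1 := by
    rw [Metric.mem_eball, edist_zero_right, ← ofReal_norm, ENNReal.ofReal_lt_one, hL,
      Prod.norm_def, max_lt_iff]
    simp only [norm_div, Complex.norm_real, Real.norm_eq_abs, abs_of_pos hR₁, abs_of_pos hR₂]
    exact ⟨(div_lt_one hR₁).2 h₁, (div_lt_one hR₂).2 h₂⟩
  have h := ((hasFPowerSeriesOnBall_doubleSeries (a := b) ha).analyticAt_of_mem hmem).comp hLa
  refine h.congr (Eventually.of_forall fun q => tsum_congr fun n => ?_)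
  simp only [hb, hL, div_pow]
  field_simp

/-- Analyticity at a point requires absolute convergence at strictly larger radii; the strict
inequality provides them. -/
theorem exists_lt_radius {C : ENNReal} (hC : C < ⊤) (b : ℂ)
    (h : ENNReal.ofReal (Real.exp 1) * C * ‖b‖ₑ < 1) :
    ∃ R : ℝ, ‖b‖ < R ∧ ENNReal.ofReal (Real.exp 1) * C * ‖(R : ℂ)‖ₑ < 1 := by
  obtain ⟨a, ha, hCa, hb⟩ := exists_pos_bound hC b h
  have he := Real.exp_pos 1
  have h1 : ‖b‖ < 1 / (Real.exp 1 * a) := by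
    rw [lt_div_iff₀ (by positivity)]
    linarith
  obtain ⟨R, hR, hR'⟩ := exists_between h1
  have hR0 : 0 < R := (norm_nonneg _).trans_lt hR
  refine ⟨R, hR, ?_⟩
  calc _ ≤ ENNReal.ofReal (Real.exp 1) * ENNReal.ofReal a * ‖(R : ℂ)‖ₑ := by gcongr
    _ = ENNReal.ofReal (Real.exp 1 * a * R) := by
      rw [← ofReal_norm, Complex.norm_real, Real.norm_eq_abs, abs_of_pos hR0,
        ← ENNReal.ofReal_mul he.le, ← ENNReal.ofReal_mul (by positivity)]
    _ < 1 := by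
      rw [ENNReal.ofReal_lt_one]
      rw [lt_div_iff₀ (by positivity)] at hR'
      linarith

section Analytic

variable {d : ℕ} {r : Measure ℝ} [IsProbabilityMeasure r] (ν : ComplexMeasure ℝ) {G : E d → ℝ}
  {c c' : ℝ}

/-- The cluster expansion as a function of complex parameters. -/
def clusterSeries (r : Measure ℝ) (ν : ComplexMeasure ℝ) (G : E d → ℝ) (η : E d →₀ ℝ)
    (p : ℂ × ℂ) : ℂ :=
  ∑' n : ℕ × ℕ, clusterCoeff r ν G η n.1 n.2 * p.1 ^ n.1 * p.2 ^ n.2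

theorem analyticOnNhd_clusterSeries (hG : Measurable G) (hGi : Integrable G)
    (hrc : r.support ⊆ Set.Icc (-c) c) (hνc' : (modulus ν).support ⊆ Set.Icc (-c') c')
    {η : E d →₀ ℝ} (hη : η ∈ Gamma0 d c) :
    AnalyticOnNhd ℂ (clusterSeries r ν G η) (polydisc r ν G) := by
  intro p hp
  obtain ⟨R₁, h₁, h₁'⟩ := exists_lt_radius (C₂_lt_top hG hGi hrc hνc') p.1 hp.1
  obtain ⟨R₂, h₂, h₂'⟩ := exists_lt_radius (C₁_lt_top hG hGi hrc hνc') p.2 hp.2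
  exact analyticAt_tsum_natProd h₁ h₂ (summable_norm_clusterCoeff ν hG hGi hrc hνc' hη ⟨h₁', h₂'⟩)

theorem analyticOnNhd_re_clusterSeries (hG : Measurable G) (hGi : Integrable G)
    (hrc : r.support ⊆ Set.Icc (-c) c) (hνc' : (modulus ν).support ⊆ Set.Icc (-c') c')
    {η : E d →₀ ℝ} (hη : η ∈ Gamma0 d c) :
    AnalyticOnNhd ℝ (fun p : ℝ × ℝ => (clusterSeries r ν G η (p.1, p.2)).re)
      {p : ℝ × ℝ | ((p.1 : ℂ), (p.2 : ℂ)) ∈ polydisc r ν G} := by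
  intro p hp
  have h := (analyticOnNhd_clusterSeries ν hG hGi hrc hνc' hη _ hp).restrictScalars (𝕜 := ℝ)
  have h1 : AnalyticAt ℝ (fun p : ℝ × ℝ => ((p.1 : ℂ), (p.2 : ℂ))) p :=
    ((Complex.ofRealCLM.analyticAt _).comp analyticAt_fst).prod
      ((Complex.ofRealCLM.analyticAt _).comp analyticAt_snd)
  exact (Complex.reCLM.analyticAt _).comp (AnalyticAt.fun_comp h h1)

end Analytic

/-! ### Dependence on the almost everywhere class of the potential -/

section AlmostEverywhere

variable {d : ℕ}

/-- An almost everywhere even function has a measurable and even representative. -/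
theorem exists_measurable_even {G : E d → ℝ} (hG : AEMeasurable G volume)
    (hGe : (fun x => G (-x)) =ᵐ[volume] G) :
    ∃ G' : E d → ℝ, Measurable G' ∧ (∀ x, G' (-x) = G' x) ∧ G =ᵐ[volume] G' := by
  -- Symmetrizing a measurable version makes evenness exact.
  refine ⟨fun x => (hG.mk G x + hG.mk G (-x)) / 2, ?_, fun x => ?_, ?_⟩
  · exact (hG.measurable_mk.add (hG.measurable_mk.comp measurable_neg)).div_const 2
  · simp only [neg_neg]
    rw [add_comm]
  · have h := (Measure.measurePreserving_neg (volume : Measure (E d))).quasiMeasurePreserving.ae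
      hG.ae_eq_mk
    filter_upwards [hG.ae_eq_mk, h, hGe] with x h1 h2 h3
    rw [← h1, ← h2, h3]
    ring

theorem ae_sub_right {G G' : E d → ℝ} (h : G =ᵐ[volume] G') (y : E d) :
    ∀ᵐ x, G (x - y) = G' (x - y) :=
  (measurePreserving_sub_right volume y).quasiMeasurePreserving.ae h

theorem ae_sub_left {G G' : E d → ℝ} (h : G =ᵐ[volume] G') (x : E d) :
    ∀ᵐ y, G (x - y) = G' (x - y) :=
  (quasiMeasurePreserving_sub_left volume x).ae h

theorem field_ae_eq {G G' : E d → ℝ} (h : G =ᵐ[volume] G') (ζ : E d →₀ ℝ) :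
    field G ζ =ᵐ[volume] field G' ζ := by
  have h1 : ∀ᵐ x : E d, ∀ y : ζ.support, G (x - y) = G' (x - y) :=
    ae_all_iff.2 fun y => ae_sub_right h y
  filter_upwards [h1] with x hx
  exact Finset.sum_congr rfl fun y hy => congrArg (ζ y * ·) (hx ⟨y, hy⟩)

variable {G G' : E d → ℝ} (r : Measure ℝ) (ν : ComplexMeasure ℝ)

theorem interaction_congr_ae (h : G =ᵐ[volume] G') (Λ : TopologicalSpace.Compacts (E d))
    (ζ : E d →₀ ℝ) : interaction ν G Λ ζ = interaction ν G' Λ ζ := by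
  refine integral_congr_ae (ae_restrict_of_ae ?_)
  filter_upwards [field_ae_eq h ζ] with x hx
  rw [hx]

theorem corr_congr_ae (h : G =ᵐ[volume] G') (z β : ℝ) (Λ : TopologicalSpace.Compacts (E d))
    (η : E d →₀ ℝ) : corr r ν G z β Λ η = corr r ν G' z β Λ η := by
  unfold corr
  simp_rw [interaction_congr_ae ν h]

theorem C₁_congr_ae (h : G =ᵐ[volume] G') : C₁ r ν G = C₁ r ν G' := by
  unfold C₁
  refine iSup_congr fun y => iSup_congr fun s => iSup_congr fun _ => lintegral_congr_ae ?_
  filter_upwards [ae_sub_left h y] with x hx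
  rw [hx]

theorem C₂_congr_ae (h : G =ᵐ[volume] G') : C₂ r ν G = C₂ r ν G' := by
  unfold C₂
  refine iSup_congr fun y => iSup_congr fun s => iSup_congr fun _ => lintegral_congr_ae ?_
  filter_upwards [ae_sub_right h y] with x hx
  rw [hx]

theorem polydisc_congr_ae (h : G =ᵐ[volume] G') : polydisc r ν G = polydisc r ν G' := by
  unfold polydisc
  rw [C₁_congr_ae r ν h, C₂_congr_ae r ν h]

theorem quasiMeasurePreserving_sub_second (m : Measure (E d)) [SigmaFinite m]
    [m.IsAddLeftInvariant] (k : Measure ℝ) [IsFiniteMeasure k] {n : ℕ} (x : E d) (j : Fin n) :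
    Measure.QuasiMeasurePreserving (fun p : Fin n → MarkedPoint d => x - (p j).1)
      (Measure.pi fun _ => m.prod k) m :=
  (quasiMeasurePreserving_sub_left m x).comp (Measure.quasiMeasurePreserving_fst.comp
    (Measure.quasiMeasurePreserving_eval (μ := fun _ : Fin n => m.prod k) j))

/-- Almost no pair of points has its difference in a given null set: with the first point fixed,
reflection and translation preserve null sets. Hence cluster functions depend only on the class of
`G`. -/
theorem quasiMeasurePreserving_sub_first_second (m : Measure (E d)) [SigmaFinite m]
    [m.IsAddLeftInvariant] (r : Measure ℝ) [IsFiniteMeasure r] {n₁ n₂ : ℕ} (i : Fin n₁)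
    (j : Fin n₂) :
    Measure.QuasiMeasurePreserving
      (fun p : (Fin n₁ → MarkedPoint d) × (Fin n₂ → MarkedPoint d) => (p.1 i).1 - (p.2 j).1)
      (boxMeasure m r ν n₁ n₂) m := by
  have hf : Measurable fun p : (Fin n₁ → MarkedPoint d) × (Fin n₂ → MarkedPoint d) =>
      (p.1 i).1 - (p.2 j).1 :=
    (measurable_fst.comp ((measurable_pi_apply i).comp measurable_fst)).sub
      (measurable_fst.comp ((measurable_pi_apply j).comp measurable_snd))
  exact QuasiMeasurePreserving.prod_of_right hf (ae_of_all _ fun p =>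
    quasiMeasurePreserving_sub_second m (modulus ν) (p i).1 j)

theorem pottsCluster_ae_eq [IsFiniteMeasure r] (h : G =ᵐ[volume] G') (η : E d →₀ ℝ)
    (n₁ n₂ : ℕ) :
    (fun p => pottsCluster G η p) =ᵐ[clusterMeasure d r ν n₁ n₂] fun p => pottsCluster G' η p := by
  have h1 : ∀ᵐ p ∂(boxMeasure volume r ν n₁ n₂), ∀ (i : Fin n₁) (j : Fin n₂),
      G ((p.1 i).1 - (p.2 j).1) = G' ((p.1 i).1 - (p.2 j).1) :=
    ae_all_iff.2 fun i => ae_all_iff.2 fun j =>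
      (quasiMeasurePreserving_sub_first_second ν volume r i j).ae h
  have h2 : ∀ᵐ p ∂(boxMeasure volume r ν n₁ n₂), ∀ (x : η.support) (j : Fin n₂),
      G (x - (p.2 j).1) = G' (x - (p.2 j).1) :=
    ae_all_iff.2 fun x => ae_all_iff.2 fun j => (quasiMeasurePreserving_second r ν volume j).ae
      ((Measure.quasiMeasurePreserving_fst (μ := volume) (ν := modulus ν)).ae (ae_sub_left h x))
  filter_upwards [h1, h2] with p hp hp'
  refine pottsCluster_congr fun i j => ?_
  rcases i with i | i | i <;> rcases j with j | j | j <;> try rfl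
  · exact congrArg _ (hp' i j)
  · exact congrArg _ (hp i j)

theorem clusterCoeff_congr_ae [IsFiniteMeasure r] (h : G =ᵐ[volume] G') (η : E d →₀ ℝ)
    (n₁ n₂ : ℕ) : clusterCoeff r ν G η n₁ n₂ = clusterCoeff r ν G' η n₁ n₂ := by
  unfold clusterCoeff
  congr 1
  refine integral_congr_ae ?_
  filter_upwards [pottsCluster_ae_eq r ν h η n₁ n₂] with p hp
  rw [hp]

end AlmostEverywhere

/-! ### Euclidean invariance -/

section Euclidean

variable {d : ℕ}

/-- Move the positions of all points. -/
def movePositions (f : E d → E d) {n₁ n₂ : ℕ}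
    (p : (Fin n₁ → MarkedPoint d) × (Fin n₂ → MarkedPoint d)) :
    (Fin n₁ → MarkedPoint d) × (Fin n₂ → MarkedPoint d) :=
  (fun i => Prod.map f id (p.1 i), fun j => Prod.map f id (p.2 j))

theorem measurePreserving_movePositions (m : Measure (E d)) [SigmaFinite m] {r : Measure ℝ}
    [IsFiniteMeasure r] (ν : ComplexMeasure ℝ) {f : E d → E d} (hf : MeasurePreserving f m m)
    (n₁ n₂ : ℕ) :
    MeasurePreserving (movePositions f) (boxMeasure m r ν n₁ n₂) (boxMeasure m r ν n₁ n₂) := by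
  have h : ∀ (k : Measure ℝ) [IsFiniteMeasure k] (n : ℕ),
      MeasurePreserving (fun (p : Fin n → MarkedPoint d) i => Prod.map f id (p i))
        (Measure.pi fun _ => m.prod k) (Measure.pi fun _ => m.prod k) := fun k _ n =>
    measurePreserving_pi _ _ fun _ => hf.prod (MeasurePreserving.id k)
  exact (h r n₁).prod (h (modulus ν) n₂)

/-- The weights involve positions only through differences between points. A second potential `G'`
is allowed because `G` is rotation invariant only almost everywhere, whereas this identity is
pointwise. -/
theorem pottsCluster_mapDomain {f : E d → E d} (hf : Function.Injective f) {G G' : E d → ℝ}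
    (hG : ∀ x y, G (f x - f y) = G' (x - y)) (η : E d →₀ ℝ) {n₁ n₂ : ℕ}
    (p : (Fin n₁ → MarkedPoint d) × (Fin n₂ → MarkedPoint d)) :
    pottsCluster G (η.mapDomain f) (movePositions f p) = pottsCluster G' η p := by
  classical
  have hsupp : (η.mapDomain f).support = η.support.map ⟨f, hf⟩ := by
    rw [Finsupp.mapDomain_support_of_injective hf, Finset.map_eq_image]
    rfl
  let e₀ : η.support ≃ (η.mapDomain f).support :=
    Equiv.ofBijective (fun x => ⟨f x.1, hsupp ▸ Finset.mem_map_of_mem ⟨f, hf⟩ x.2⟩) (by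
      constructor
      · intro x y hxy
        exact Subtype.ext (hf (congrArg Subtype.val hxy))
      · rintro ⟨y, hy⟩
        have hy' := hy
        rw [hsupp, Finset.mem_map] at hy'
        obtain ⟨x, hx, rfl⟩ := hy'
        exact ⟨⟨x, hx⟩, rfl⟩)
  let e : η.support ⊕ (Fin n₁ ⊕ Fin n₂) ≃ (η.mapDomain f).support ⊕ (Fin n₁ ⊕ Fin n₂) :=
    Equiv.sumCongr e₀ (Equiv.refl _)
  have h1 : (Finset.univ.map Function.Embedding.inl :
      Finset ((η.mapDomain f).support ⊕ (Fin n₁ ⊕ Fin n₂))) =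
      (Finset.univ.map Function.Embedding.inl).map e.toEmbedding := by
    ext a
    rcases a with a | a
    · obtain ⟨b, rfl⟩ := e₀.surjective a
      simp [e]
    · simp [e]
  have h2 : (Finset.univ.map Function.Embedding.inr :
      Finset ((η.mapDomain f).support ⊕ (Fin n₁ ⊕ Fin n₂))) =
      (Finset.univ.map Function.Embedding.inr).map e.toEmbedding := by
    ext a
    rcases a with a | a <;> simp [e]
  unfold pottsCluster
  rw [h1, h2]
  refine (clusterFun_map e.toEmbedding _ (pottsWeight_empty _ _) _ _).trans ?_
  have h3 : (fun A => pottsWeight G (family (η.mapDomain f) (movePositions f p))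
      (A.map e.toEmbedding)) = pottsWeight G' (family η p) := by
    simp_rw [pottsWeight_map]
    refine pottsWeight_congr fun i j => ?_
    have hval : ∀ x : η.support, (η.mapDomain f) (f x) = η x := fun x =>
      Finsupp.mapDomain_apply hf η x
    rcases i with i | i | i <;> rcases j with j | j | j <;> try rfl
    · change (η.mapDomain f) (f i) * (p.2 j).2 * G (f i - f (p.2 j).1) = _
      rw [hval, hG]
      rfl
    · change (p.1 i).2 * (p.2 j).2 * G (f (p.1 i).1 - f (p.2 j).1) = _
      rw [hG]
      rfl
  rw [h3]

variable {r : Measure ℝ} [IsFiniteMeasure r] (ν : ComplexMeasure ℝ) {G : E d → ℝ}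

theorem clusterIntegral_mapDomain (m : Measure (E d)) [SigmaFinite m] (hG : Measurable G)
    {G' : E d → ℝ} {f : E d → E d} (hf : Function.Injective f) (hfm : MeasurePreserving f m m)
    (hGf : ∀ x y, G (f x - f y) = G' (x - y)) (η : E d →₀ ℝ) (n₁ n₂ : ℕ) :
    clusterIntegral m r ν G (η.mapDomain f) n₁ n₂ = clusterIntegral m r ν G' η n₁ n₂ := by
  have hmp := measurePreserving_movePositions m (r := r) ν hfm n₁ n₂
  have hmeas : Measurable fun p : (Fin n₁ → MarkedPoint d) × (Fin n₂ → MarkedPoint d) =>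
      pottsCluster G (η.mapDomain f) p * densityProd ν p :=
    (measurable_pottsCluster hG _ n₁ n₂).mul (measurable_densityProd ν n₁ n₂)
  have h := integral_map hmp.aemeasurable
    (hmeas.aestronglyMeasurable (μ := Measure.map (movePositions f) (boxMeasure m r ν n₁ n₂)))
  rw [hmp.map_eq] at h
  rw [clusterIntegral, clusterIntegral, h]
  congr 1
  refine integral_congr_ae (ae_of_all _ fun p => ?_)
  dsimp only
  rw [pottsCluster_mapDomain hf hGf]
  rfl

/-- The motion preserves Lebesgue measure, so a change of variables moves it from `η` to the
potential, where it becomes `G ∘ g⁻¹`; this agrees with `G` almost everywhere. -/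
theorem clusterCoeff_euclideanAction (hG : Measurable G)
    (hGinv : ∀ g : E d ≃ₗᵢ[ℝ] E d, (fun x => G (g x)) =ᵐ[volume] G) (η : E d →₀ ℝ)
    (g : E d ≃ₗᵢ[ℝ] E d) (a : E d) (n₁ n₂ : ℕ) :
    clusterCoeff r ν G (euclideanAction g a η) n₁ n₂ = clusterCoeff r ν G η n₁ n₂ := by
  have hf : Function.Injective fun y : E d => g.symm (y - a) :=
    g.symm.injective.comp (sub_left_injective)
  have hfm : MeasurePreserving (fun y : E d => g.symm (y - a)) volume volume :=
    g.symm.measurePreserving.comp (measurePreserving_sub_right volume a)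
  have hGf : ∀ x y, G (g.symm (x - a) - g.symm (y - a)) = (fun x => G (g.symm x)) (x - y) := by
    intro x y
    rw [← map_sub]
    simp
  rw [← clusterCoeff_congr_ae r ν (hGinv g.symm) η]
  exact clusterIntegral_mapDomain ν volume hG hf hfm hGf η n₁ n₂

theorem clusterSeries_euclideanAction (hG : Measurable G)
    (hGinv : ∀ g : E d ≃ₗᵢ[ℝ] E d, (fun x => G (g x)) =ᵐ[volume] G) (η : E d →₀ ℝ)
    (g : E d ≃ₗᵢ[ℝ] E d) (a : E d) :
    clusterSeries r ν G (euclideanAction g a η) = clusterSeries r ν G η := by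
  funext p
  unfold clusterSeries
  simp_rw [clusterCoeff_euclideanAction ν hG hGinv]

end Euclidean

end TrigGas

end

/-! ### Assembly of the theorem -/

theorem theorem6p1 (d : ℕ) (hd : 1 ≤ d)
    (r : Measure ℝ) [IsProbabilityMeasure r] (hr0 : r {0} = 0)
    (c : ℝ) (hc : 0 < c) (hrc : r.support ⊆ Set.Icc (-c) c)
    (ν : ComplexMeasure ℝ)
    (hν : ∀ A, MeasurableSet A → ν A = starRingEnd ℂ (ν ((fun α => -α) ⁻¹' A)))
    (c' : ℝ) (hc' : 0 < c') (hνc' : (TrigGas.modulus ν).support ⊆ Set.Icc (-c') c')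
    (G : TrigGas.E d → ℝ) (hG : Integrable G volume)
    (hGinv : ∀ g : TrigGas.E d ≃ₗᵢ[ℝ] TrigGas.E d, (fun x => G (g x)) =ᵐ[volume] G) :
    -- the coefficients of the expansion are given by absolutely convergent integrals,
    -- and the expansion converges absolutely for all complex parameters in the polydisc
    (∀ η ∈ TrigGas.Gamma0 d c, ∀ n₁ n₂ : ℕ,
      Integrable (fun p => TrigGas.pottsCluster G η p)
        (TrigGas.clusterMeasure d r ν n₁ n₂)) ∧
    (∀ η ∈ TrigGas.Gamma0 d c, ∀ p ∈ TrigGas.polydisc r ν G,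
      Summable fun n : ℕ × ℕ =>
        ‖p.1‖ ^ n.1 * ‖p.2‖ ^ n.2 / ((n.1.factorial : ℝ) * (n.2.factorial : ℝ)) *
          ∫ q, ‖TrigGas.pottsCluster G η q‖ ∂(TrigGas.clusterMeasure d r ν n.1 n.2)) ∧
    ∃ ρ : ℝ → ℝ → (TrigGas.E d →₀ ℝ) → ℝ,
      -- the infinite volume limit, its expansion in `z` and `β`, its expansion in `β`
      (∀ z β : ℝ, 0 < z → ((z : ℂ), (β : ℂ)) ∈ TrigGas.polydisc r ν G →
        ∀ η ∈ TrigGas.Gamma0 d c,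
          Tendsto (fun Λ : TopologicalSpace.Compacts (TrigGas.E d) =>
            TrigGas.corr r ν G z β Λ η) atTop (𝓝 (ρ z β η)) ∧
          HasSum (fun n : ℕ × ℕ => TrigGas.clusterCoeff r ν G η n.1 n.2 *
            (z : ℂ) ^ n.1 * (β : ℂ) ^ n.2) (ρ z β η : ℂ) ∧
          HasSum (fun n₂ : ℕ => (∑' n₁ : ℕ, TrigGas.clusterCoeff r ν G η n₁ n₂ *
            (z : ℂ) ^ n₁) * (β : ℂ) ^ n₂) (ρ z β η : ℂ)) ∧
      -- joint analyticity in `z` and `β`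
      (∀ η ∈ TrigGas.Gamma0 d c,
        AnalyticOnNhd ℝ (fun p : ℝ × ℝ => ρ p.1 p.2 η)
          {p : ℝ × ℝ | 0 < p.1 ∧ ((p.1 : ℂ), (p.2 : ℂ)) ∈ TrigGas.polydisc r ν G} ∧
        ∃ R : ℂ × ℂ → ℂ, AnalyticOnNhd ℂ R (TrigGas.polydisc r ν G) ∧
          ∀ z β : ℝ, 0 < z → ((z : ℂ), (β : ℂ)) ∈ TrigGas.polydisc r ν G →
            R ((z : ℂ), (β : ℂ)) = (ρ z β η : ℂ)) ∧
      -- Euclidean invariance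
      (∀ z β : ℝ, 0 < z → ((z : ℂ), (β : ℂ)) ∈ TrigGas.polydisc r ν G →
        ∀ η ∈ TrigGas.Gamma0 d c, ∀ (g : TrigGas.E d ≃ₗᵢ[ℝ] TrigGas.E d) (a : TrigGas.E d),
          ρ z β (TrigGas.euclideanAction g a η) = ρ z β η) := by
  classical
  -- The reflection `-1` belongs to `O(d)`, so the potential is even almost everywhere.
  obtain ⟨G', hG'm, hG'e, hae⟩ := TrigGas.exists_measurable_even hG.1.aemeasurable
    (hGinv (LinearIsometryEquiv.neg ℝ))
  have hG'i : Integrable G' volume := hG.congr hae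
  have hG'inv : ∀ g : TrigGas.E d ≃ₗᵢ[ℝ] TrigGas.E d, (fun x => G' (g x)) =ᵐ[volume] G' := by
    intro g
    have h := g.measurePreserving.quasiMeasurePreserving.ae hae
    filter_upwards [h, hGinv g, hae] with x h1 h2 h3
    rw [← h1, h2, h3]
  have hcl := fun η n₁ n₂ => TrigGas.pottsCluster_ae_eq r ν hae η n₁ n₂
  rw [TrigGas.polydisc_congr_ae r ν hae]
  simp_rw [TrigGas.corr_congr_ae r ν hae, TrigGas.clusterCoeff_congr_ae r ν hae]
  -- The witness `ρ` is the real part of the cluster series for all arguments; for real parameters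
  -- of the domain the series is real, so nothing is lost.
  refine ⟨fun η hη n₁ n₂ => ?_, fun η hη p hp => ?_, fun z β η =>
    (TrigGas.clusterSeries r ν G' η (z, β)).re, ?_, ?_, ?_⟩
  · exact (TrigGas.integrable_pottsCluster hG'm hG'i hrc hνc' η hη n₁ n₂).congr (hcl η n₁ n₂).symm
  · refine (TrigGas.summable_pottsCluster hG'm hG'i hrc hνc' η hη p hp).congr fun n => ?_
    congr 1
    refine integral_congr_ae ?_
    filter_upwards [hcl η n.1 n.2] with q hq
    rw [hq]
  · intro z β hz hD η hη
    obtain ⟨h1, h2⟩ := TrigGas.tendsto_corr ν hν hG'm hG'i hG'e hrc hνc' hη hz.le hD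
    have h3 := (TrigGas.summable_norm_clusterCoeff ν hG'm hG'i hrc hνc' hη hD).of_norm.hasSum
    have h4 : ((TrigGas.clusterSeries r ν G' η (z, β)).re : ℂ) =
        TrigGas.clusterSeries r ν G' η (z, β) := Complex.ext rfl h2.symm
    rw [h4]
    exact ⟨h1, h3, TrigGas.hasSum_iterated h3⟩
  · intro η hη
    refine ⟨(TrigGas.analyticOnNhd_re_clusterSeries ν hG'm hG'i hrc hνc' hη).mono
      fun p hp => hp.2, TrigGas.clusterSeries r ν G' η,
      TrigGas.analyticOnNhd_clusterSeries ν hG'm hG'i hrc hνc' hη, fun z β hz hD => ?_⟩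
    obtain ⟨-, h2⟩ := TrigGas.tendsto_corr ν hν hG'm hG'i hG'e hrc hνc' hη hz.le hD
    exact Complex.ext rfl h2
  · intro z β _ _ η _ g a
    dsimp only
    -- The coefficients agree one by one, so neither convergence nor the limit enters.
    rw [TrigGas.clusterSeries_euclideanAction ν hG'm hG'inv]
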